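/- **Setting.** Let $E$ be a finite set and $\lambda$ an integer-valued function on the subsets of $E$ with $\lambda(X)=\lambda(E-X)$ and $\lambda(X)+\lambda(Y)\ge\lambda(X\cup Y)+\lambda(X\cap Y)$ for all $X,Y\subseteq E$ (so $(E,\lambda)$ is a *connectivity system*), and let $k$ be a positive integer. A set $X\subseteq E$ is *$k$-separating*, and the unordered partition $(X,E-X)$ is a *$k$-separation*, if $\lambda(X)\le k$. A *tangle of order $k$* is a collection $\mathcal T$ of subsets of $E$ such that: (T1) $\lambda(A)<k$ for all $A\in\mathcal T$; (T2) if $\lambda(A)\le k-1$, then $A\in\mathcal T$ or $E-A\in\mathcal T$; (T3) no three members of $\mathcal T$ have union $E$; (T4) $E-\{e\}\notin\mathcal T$ for all $e\in E$. It is *robust* if $A_1\cup\dots\cup A_8\ne E$ for all $A_1,\dots,A_8\in\mathcal T$. A set is *$\mathcal T$-weak* if it is contained in a member of $\mathcal T$, and *$\mathcal T$-strong* otherwise; a partition of $E$ is $\mathcal T$-strong if all its parts are. **Equivalence.** A $\mathcal T$-strong $k$-separating set $X$ is *fully closed* if $\lambda(X\cup Y)>k$ for every non-empty $\mathcal T$-weak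 $Y\subseteq E-X$. The *full closure* $\mathrm{fcl}(X)$ of a $\mathcal T$-strong $k$-separating set $X$ is the intersection of all fully closed sets containing $X$. Two $\mathcal T$-strong $k$-separations $(X,Y)$ and $(X',Y')$ are *$\mathcal T$-equivalent* if $\{\mathrm{fcl}(X),\mathrm{fcl}(Y)\}=\{\mathrm{fcl}(X'),\mathrm{fcl}(Y')\}$. A $k$-separating set $X$ is *sequential* if $E-X$ is $\mathcal T$-strong and $\mathrm{fcl}(E-X)=E$. **Tree compatible sets.** Let $\mathcal S$ be a set of non-sequential $k$-separating sets with $\mathcal T$-strong complements. A *$(k,\mathcal S)$-separation* is a $k$-separation $(X,E-X)$ with $X,E-X\in\mathcal S$. The set $\mathcal S$ is *tree compatible* if: (S1) every $\mathcal T$-strong $k$-separation that is $\mathcal T$-equivalent to a $(k,\mathcal S)$-separation is a $(k,\mathcal S)$-separation; and (S2) if $X\in\mathcal S$, $(Y,E-Y)$ is a $\mathcal T$-strong $k$-separation and $X\subseteq Y$, then $Y\in\mathcal S$. **Flowers.** A *$k$-flower* in $\mathcal T$ is a $\mathcal T$-strong partition $\Phi=(P_1,\dots,P_n)$ of $E$,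 $n\ge1$, such that $P_i$ and $P_i\cup P_{i+1}$ are $k$-separating for all $i$ (indices modulo $n$); it *displays* the $k$-separations $(X,E-X)$ for which $X$ is a union of petals $P_i$. For non-empty $I\subseteq\{1,\dots,n\}$ let $P_I=\bigcup_{i\in I}P_i$. A $k$-flower is a *$k$-anemone* if every $P_I$ is $k$-separating, and a *$k$-daisy* if $P_I$ is $k$-separating exactly when $I$ is consecutive in the cyclic order. For collections (such as those displayed by two flowers or trees) of $k$-separations, write $\mathcal D\preccurlyeq_{\mathcal S}\mathcal D'$ if every $(k,\mathcal S)$-separation in $\mathcal D$ is $\mathcal T$-equivalent to some $(k,\mathcal S)$-separation in $\mathcal D'$. Two flowers are equivalent if $\preccurlyeq_{\mathcal S}$ holds in both directions between the collections that they display, and the *$\mathcal S$-order* of a flower is the minimum number of petals of a $k$-flower equivalent to it. A petal $P_i$ is *$\mathcal T$-loose* if $P_i\subseteq\mathrm{fcl}(P_j)$ for some $j\ne i$, where $P_i$ and $P_j$ are moreover required to be consecutive in the cyclic order if $\Phi$ is not a $k$-anemone. **Trees.** Let $\pi$ be a partition of $E$ whose members may be empty. Consider a finite tree $T$ in which the members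 of $\pi$ (*bags*) label distinct vertices (*bag vertices*), and each non-bag vertex is labelled $A$ or $D$, where a vertex labelled $D$ carries a cyclic ordering of its incident edges. A subtree displays the union of the bags at its vertices; an edge $e$, respectively a non-bag vertex $v$, displays the partition of $E$ displayed by the components of $T\backslash e$, respectively $T-v$. The $k$-separations *displayed by $T$* are those displayed by an edge, and those displayed by a $k$-flower that arises as the partition displayed by a non-bag vertex. A $\mathcal T$-strong $k$-separation *conforms* with $T$ if it is $\mathcal T$-equivalent to a $k$-separation displayed by $T$, or to a $k$-separation with one side contained in a bag. Such a $T$ is a *partial $(k,\mathcal S)$-tree* for $\mathcal T$ if: 1. every edge displays a $\mathcal T$-strong $k$-separation, which is a $(k,\mathcal S)$-separation if both ends of the edge are bag vertices; 2. for every vertex labelled $A$ the displayed partition is a $k$-anemone, and for every vertex labelled $D$ the displayed partition, in the induced cyclic order, is a $k$-daisy; in both cases it has $\mathcal S$-order at least three and no $\mathcal T$-loose petals; 3. every $(k,\mathcal S)$-separation conforms with $T$. It is *$\mathcal S$-maximal* if every partial $(k,\mathcal S)$-tree $T'$ for $\mathcal T$ with $T\preccurlyeq_{\mathcal S}T'$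 satisfies $T'\preccurlyeq_{\mathcal S}T$, where trees are compared through the $k$-separations that they display. **Theorem.** Let $\mathcal T$ be a robust tangle of order $k$ in a connectivity system $(E,\lambda)$, and let $\mathcal S$ be a tree compatible set. If $T$ is an $\mathcal S$-maximal partial $(k,\mathcal S)$-tree for $\mathcal T$, then every $(k,\mathcal S)$-separation of $\lambda$ is $\mathcal T$-equivalent to some $(k,\mathcal S)$-separation displayed by $T$. -/

import Mathlib

/-- A connectivity function: an integer-valued, symmetric, submodular function on the subsets of
`E`. The ground set `E` is required to be finite wherever connectivity systems are used. -/
structure ConnectivitySystem (E : Type*) where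
  conn : Set E → ℤ
  conn_compl : ∀ X : Set E, conn Xᶜ = conn X
  submodular : ∀ X Y : Set E, conn (X ∪ Y) + conn (X ∩ Y) ≤ conn X + conn Y

namespace ConnectivitySystem

section Separations

variable {E : Type*} (C : ConnectivitySystem E) (k : ℕ) (𝒯 : Set (Set E))

/-- `X` is `k`-separating. An (unordered) `k`-separation `(X, E - X)` is represented throughout by
either of its two sides. -/
def IsKSeparating (X : Set E) : Prop := C.conn X ≤ (k : ℤ)

/-- `𝒯` is a tangle of order `k`. -/
structure IsTangle : Prop where
  conn_lt : ∀ A ∈ 𝒯, C.conn A < (k : ℤ)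
  mem_or_compl_mem : ∀ A : Set E, C.conn A ≤ (k : ℤ) - 1 → A ∈ 𝒯 ∨ Aᶜ ∈ 𝒯
  union_three_ne : ∀ A₁ ∈ 𝒯, ∀ A₂ ∈ 𝒯, ∀ A₃ ∈ 𝒯, A₁ ∪ A₂ ∪ A₃ ≠ Set.univ
  compl_singleton_notMem : ∀ e : E, ({e}ᶜ : Set E) ∉ 𝒯

/-- A tangle is robust if no eight of its members (repetitions allowed) cover `E`. -/
structure IsRobustTangle : Prop extends C.IsTangle k 𝒯 where
  union_eight_ne : ∀ A : Fin 8 → Set E, (∀ i, A i ∈ 𝒯) → (⋃ i, A i) ≠ Set.univ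

end Separations

section Strength

variable {E : Type*} (𝒯 : Set (Set E))

/-- `X` is `𝒯`-weak: it is contained in a member of `𝒯`. -/
def IsWeak (X : Set E) : Prop := ∃ A ∈ 𝒯, X ⊆ A

/-- `X` is `𝒯`-strong: it is not `𝒯`-weak. -/
def IsStrong (X : Set E) : Prop := ¬ IsWeak 𝒯 X

end Strength

section Closure

variable {E : Type*} (C : ConnectivitySystem E) (k : ℕ) (𝒯 : Set (Set E))

/-- `(X, E - X)` is a `𝒯`-strong `k`-separation. -/
structure IsStrongSep (X : Set E) : Prop where
  ksep : C.IsKSeparating k X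
  strong : IsStrong 𝒯 X
  strong_compl : IsStrong 𝒯 Xᶜ

/-- `X` is a fully closed (`𝒯`-strong, `k`-separating) set. -/
structure IsFullyClosed (X : Set E) : Prop where
  ksep : C.IsKSeparating k X
  strong : IsStrong 𝒯 X
  not_ksep : ∀ Y : Set E, Y ⊆ Xᶜ → Y.Nonempty → IsWeak 𝒯 Y → ¬ C.IsKSeparating k (X ∪ Y)

/-- The full closure of `X`: the intersection of all fully closed sets containing `X`
(used for `𝒯`-strong `k`-separating `X`). -/
def fcl (X : Set E) : Set E := ⋂₀ {F | C.IsFullyClosed k 𝒯 F ∧ X ⊆ F}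

/-- `(X, E - X)` and `(Y, E - Y)` are `𝒯`-equivalent `𝒯`-strong `k`-separations. -/
structure SepEquiv (X Y : Set E) : Prop where
  left : C.IsStrongSep k 𝒯 X
  right : C.IsStrongSep k 𝒯 Y
  fcl_eq : ({C.fcl k 𝒯 X, C.fcl k 𝒯 Xᶜ} : Set (Set E)) = {C.fcl k 𝒯 Y, C.fcl k 𝒯 Yᶜ}

/-- The `k`-separating set `X` is `𝒯`-sequential. -/
structure IsSequential (X : Set E) : Prop where
  ksep : C.IsKSeparating k X
  strong_compl : IsStrong 𝒯 Xᶜ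
  fcl_compl : C.fcl k 𝒯 Xᶜ = Set.univ

/-- `(X, E - X)` is a `(k, 𝒮)`-separation. -/
structure IsSSep (𝒮 : Set (Set E)) (X : Set E) : Prop where
  ksep : C.IsKSeparating k X
  mem : X ∈ 𝒮
  compl_mem : Xᶜ ∈ 𝒮

/-- `𝒮` is a tree compatible set: a set of non-sequential `k`-separating sets with `𝒯`-strong
complements that is closed under `𝒯`-equivalence of `(k, 𝒮)`-separations and under enlargement
to a side of a `𝒯`-strong `k`-separation. -/
structure IsTreeCompatible (𝒮 : Set (Set E)) : Prop where
  ksep : ∀ X ∈ 𝒮, C.IsKSeparating k X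
  not_sequential : ∀ X ∈ 𝒮, ¬ C.IsSequential k 𝒯 X
  strong_compl : ∀ X ∈ 𝒮, IsStrong 𝒯 Xᶜ
  of_equiv : ∀ X Y : Set E, C.IsSSep k 𝒮 X → C.SepEquiv k 𝒯 X Y → C.IsSSep k 𝒮 Y
  of_subset : ∀ X Y : Set E, X ∈ 𝒮 → C.IsStrongSep k 𝒯 Y → X ⊆ Y → Y ∈ 𝒮

/-- For collections `D`, `D'` of (displayed) separations: every `(k, 𝒮)`-separation in `D` is
`𝒯`-equivalent to some `(k, 𝒮)`-separation in `D'`. -/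
def DisplayLE (𝒮 D D' : Set (Set E)) : Prop :=
  ∀ X ∈ D, C.IsSSep k 𝒮 X → ∃ Y ∈ D', C.IsSSep k 𝒮 Y ∧ C.SepEquiv k 𝒯 X Y

end Closure

section Flowers

/-- `j` is the cyclic successor of `i` in `Fin n`. -/
def CyclicNext {n : ℕ} (i j : Fin n) : Prop := (j : ℕ) = ((i : ℕ) + 1) % n

/-- The members of `I` form a consecutive set in the cyclic order on `Fin n`. -/
def IsCyclicInterval {n : ℕ} (I : Set (Fin n)) : Prop :=
  ∃ a l : ℕ, ∀ j : Fin n, j ∈ I ↔ ∃ m < l, (j : ℕ) = (a + m) % n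

variable {E : Type*} (C : ConnectivitySystem E) (k : ℕ) (𝒯 𝒮 : Set (Set E))

/-- `(P 0, …, P (n-1))` is a `k`-flower in `𝒯`. -/
structure IsFlower {n : ℕ} (P : Fin n → Set E) : Prop where
  pos : 0 < n
  disjoint : Pairwise fun i j => Disjoint (P i) (P j)
  cover : (⋃ i, P i) = Set.univ
  strong : ∀ i, IsStrong 𝒯 (P i)
  ksep : ∀ i, C.IsKSeparating k (P i)
  ksep_next : ∀ i j, CyclicNext i j → C.IsKSeparating k (P i ∪ P j)

/-- The `k`-separating sets displayed by a flower: its `k`-separating unions of petals. -/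
def flowerDisplayed {n : ℕ} (P : Fin n → Set E) : Set (Set E) :=
  {X | C.IsKSeparating k X ∧ ∃ I : Set (Fin n), X = ⋃ i ∈ I, P i}

/-- `P` is a `k`-anemone. -/
structure IsAnemone {n : ℕ} (P : Fin n → Set E) : Prop where
  flower : C.IsFlower k 𝒯 P
  ksep : ∀ I : Set (Fin n), I.Nonempty → C.IsKSeparating k (⋃ i ∈ I, P i)

/-- `P` is a `k`-daisy. -/
structure IsDaisy {n : ℕ} (P : Fin n → Set E) : Prop where
  flower : C.IsFlower k 𝒯 P
  ksep_iff : ∀ I : Set (Fin n), I.Nonempty →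
    (C.IsKSeparating k (⋃ i ∈ I, P i) ↔ IsCyclicInterval I)

/-- The flowers `P` and `Q` are `𝒯`-equivalent with respect to `𝒮`. -/
def FlowerEquiv {n m : ℕ} (P : Fin n → Set E) (Q : Fin m → Set E) : Prop :=
  C.DisplayLE k 𝒯 𝒮 (C.flowerDisplayed k P) (C.flowerDisplayed k Q) ∧
    C.DisplayLE k 𝒯 𝒮 (C.flowerDisplayed k Q) (C.flowerDisplayed k P)

/-- The `𝒮`-order of a flower: the least number of petals of an equivalent flower. -/
noncomputable def sOrder {n : ℕ} (P : Fin n → Set E) : ℕ :=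
  sInf {m : ℕ | ∃ Q : Fin m → Set E, C.IsFlower k 𝒯 Q ∧ C.FlowerEquiv k 𝒯 𝒮 P Q}

/-- The petal `P i` is `𝒯`-loose: it lies in the full closure of another petal that is, up to
labels, consecutive to it. The petals of an anemone may be permuted arbitrarily, so that any two
petals of an anemone are consecutive up to labels; in a daisy only cyclic neighbours are. -/
def IsLoosePetal {n : ℕ} (P : Fin n → Set E) (i : Fin n) : Prop :=
  ∃ j, j ≠ i ∧ (CyclicNext i j ∨ CyclicNext j i ∨ C.IsAnemone k 𝒯 P) ∧ P i ⊆ C.fcl k 𝒯 (P j)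

end Flowers

end ConnectivitySystem

/-- The label of a vertex whose set of neighbours is `N`: a bag, or the letter `A`, or the letter
`D` together with a cyclic ordering of the incident edges (equivalently of the neighbours), given
by an enumeration whose starting point is immaterial. -/
inductive VertexLabel (E N : Type*) where
  | bag (B : Set E)
  | A
  | D (n : ℕ) (order : Fin n ≃ N)

/-- The elements of `E` placed at a vertex with the given label. -/
def VertexLabel.content {E N : Type*} : VertexLabel E N → Set E
  | .bag B => B
  | .A => ∅
  | .D _ _ => ∅

/-- A `π`-labelled tree with vertex set `V`, whose non-bag vertices are labelled `A` or `D`. The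
partition `π` of `E` is the family of bags; (several) bags may be empty. -/
structure LabelledTree (E V : Type*) where
  graph : SimpleGraph V
  isTree : graph.IsTree
  label : (v : V) → VertexLabel E (graph.neighborSet v)
  disjoint : Pairwise fun v w => Disjoint (label v).content (label w).content
  cover : (⋃ v, (label v).content) = Set.univ

namespace LabelledTree

variable {E V : Type*} (T : LabelledTree E V)

/-- `B` is the bag labelling `v`; in particular `v` is a bag vertex. -/
def HasBag (v : V) (B : Set E) : Prop := T.label v = VertexLabel.bag B

/-- `v` is a bag vertex. -/
def IsBagVertex (v : V) : Prop := ∃ B, T.HasBag v B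

/-- The set displayed by the component containing `u` of the tree without the edge `uv`. -/
def edgeSide (u v : V) : Set E :=
  ⋃ x ∈ {x | (T.graph.deleteEdges {s(u, v)}).Reachable u x}, (T.label x).content

/-- For a neighbour `w` of `v`: the set displayed by the component containing `w` of the tree
without the vertex `v` (isolating `v` leaves the other components of `T - v` unchanged). -/
def petal (v : V) (w : T.graph.neighborSet v) : Set E :=
  ⋃ x ∈ {x | (T.graph.deleteIncidenceSet v).Reachable w x}, (T.label x).content

/-- The partition displayed by `v`, ordered by an ordering of the edges incident with `v`. -/
def petals (v : V) {n : ℕ} (e : Fin n ≃ T.graph.neighborSet v) : Fin n → Set E :=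
  fun i => T.petal v (e i)

variable (C : ConnectivitySystem E) (k : ℕ) (𝒯 𝒮 : Set (Set E))

/-- The `k`-separations displayed by an edge or by a `k`-flower vertex of the tree. (Which
separations a flower vertex displays does not depend on the ordering of its petals.) -/
def displayed : Set (Set E) :=
  {X | C.IsKSeparating k X ∧
    ((∃ u v, T.graph.Adj u v ∧ X = T.edgeSide u v) ∨
      ∃ v, ¬ T.IsBagVertex v ∧ ∃ (n : ℕ) (e : Fin n ≃ T.graph.neighborSet v),
        C.IsFlower k 𝒯 (T.petals v e) ∧ X ∈ C.flowerDisplayed k (T.petals v e))}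

/-- The `𝒯`-strong `k`-separation `(X, E - X)` conforms with the tree. -/
def Conforms (X : Set E) : Prop :=
  (∃ Y ∈ T.displayed C k 𝒯, C.SepEquiv k 𝒯 X Y) ∨
    ∃ Y, C.SepEquiv k 𝒯 X Y ∧ ∃ v B, T.HasBag v B ∧ (Y ⊆ B ∨ Yᶜ ⊆ B)

/-- `T` is a partial `(k, 𝒮)`-tree for `𝒯`. -/
structure IsPartialTree : Prop where
  edge_strong : ∀ u v, T.graph.Adj u v → C.IsStrongSep k 𝒯 (T.edgeSide u v)
  edge_bags : ∀ u v, T.graph.Adj u v → T.IsBagVertex u → T.IsBagVertex v →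
    C.IsSSep k 𝒮 (T.edgeSide u v)
  anemone : ∀ v, T.label v = VertexLabel.A →
    ∃ (n : ℕ) (e : Fin n ≃ T.graph.neighborSet v),
      C.IsAnemone k 𝒯 (T.petals v e) ∧ 3 ≤ C.sOrder k 𝒯 𝒮 (T.petals v e) ∧
        ∀ i, ¬ C.IsLoosePetal k 𝒯 (T.petals v e) i
  daisy : ∀ (v : V) (n : ℕ) (e : Fin n ≃ T.graph.neighborSet v),
    T.label v = VertexLabel.D n e →
      C.IsDaisy k 𝒯 (T.petals v e) ∧ 3 ≤ C.sOrder k 𝒯 𝒮 (T.petals v e) ∧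
        ∀ i, ¬ C.IsLoosePetal k 𝒯 (T.petals v e) i
  conforms : ∀ X, C.IsSSep k 𝒮 X → T.Conforms C k 𝒯 X

end LabelledTree

universe v

/-- `T` is an `𝒮`-maximal partial `(k, 𝒮)`-tree for `𝒯`: it is maximal in the quasi-order of
displaying, up to `𝒯`-equivalence, at least the same `(k, 𝒮)`-separations, on all finite partial
`(k, 𝒮)`-trees (every finite tree has a copy on a vertex set in the universe of `V`). -/
structure LabelledTree.IsMaximalPartialTree {E : Type*} {V : Type v} (T : LabelledTree E V)
    (C : ConnectivitySystem E) (k : ℕ) (𝒯 𝒮 : Set (Set E)) : Prop where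
  isPartialTree : T.IsPartialTree C k 𝒯 𝒮
  maximal : ∀ (W : Type v) [Finite W] (T' : LabelledTree E W), T'.IsPartialTree C k 𝒯 𝒮 →
    C.DisplayLE k 𝒯 𝒮 (T.displayed C k 𝒯) (T'.displayed C k 𝒯) →
      C.DisplayLE k 𝒯 𝒮 (T'.displayed C k 𝒯) (T.displayed C k 𝒯)

/-! Suppose that some `(k, 𝒮)`-separation is equivalent to none displayed by `T`. By conformity it
may be taken to have a side `X` inside a bag `B`, and among all undisplayed choices of `X ⊆ B` one
is taken whose full closure is largest. The plan is to replace `B` by a smaller bag with a star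
attached, so that the new partial tree displays everything that `T` displays and `X` as well. This
contradicts maximality.

The star comes from a flower. Among the flowers having a petal that contains `Bᶜ`, and displaying at
least what `(X, Xᶜ)` displays, choose one that displays a maximal set of `(k, 𝒮)`-separations up to
equivalence, with as few petals as possible (`IsOptimal`). Number it so that `Bᶜ ⊆ P 0`. The old
vertex keeps `B ∩ P 0`. For two petals a new bag `P 1` is joined to it; for three or more, the
centre is labelled `A` or `D` according to `IsFlower.isAnemone_or_isDaisy`, and the petals other
than `P 0` become leaves. Minimality of the number of petals rules out loose petals and gives
`𝒮`-order at least three (`IsOptimal.not_subset_fcl`, `IsOptimal.three_le_sOrder`).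

The heart is that separations inside `B` still conform, via `IsOptimal.conforms`. Replace such a
separation by an equivalent `U` that cuts as few petals as possible. Then no petal is cut into a
weak and a strong piece. No petal is cut into two weak pieces either (`IsOptimal.not_weak_parts`):
this is an uncrossing argument that would otherwise cover `E` by eight weak sets, against
robustness. So every cut petal is cut into strong pieces. Unless a side of `U` lies in a petal,
`IsProperFlower.exists_refinement` splits the petals along `U`, and maximality shows that `U` was
displayed up to equivalence already.

If the side in `B` lies in a petal, it lies in a bag of the new tree. If the other side lies in the
petal containing `Bᶜ`, the largest choice of `fcl X` forces `U` to be displayed by the flower or by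
`T` (`complements_of_maximal`). That step needs `Bᶜ` not to lie in `fcl B`
(`IsPartialTree.compl_bag`), which holds because bag-to-bag edges are non-sequential and flower
vertices have no loose petals. -/

namespace ConnectivitySystem

/-! ### Weak and strong sets, uncrossing and full closure -/

section Core

variable {E : Type*} {C : ConnectivitySystem E} {k : ℕ} {𝒯 𝒮 : Set (Set E)}

theorem IsStrong.mono {X Y : Set E} (h : IsStrong 𝒯 X) (hXY : X ⊆ Y) : IsStrong 𝒯 Y :=
  fun ⟨A, hA, hY⟩ => h ⟨A, hA, hXY.trans hY⟩

theorem IsWeak.mono {X Y : Set E} (h : IsWeak 𝒯 Y) (hXY : X ⊆ Y) : IsWeak 𝒯 X :=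
  let ⟨A, hA, hY⟩ := h
  ⟨A, hA, hXY.trans hY⟩

theorem not_isStrong {X : Set E} : ¬ IsStrong 𝒯 X ↔ IsWeak 𝒯 X := not_not

theorem isWeak_or_isStrong (X : Set E) : IsWeak 𝒯 X ∨ IsStrong 𝒯 X := em _

theorem IsKSeparating.compl {X : Set E} (h : C.IsKSeparating k X) : C.IsKSeparating k Xᶜ := by
  unfold IsKSeparating at *
  rwa [C.conn_compl]

theorem IsKSeparating.univ {X : Set E} (h : C.IsKSeparating k X) :
    C.IsKSeparating k Set.univ := by
  have h1 := C.submodular X Xᶜ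
  have h2 := C.conn_compl X
  have h3 := C.conn_compl Set.univ
  rw [Set.union_compl_self, Set.inter_compl_self] at h1
  rw [Set.compl_univ] at h3
  unfold IsKSeparating at *
  linarith

namespace IsTangle

variable (h : C.IsTangle k 𝒯)
include h

/-- If the connectivity were below `k`, one of the two sides would belong to the tangle. Combined
with submodularity this gives the two uncrossing rules below. -/
theorem le_conn {X : Set E} (hX : IsStrong 𝒯 X) (hX' : IsStrong 𝒯 Xᶜ) : (k : ℤ) ≤ C.conn X := by
  by_contra hlt
  rcases h.mem_or_compl_mem X (by omega) with hm | hm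
  · exact hX ⟨X, hm, subset_rfl⟩
  · exact hX' ⟨Xᶜ, hm, subset_rfl⟩

theorem ksep_union {X Y : Set E} (hX : C.IsKSeparating k X) (hY : C.IsKSeparating k Y)
    (hXY : IsStrong 𝒯 (X ∩ Y)) (hXY' : IsStrong 𝒯 (X ∩ Y)ᶜ) : C.IsKSeparating k (X ∪ Y) := by
  have := h.le_conn hXY hXY'
  have := C.submodular X Y
  unfold IsKSeparating at *
  linarith

theorem ksep_inter {X Y : Set E} (hX : C.IsKSeparating k X) (hY : C.IsKSeparating k Y)
    (hXY : IsStrong 𝒯 (X ∪ Y)) (hXY' : IsStrong 𝒯 (X ∪ Y)ᶜ) : C.IsKSeparating k (X ∩ Y) := by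
  have := h.le_conn hXY hXY'
  have := C.submodular X Y
  unfold IsKSeparating at *
  linarith

/-- Uncross `Z ∪ W` with `F`: their intersection contains the strong set `Z`. If its complement is
strong too, then `F ∪ W` is `k`-separating, against full closedness. Otherwise `Fᶜ` is weak, and
adding all of `Fᶜ` to `F` gives the same contradiction. -/
theorem subset_of_isFullyClosed {F Z W : Set E} (hF : C.IsFullyClosed k 𝒯 F)
    (hZ : IsStrong 𝒯 Z) (hZF : Z ⊆ F) (hW : IsWeak 𝒯 W) (hZW : C.IsKSeparating k (Z ∪ W)) :
    W ⊆ F := by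
  by_contra hWF
  obtain ⟨e, heW, heF⟩ := Set.not_subset.1 hWF
  have hFW : ¬ C.IsKSeparating k (F ∪ (W \ F)) :=
    hF.not_ksep _ (fun x hx => hx.2) ⟨e, heW, heF⟩ (hW.mono Set.sdiff_subset)
  have hs : IsStrong 𝒯 ((Z ∪ W) ∩ F) := hZ.mono fun x hx => ⟨Or.inl hx, hZF hx⟩
  have hc : IsWeak 𝒯 Fᶜ := by
    refine (not_isStrong.1 fun hc => hFW ?_ : IsWeak 𝒯 ((Z ∪ W) ∩ F)ᶜ).mono
      (Set.compl_subset_compl.2 Set.inter_subset_right)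
    have := h.ksep_union hZW hF.ksep hs hc
    have he : (Z ∪ W) ∪ F = F ∪ (W \ F) := by
      ext x
      have := @hZF x
      simp only [Set.mem_union, Set.mem_sdiff]
      tauto
    rwa [he] at this
  refine hF.not_ksep Fᶜ subset_rfl ⟨e, heF⟩ hc ?_
  rw [Set.union_compl_self]
  exact hF.ksep.univ

theorem subset_fcl_of_isWeak {X Z W : Set E} (hZ : IsStrong 𝒯 Z) (hZX : Z ⊆ C.fcl k 𝒯 X)
    (hW : IsWeak 𝒯 W) (hZW : C.IsKSeparating k (Z ∪ W)) : W ⊆ C.fcl k 𝒯 X :=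
  Set.subset_sInter fun _ hF =>
    h.subset_of_isFullyClosed hF.1 hZ (hZX.trans (Set.sInter_subset_of_mem hF)) hW hZW

end IsTangle

theorem subset_fcl (X : Set E) : X ⊆ C.fcl k 𝒯 X := Set.subset_sInter fun _ hF => hF.2

theorem fcl_subset_of_subset_fcl {X Y : Set E} (h : X ⊆ C.fcl k 𝒯 Y) :
    C.fcl k 𝒯 X ⊆ C.fcl k 𝒯 Y :=
  Set.subset_sInter fun _ hF =>
    Set.sInter_subset_of_mem ⟨hF.1, h.trans (Set.sInter_subset_of_mem hF)⟩

theorem fcl_mono {X Y : Set E} (h : X ⊆ Y) : C.fcl k 𝒯 X ⊆ C.fcl k 𝒯 Y :=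
  fcl_subset_of_subset_fcl (h.trans (subset_fcl Y))

/-- `H` arises from `X` by successively adding weak sets, all the intermediate sets being
`k`-separating. -/
inductive WeakExtends (C : ConnectivitySystem E) (k : ℕ) (𝒯 : Set (Set E)) (X : Set E) :
    Set E → Prop
  | refl : WeakExtends C k 𝒯 X X
  | step {H W : Set E} : WeakExtends C k 𝒯 X H → IsWeak 𝒯 W → C.IsKSeparating k (H ∪ W) →
      WeakExtends C k 𝒯 X (H ∪ W)

namespace WeakExtends

theorem subset {X H : Set E} (h : WeakExtends C k 𝒯 X H) : X ⊆ H := by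
  induction h with
  | refl => exact subset_rfl
  | step _ _ _ ih => exact ih.trans Set.subset_union_left

theorem ksep {X H : Set E} (hX : C.IsKSeparating k X) (h : WeakExtends C k 𝒯 X H) :
    C.IsKSeparating k H := by
  cases h with
  | refl => exact hX
  | step _ _ h => exact h

theorem subset_fcl (hT : C.IsTangle k 𝒯) {X H : Set E} (hX : IsStrong 𝒯 X)
    (h : WeakExtends C k 𝒯 X H) : H ⊆ C.fcl k 𝒯 X := by
  induction h with
  | refl => exact ConnectivitySystem.subset_fcl X
  | step h hW hk ih =>
    exact Set.union_subset ih (hT.subset_fcl_of_isWeak (hX.mono h.subset) ih hW hk)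

end WeakExtends

section Finite

variable [Finite E]

/-- A maximal weak extension is fully closed, and every weak extension lies in the full closure.
Hence the full closure is reached from `X` by a chain of weak steps. -/
theorem exists_weakExtends_fcl (hT : C.IsTangle k 𝒯) {X : Set E} (hX : IsStrong 𝒯 X)
    (hk : C.IsKSeparating k X) :
    WeakExtends C k 𝒯 X (C.fcl k 𝒯 X) ∧ C.IsFullyClosed k 𝒯 (C.fcl k 𝒯 X) := by
  obtain ⟨H, hH⟩ := (Set.toFinite {H | WeakExtends C k 𝒯 X H}).exists_maximal ⟨X, .refl⟩
  have hHX : WeakExtends C k 𝒯 X H := hH.prop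
  have hF : C.IsFullyClosed k 𝒯 H := by
    refine ⟨hHX.ksep hk, hX.mono hHX.subset, fun Y hY hne hw hHY => ?_⟩
    obtain ⟨y, hy⟩ := hne
    have hHY' : WeakExtends C k 𝒯 X (H ∪ Y) := .step hHX hw hHY
    exact hY hy (hH.le_of_ge hHY' Set.subset_union_left (Or.inr hy))
  have hle : C.fcl k 𝒯 X ⊆ H := Set.sInter_subset_of_mem ⟨hF, hHX.subset⟩
  have he : C.fcl k 𝒯 X = H := hle.antisymm (hHX.subset_fcl hT hX)
  rw [he]
  exact ⟨hHX, hF⟩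

theorem isStrong_compl_fcl (hT : C.IsTangle k 𝒯) {X : Set E} (hX : IsStrong 𝒯 X)
    (hk : C.IsKSeparating k X) (hne : C.fcl k 𝒯 X ≠ Set.univ) :
    IsStrong 𝒯 (C.fcl k 𝒯 X)ᶜ := by
  intro hw
  refine (exists_weakExtends_fcl hT hX hk).2.not_ksep _ subset_rfl
    (Set.nonempty_compl.2 hne) hw ?_
  rw [Set.union_compl_self]
  exact hk.univ

/-- Enlarging a side of a strong separation within its full closure changes neither of the two
full closures. -/
theorem fcl_eq_of_subset_fcl (hT : C.IsTangle k 𝒯) {X X' : Set E} (hX : C.IsStrongSep k 𝒯 X)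
    (hne : C.fcl k 𝒯 X ≠ Set.univ) (hXX' : X ⊆ X') (hX' : X' ⊆ C.fcl k 𝒯 X)
    (hk : C.IsKSeparating k X') :
    C.IsStrongSep k 𝒯 X' ∧ C.fcl k 𝒯 X' = C.fcl k 𝒯 X ∧ C.fcl k 𝒯 X'ᶜ = C.fcl k 𝒯 Xᶜ := by
  have hs := isStrong_compl_fcl hT hX.strong hX.ksep hne
  refine ⟨⟨hk, hX.strong.mono hXX', hs.mono (Set.compl_subset_compl.2 hX')⟩,
    (fcl_subset_of_subset_fcl hX').antisymm (fcl_mono hXX'),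
    (fcl_mono (Set.compl_subset_compl.2 hXX')).antisymm
      (Set.subset_sInter fun F hF => ?_)⟩
  have hXF : Xᶜ ⊆ F := by
    -- Run the chain from `X` to its full closure backwards. Intersecting its members with `X'` and
    -- taking complements turns each step into the addition of a weak set to a subset of `F`, which
    -- `F` absorbs.
    have key : ∀ H, WeakExtends C k 𝒯 X H → H ⊆ C.fcl k 𝒯 X → (X' ∩ H)ᶜ ⊆ F → Xᶜ ⊆ F := by
      intro H hH
      induction hH with
      | refl =>
        intro _ h
        rwa [Set.inter_eq_right.2 hXX'] at h
      | @step H W hH hW hHW ih =>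
        intro hsub hF'
        have hHs : H ⊆ C.fcl k 𝒯 X := Set.subset_union_left.trans hsub
        refine ih hHs ?_
        have hk' : C.IsKSeparating k (X' ∩ H)ᶜ := by
          refine (hT.ksep_inter hk (hH.ksep hX.ksep) (hX.strong.mono ?_) (hs.mono ?_)).compl
          · exact hXX'.trans Set.subset_union_left
          · exact Set.compl_subset_compl.2 (Set.union_subset hX' hHs)
        have he : (X' ∩ H)ᶜ = (X' ∩ (H ∪ W))ᶜ ∪ (W ∩ (X' ∩ H)ᶜ) := by
          ext x
          simp only [Set.mem_union, Set.mem_compl_iff, Set.mem_inter_iff]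
          tauto
        rw [he] at hk' ⊢
        refine Set.union_subset hF' (hT.subset_of_isFullyClosed hF.1 (hs.mono ?_) hF'
          (hW.mono Set.inter_subset_left) hk')
        exact Set.compl_subset_compl.2 (Set.inter_subset_left.trans hX')
    refine key _ (exists_weakExtends_fcl hT hX.strong hX.ksep).1 subset_rfl ?_
    rw [Set.inter_eq_left.2 hX']
    exact hF.2
  exact Set.sInter_subset_of_mem ⟨hF.1, hXF⟩

end Finite

theorem IsRobustTangle.not_eight (h : C.IsRobustTangle k 𝒯) {A : Fin 8 → Set E}
    (hA : ∀ i, IsWeak 𝒯 (A i)) (hu : ∀ e, ∃ i, e ∈ A i) : False := by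
  choose B hB hAB using hA
  refine h.union_eight_ne B hB (Set.eq_univ_of_forall fun e => ?_)
  obtain ⟨i, hi⟩ := hu e
  exact Set.mem_iUnion.2 ⟨i, hAB i hi⟩

theorem SepEquiv.symm {X Y : Set E} (h : C.SepEquiv k 𝒯 X Y) : C.SepEquiv k 𝒯 Y X :=
  ⟨h.right, h.left, h.fcl_eq.symm⟩

theorem SepEquiv.trans {X Y Z : Set E} (h : C.SepEquiv k 𝒯 X Y) (h' : C.SepEquiv k 𝒯 Y Z) :
    C.SepEquiv k 𝒯 X Z :=
  ⟨h.left, h'.right, h.fcl_eq.trans h'.fcl_eq⟩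

theorem IsStrongSep.sepEquiv_refl {X : Set E} (h : C.IsStrongSep k 𝒯 X) : C.SepEquiv k 𝒯 X X :=
  ⟨h, h, rfl⟩

theorem IsStrongSep.compl {X : Set E} (h : C.IsStrongSep k 𝒯 X) : C.IsStrongSep k 𝒯 Xᶜ :=
  ⟨h.ksep.compl, h.strong_compl, by rw [compl_compl]; exact h.strong⟩

theorem IsStrongSep.sepEquiv_compl {X : Set E} (h : C.IsStrongSep k 𝒯 X) :
    C.SepEquiv k 𝒯 X Xᶜ :=
  ⟨h, h.compl, by rw [compl_compl, Set.pair_comm]⟩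

theorem SepEquiv.compl_right {X Y : Set E} (h : C.SepEquiv k 𝒯 X Y) : C.SepEquiv k 𝒯 X Yᶜ :=
  h.trans h.right.sepEquiv_compl

theorem SepEquiv.compl_left {X Y : Set E} (h : C.SepEquiv k 𝒯 X Y) : C.SepEquiv k 𝒯 Xᶜ Y :=
  h.symm.compl_right.symm

theorem SepEquiv.fcl_eq_or {X Y : Set E} (h : C.SepEquiv k 𝒯 X Y) :
    C.fcl k 𝒯 X = C.fcl k 𝒯 Y ∨ C.fcl k 𝒯 X = C.fcl k 𝒯 Yᶜ := by
  have : C.fcl k 𝒯 X ∈ ({C.fcl k 𝒯 Y, C.fcl k 𝒯 Yᶜ} : Set (Set E)) := by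
    rw [← h.fcl_eq]
    exact Or.inl rfl
  simpa using this

theorem sepEquiv_of_subset_fcl [Finite E] (hT : C.IsTangle k 𝒯) {X X' : Set E}
    (hX : C.IsStrongSep k 𝒯 X) (hne : C.fcl k 𝒯 X ≠ Set.univ) (hXX' : X ⊆ X')
    (hX' : X' ⊆ C.fcl k 𝒯 X) (hk : C.IsKSeparating k X') : C.SepEquiv k 𝒯 X X' := by
  obtain ⟨h1, h2, h3⟩ := fcl_eq_of_subset_fcl hT hX hne hXX' hX' hk
  exact ⟨hX, h1, by rw [h2, h3]⟩

theorem IsSSep.compl {X : Set E} (h : C.IsSSep k 𝒮 X) : C.IsSSep k 𝒮 Xᶜ :=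
  ⟨h.ksep.compl, h.compl_mem, by rw [compl_compl]; exact h.mem⟩

namespace IsTreeCompatible

variable (h𝒮 : C.IsTreeCompatible k 𝒯 𝒮)
include h𝒮

theorem isStrongSep {X : Set E} (h : C.IsSSep k 𝒮 X) : C.IsStrongSep k 𝒯 X :=
  ⟨h.ksep, by simpa using h𝒮.strong_compl _ h.compl_mem, h𝒮.strong_compl _ h.mem⟩

theorem fcl_compl_ne_univ {X : Set E} (h : C.IsSSep k 𝒮 X) : C.fcl k 𝒯 Xᶜ ≠ Set.univ :=
  fun hu => h𝒮.not_sequential X h.mem ⟨h.ksep, h𝒮.strong_compl _ h.mem, hu⟩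

theorem fcl_ne_univ {X : Set E} (h : C.IsSSep k 𝒮 X) : C.fcl k 𝒯 X ≠ Set.univ := by
  simpa using h𝒮.fcl_compl_ne_univ h.compl

theorem isSSep_of_sepEquiv {X Y : Set E} (h : C.IsSSep k 𝒮 X) (hXY : C.SepEquiv k 𝒯 X Y) :
    C.IsSSep k 𝒮 Y :=
  h𝒮.of_equiv X Y h hXY

theorem sepEquiv_refl {X : Set E} (h : C.IsSSep k 𝒮 X) : C.SepEquiv k 𝒯 X X :=
  (h𝒮.isStrongSep h).sepEquiv_refl

end IsTreeCompatible

/-! ### Cuts into weak pieces -/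

section Robust

/-- If `P ∪ Q` has a strong complement and `Q` is strong, then `P ∩ Q` is `k`-separating, so `fcl
Qᶜ` absorbs first `Q \ P` and then `Q ∩ P`. A weak `Q` is absorbed at once. -/
theorem fcl_compl_eq_univ_of_weak_parts (h : C.IsRobustTangle k 𝒯) {Q P : Set E}
    (hQ : C.IsKSeparating k Q) (hQ' : IsStrong 𝒯 Qᶜ) (hP : C.IsKSeparating k P)
    (h1 : IsWeak 𝒯 (Q ∩ P)) (h2 : IsWeak 𝒯 (Q \ P)) : C.fcl k 𝒯 Qᶜ = Set.univ := by
  have hT := h.toIsTangle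
  have main : ∀ P : Set E, C.IsKSeparating k P → IsWeak 𝒯 (Q ∩ P) → IsWeak 𝒯 (Q \ P) →
      IsStrong 𝒯 (P ∪ Q)ᶜ → C.fcl k 𝒯 Qᶜ = Set.univ := by
    intro P hP h1 h2 hs
    refine Set.eq_univ_of_univ_subset ?_
    rw [← Set.compl_union_self Q]
    refine Set.union_subset (subset_fcl _) ?_
    rcases isWeak_or_isStrong (𝒯 := 𝒯) Q with hw | hw
    · refine hT.subset_fcl_of_isWeak hQ' (subset_fcl _) hw ?_
      rw [Set.compl_union_self]
      exact hQ.univ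
    · have hk := (hT.ksep_inter hP hQ (hw.mono Set.subset_union_right) hs).compl
      have he : (P ∩ Q)ᶜ = Qᶜ ∪ (Q \ P) := by
        ext x
        simp only [Set.mem_union, Set.mem_compl_iff, Set.mem_inter_iff, Set.mem_sdiff]
        tauto
      rw [he] at hk
      have ha := hT.subset_fcl_of_isWeak hQ' (subset_fcl _) h2 hk
      have hb : Q ∩ P ⊆ C.fcl k 𝒯 Qᶜ := by
        refine hT.subset_fcl_of_isWeak (hQ'.mono Set.subset_union_left)
          (Set.union_subset (subset_fcl _) ha) h1 ?_
        have he : Qᶜ ∪ (Q \ P) ∪ (Q ∩ P) = Set.univ := by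
          ext x
          simp only [Set.mem_union, Set.mem_compl_iff, Set.mem_inter_iff, Set.mem_sdiff,
            Set.mem_univ, iff_true]
          tauto
        rw [he]
        exact hQ.univ
      exact (Set.inter_union_sdiff Q P).superset.trans (Set.union_subset hb ha)
  by_cases hs : IsStrong 𝒯 (P ∪ Q)ᶜ
  · exact main P hP h1 h2 hs
  -- If `Pᶜ ∪ Q` also had a weak complement, the two outer sets and the two pieces of `Q` would be
  -- four weak sets covering `E`; the list is padded to length eight.
  · refine main Pᶜ hP.compl h2 (by simpa [Set.sdiff_eq] using h1) fun hw => ?_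
    refine h.not_eight (A := ![Q ∩ P, Q \ P, (P ∪ Q)ᶜ, (Pᶜ ∪ Q)ᶜ, Q ∩ P, Q ∩ P, Q ∩ P, Q ∩ P])
      (fun i => ?_) fun e => ?_
    · fin_cases i <;> first | exact h1 | exact h2 | exact not_isStrong.1 hs | exact hw
    · by_cases hq : e ∈ Q <;> by_cases hp : e ∈ P
      · exact ⟨0, hq, hp⟩
      · exact ⟨1, hq, hp⟩
      · exact ⟨3, by simp [hq, hp]⟩
      · exact ⟨2, by simp [hq, hp]⟩

theorem IsSSep.strong_inter_or_diff (h : C.IsRobustTangle k 𝒯) (h𝒮 : C.IsTreeCompatible k 𝒯 𝒮)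
    {Q P : Set E} (hQ : C.IsSSep k 𝒮 Q) (hP : C.IsKSeparating k P) :
    IsStrong 𝒯 (Q ∩ P) ∨ IsStrong 𝒯 (Q \ P) := by
  by_contra hc
  rw [not_or, not_isStrong, not_isStrong] at hc
  exact h𝒮.fcl_compl_ne_univ hQ (fcl_compl_eq_univ_of_weak_parts h hQ.ksep
    (h𝒮.isStrongSep hQ).strong_compl hP hc.1 hc.2)

/-- A set `J` that is cut into weak pieces by `U` lies in the full closure of a neighbouring set
`K` that is cut into strong pieces. -/
theorem subset_fcl_of_weak_parts (hT : C.IsTangle k 𝒯) {U J K : Set E}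
    (hU : C.IsKSeparating k U) (hQ : C.IsKSeparating k (J ∪ K)) (hK : C.IsKSeparating k K)
    (hJ1 : IsWeak 𝒯 (J ∩ U)) (hJ2 : IsWeak 𝒯 (J \ U)) (hK1 : IsStrong 𝒯 (K ∩ U))
    (hK2 : IsStrong 𝒯 (K \ U))
    (hs : IsStrong 𝒯 ((J ∪ K)ᶜ ∩ U) ∨ IsStrong 𝒯 ((J ∪ K)ᶜ \ U)) : J ⊆ C.fcl k 𝒯 K := by
  have main : ∀ U : Set E, C.IsKSeparating k U → IsWeak 𝒯 (J ∩ U) → IsWeak 𝒯 (J \ U) →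
      IsStrong 𝒯 (K ∩ U) → IsStrong 𝒯 (K \ U) → IsStrong 𝒯 ((J ∪ K)ᶜ \ U) →
      J ⊆ C.fcl k 𝒯 K := by
    intro U hU hJ1 hJ2 hK1 hK2 hs
    -- Two uncrossings make `K ∪ (J ∩ U)` `k`-separating, so the full closure of `K` absorbs `J ∩
    -- U`, and then `J \ U` because `J ∪ K` is `k`-separating.
    have hk1 : C.IsKSeparating k ((J ∪ K) ∩ U) :=
      hT.ksep_inter hQ hU (hK1.mono fun x hx => Or.inr hx.2)
        (hs.mono fun x hx => by
          simp only [Set.mem_sdiff, Set.mem_compl_iff, Set.mem_union] at hx ⊢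
          tauto)
    have hk2 : C.IsKSeparating k (K ∪ (J ∩ U)) := by
      have := hT.ksep_union hK hk1 (hK1.mono fun x hx => ⟨hx.1, Or.inr hx.1, hx.2⟩)
        (hK2.mono fun x hx => by
          simp only [Set.mem_sdiff, Set.mem_compl_iff, Set.mem_inter_iff] at hx ⊢
          tauto)
      convert this using 1
      ext x
      simp only [Set.mem_union, Set.mem_inter_iff]
      tauto
    have hKs : IsStrong 𝒯 K := hK1.mono Set.inter_subset_left
    have ha := hT.subset_fcl_of_isWeak hKs (subset_fcl _) hJ1 hk2
    have hb : J \ U ⊆ C.fcl k 𝒯 K := by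
      refine hT.subset_fcl_of_isWeak (hKs.mono Set.subset_union_left)
        (Set.union_subset (subset_fcl _) ha) hJ2 ?_
      convert hQ using 1
      ext x
      simp only [Set.mem_union, Set.mem_inter_iff, Set.mem_sdiff]
      tauto
    rw [← Set.inter_union_sdiff J U]
    exact Set.union_subset ha hb
  rcases hs with hs | hs
  · refine main Uᶜ hU.compl hJ2 (by simpa [Set.sdiff_eq] using hJ1) hK2
      (by simpa [Set.sdiff_eq] using hK1) (by simpa [Set.sdiff_eq] using hs)
  · exact main U hU hJ1 hJ2 hK1 hK2 hs

end Robust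

end Core

end ConnectivitySystem

namespace ConnectivitySystem

/-! ### Unions of parts of a partition -/

section Saturated

variable {E ι : Type*} {P : ι → Set E}

/-- `Y` is a union of members of the partition `P`. -/
def Saturated (P : ι → Set E) (Y : Set E) : Prop := ∀ i, P i ⊆ Y ∨ Disjoint (P i) Y

theorem Saturated.compl {Y : Set E} (h : Saturated P Y) : Saturated P Yᶜ := fun i =>
  (h i).symm.imp (fun h => Set.subset_compl_iff_disjoint_right.2 h)
    (fun h => Set.disjoint_compl_right_iff_subset.2 h)

theorem Saturated.union {X Y : Set E} (hX : Saturated P X) (hY : Saturated P Y) :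
    Saturated P (X ∪ Y) := fun i => by
  rcases hX i with h | h
  · exact Or.inl (h.trans Set.subset_union_left)
  · rcases hY i with h' | h'
    · exact Or.inl (h'.trans Set.subset_union_right)
    · exact Or.inr (Set.disjoint_union_right.2 ⟨h, h'⟩)

theorem Saturated.inter {X Y : Set E} (hX : Saturated P X) (hY : Saturated P Y) :
    Saturated P (X ∩ Y) := by
  simpa [Set.compl_union] using (hX.compl.union hY.compl).compl

theorem Saturated.diff {X Y : Set E} (hX : Saturated P X) (hY : Saturated P Y) :
    Saturated P (X \ Y) := hX.inter hY.compl

theorem saturated_part (hd : Pairwise fun i j => Disjoint (P i) (P j)) (i : ι) :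
    Saturated P (P i) := fun j => by
  by_cases h : j = i
  · exact Or.inl (by rw [h])
  · exact Or.inr (hd h)

theorem saturated_biUnion (hd : Pairwise fun i j => Disjoint (P i) (P j)) (I : Set ι) :
    Saturated P (⋃ i ∈ I, P i) := fun j => by
  by_cases h : j ∈ I
  · exact Or.inl (Set.subset_biUnion_of_mem h)
  · refine Or.inr (Set.disjoint_iUnion₂_right.2 fun i hi => hd ?_)
    rintro rfl
    exact h hi

theorem Saturated.eq_biUnion {Y : Set E} (h : Saturated P Y) (hc : (⋃ i, P i) = Set.univ) :
    Y = ⋃ i ∈ {i | P i ⊆ Y}, P i := by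
  refine Set.Subset.antisymm (fun e he => ?_) (Set.iUnion₂_subset fun i hi => hi)
  obtain ⟨i, hi⟩ := Set.mem_iUnion.1 (hc.symm ▸ Set.mem_univ e : e ∈ ⋃ i, P i)
  have : P i ⊆ Y := (h i).resolve_right fun hd => Set.disjoint_left.1 hd hi he
  exact Set.mem_biUnion this hi

theorem Saturated.exists_subset {Y : Set E} (h : Saturated P Y) (hc : (⋃ i, P i) = Set.univ)
    {e : E} (he : e ∈ Y) : ∃ i, e ∈ P i ∧ P i ⊆ Y := by
  obtain ⟨i, hi⟩ := Set.mem_iUnion.1 (hc.symm ▸ Set.mem_univ e : e ∈ ⋃ i, P i)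
  exact ⟨i, hi, (h i).resolve_right fun hd => Set.disjoint_left.1 hd hi he⟩

/-- The members of the partition `P` that are cut by `U`. -/
def crossed (P : ι → Set E) (U : Set E) : Set (Set E) :=
  {A | A ∈ Set.range P ∧ ¬ A ⊆ U ∧ ¬ Disjoint A U}

end Saturated

/-! ### Cyclic successors -/

section Cyclic

theorem cyclicNext_iff_cases {n : ℕ} {i j : Fin n} :
    CyclicNext i j ↔ ((i : ℕ) + 1 < n ∧ (j : ℕ) = i + 1) ∨ ((i : ℕ) + 1 = n ∧ (j : ℕ) = 0) := by
  unfold CyclicNext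
  have := i.isLt
  rcases Nat.lt_or_ge ((i : ℕ) + 1) n with h | h
  · rw [Nat.mod_eq_of_lt h]
    omega
  · have : (i : ℕ) + 1 = n := by omega
    rw [this, Nat.mod_self]
    omega

theorem cyclicNext_iff_eq_add_one {m : ℕ} {i j : Fin (m + 1)} : CyclicNext i j ↔ j = i + 1 := by
  unfold CyclicNext
  rw [Fin.ext_iff, Fin.val_add, Fin.val_one', Nat.add_mod_mod]

end Cyclic

/-! ### Flowers and the merging of petals -/

section Flower

variable {E : Type*} {C : ConnectivitySystem E} {k : ℕ} {𝒯 𝒮 : Set (Set E)}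

namespace IsFlower

variable {n : ℕ} {P : Fin n → Set E}

theorem exists_mem (h : C.IsFlower k 𝒯 P) (e : E) : ∃ i, e ∈ P i :=
  Set.mem_iUnion.1 (h.cover.symm ▸ Set.mem_univ e)

theorem eq_of_mem (h : C.IsFlower k 𝒯 P) {e : E} {i j : Fin n} (hi : e ∈ P i) (hj : e ∈ P j) :
    i = j := by
  by_contra hij
  exact Set.disjoint_left.1 (h.disjoint hij) hi hj

theorem isStrong_of_saturated (h : C.IsFlower k 𝒯 P) {Y : Set E} (hY : Saturated P Y)
    (hne : Y.Nonempty) : IsStrong 𝒯 Y := by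
  obtain ⟨e, he⟩ := hne
  obtain ⟨i, -, hi⟩ := hY.exists_subset h.cover he
  exact (h.strong i).mono hi

theorem reindex (h : C.IsFlower k 𝒯 P) (e : Fin n ≃ Fin n)
    (he : ∀ i j, CyclicNext i j → C.IsKSeparating k (P (e i) ∪ P (e j))) :
    C.IsFlower k 𝒯 (P ∘ e) where
  pos := h.pos
  disjoint i j hij := h.disjoint (e.injective.ne hij)
  cover := by rw [← h.cover]; exact e.surjective.iUnion_comp P
  strong i := h.strong (e i)
  ksep i := h.ksep (e i)
  ksep_next i j hij := he i j hij

theorem rotate {m : ℕ} {P : Fin (m + 1) → Set E} (h : C.IsFlower k 𝒯 P) (r : Fin (m + 1)) :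
    C.IsFlower k 𝒯 (P ∘ Equiv.addRight r) := by
  refine h.reindex _ fun i j hij => h.ksep_next _ _ ?_
  rw [cyclicNext_iff_eq_add_one] at hij ⊢
  simp only [Equiv.coe_addRight, hij]
  abel

end IsFlower

theorem IsAnemone.ksep_biUnion {n : ℕ} {P : Fin n → Set E} (h : C.IsAnemone k 𝒯 P)
    (I : Set (Fin n)) : C.IsKSeparating k (⋃ i ∈ I, P i) := by
  rcases I.eq_empty_or_nonempty with rfl | hI
  · simp only [Set.mem_empty_iff_false, Set.iUnion_of_empty, Set.iUnion_empty]
    rw [← Set.compl_univ]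
    exact (h.flower.ksep ⟨0, h.flower.pos⟩).univ.compl
  · exact h.ksep I hI

theorem IsAnemone.ksep_of_saturated {n : ℕ} {P : Fin n → Set E} (h : C.IsAnemone k 𝒯 P)
    {Y : Set E} (hY : Saturated P Y) : C.IsKSeparating k Y := by
  rw [hY.eq_biUnion h.flower.cover]
  exact h.ksep_biUnion _

theorem IsAnemone.reindex {n : ℕ} {P : Fin n → Set E} (h : C.IsAnemone k 𝒯 P)
    (e : Fin n ≃ Fin n) : C.IsFlower k 𝒯 (P ∘ e) :=
  h.flower.reindex e fun _ _ _ => h.ksep_of_saturated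
    ((saturated_part h.flower.disjoint _).union (saturated_part h.flower.disjoint _))

/-- A flower all of whose petals are non-empty. -/
structure IsProperFlower (C : ConnectivitySystem E) (k : ℕ) (𝒯 : Set (Set E)) {n : ℕ}
    (P : Fin n → Set E) : Prop extends C.IsFlower k 𝒯 P where
  nonempty : ∀ i, (P i).Nonempty

namespace IsProperFlower

/-- The petals `i` and `j` are neighbours, possibly after a permutation of the petals of an
anemone. -/
def Mergeable (C : ConnectivitySystem E) (k : ℕ) (𝒯 : Set (Set E)) {n : ℕ} (P : Fin n → Set E)
    (i j : Fin n) : Prop :=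
  i ≠ j ∧ (CyclicNext i j ∨ CyclicNext j i ∨ C.IsAnemone k 𝒯 P)

theorem Mergeable.symm {n : ℕ} {P : Fin n → Set E} {i j : Fin n} (h : Mergeable C k 𝒯 P i j) :
    Mergeable C k 𝒯 P j i :=
  ⟨h.1.symm, by have := h.2; tauto⟩

theorem Mergeable.ksep {n : ℕ} {P : Fin n → Set E} (hP : C.IsFlower k 𝒯 P) {i j : Fin n}
    (h : Mergeable C k 𝒯 P i j) : C.IsKSeparating k (P i ∪ P j) := by
  rcases h.2 with h | h | h
  · exact hP.ksep_next i j h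
  · rw [Set.union_comm]
    exact hP.ksep_next j i h
  · exact h.ksep_of_saturated
      ((saturated_part hP.disjoint _).union (saturated_part hP.disjoint _))

theorem isStrong_compl {n : ℕ} {P : Fin n → Set E} (hP : C.IsFlower k 𝒯 P) {i j : Fin n}
    (hij : i ≠ j) {Y : Set E} (hY : Y ⊆ P i) : IsStrong 𝒯 Yᶜ :=
  (hP.strong j).mono (Set.subset_compl_iff_disjoint_left.2
    ((hP.disjoint hij).mono_left hY))

theorem merge_zero_one (hT : C.IsTangle k 𝒯) {m : ℕ} {P : Fin (m + 2) → Set E}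
    (hP : C.IsProperFlower k 𝒯 P) :
    ∃ P' : Fin (m + 1) → Set E, C.IsProperFlower k 𝒯 P' ∧
      Set.range P' = insert (P 0 ∪ P 1) (Set.range P \ {P 0, P 1}) := by
  -- Non-emptiness is needed here: strength alone does not exclude empty petals, since the empty set
  -- is strong when `𝒯` is empty.
  have hinj : ∀ i j, P i = P j → i = j := fun i j hij => by
    obtain ⟨e, he⟩ := hP.nonempty i
    exact hP.eq_of_mem he (hij ▸ he)
  set P' : Fin (m + 1) → Set E := fun i => if i = 0 then P 0 ∪ P 1 else P i.succ with hP'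
  have h0 : P' 0 = P 0 ∪ P 1 := by simp [hP']
  have hs : ∀ i, i ≠ 0 → P' i = P i.succ := fun i hi => by simp [hP', hi]
  have h01 : C.IsKSeparating k (P 0 ∪ P 1) := hP.ksep_next _ _ (by
    rw [cyclicNext_iff_eq_add_one]; simp)
  have hsucc0 : ∀ i : Fin (m + 1), i.succ ≠ 0 := Fin.succ_ne_zero
  have hsucc1 : ∀ i : Fin (m + 1), i ≠ 0 → i.succ ≠ 1 := fun i hi h => hi (by
    rw [← Fin.succ_zero_eq_one] at h
    exact Fin.succ_injective _ h)
  have hrange : Set.range P' = insert (P 0 ∪ P 1) (Set.range P \ {P 0, P 1}) := by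
    ext A
    constructor
    · rintro ⟨i, rfl⟩
      by_cases hi : i = 0
      · rw [hi, h0]
        exact Or.inl rfl
      · rw [hs i hi]
        refine Or.inr ⟨⟨_, rfl⟩, ?_⟩
        rintro (h | h)
        · exact hsucc0 i (hinj _ _ h)
        · exact hsucc1 i hi (hinj _ _ h)
    · rintro (rfl | ⟨⟨i, rfl⟩, hi⟩)
      · exact ⟨0, h0⟩
      · obtain ⟨j, rfl⟩ : ∃ j : Fin (m + 1), i = j.succ := by
          refine Fin.exists_succ_eq.2 ?_ |>.imp fun _ => Eq.symm
          rintro rfl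
          exact hi (Or.inl rfl)
        refine ⟨j, hs j ?_⟩
        rintro rfl
        exact hi (Or.inr rfl)
  have hcov : (⋃ i, P' i) = Set.univ := by
    refine Set.eq_univ_of_forall fun e => ?_
    obtain ⟨i, hi⟩ := hP.exists_mem e
    refine Fin.cases ?_ (fun j => ?_) i hi
    · exact fun h => Set.mem_iUnion.2 ⟨0, by rw [h0]; exact Or.inl h⟩
    · intro h
      by_cases hj : j = 0
      · subst hj
        exact Set.mem_iUnion.2 ⟨0, by rw [h0]; exact Or.inr h⟩
      · exact Set.mem_iUnion.2 ⟨j, by rwa [hs j hj]⟩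
  refine ⟨P', ⟨⟨by omega, ?_, hcov, ?_, ?_, ?_⟩, ?_⟩, hrange⟩
  · have hd : ∀ j, j ≠ 0 → Disjoint (P' 0) (P' j) := fun j hj => by
      rw [h0, hs j hj]
      exact Set.disjoint_union_left.2 ⟨hP.disjoint (hsucc0 j).symm,
        hP.disjoint (hsucc1 j hj).symm⟩
    intro i j hij
    by_cases hi : i = 0
    · subst hi
      exact hd j hij.symm
    · by_cases hj : j = 0
      · subst hj
        exact (hd i hij).symm
      · rw [hs i hi, hs j hj]
        exact hP.disjoint fun h => hij (Fin.succ_injective _ h)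
  · intro i
    by_cases hi : i = 0
    · rw [hi, h0]
      exact (hP.strong 0).mono Set.subset_union_left
    · rw [hs i hi]
      exact hP.strong _
  · intro i
    by_cases hi : i = 0
    · rw [hi, h0]
      exact h01
    · rw [hs i hi]
      exact hP.ksep _
  · intro i j hij
    -- Only one petal remains: it is its own cyclic successor and equals `E`.
    by_cases hm : m = 0
    · subst hm
      have : P' i ∪ P' j = Set.univ := by
        rw [show j = i from Fin.ext (by omega), Set.union_self, ← hcov]
        ext e
        simp [show i = 0 from Fin.ext (by simp)]
      rw [this]
      exact (hP.ksep 0).univ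
    · rw [cyclicNext_iff_cases] at hij
      by_cases hi : i = 0
      · subst hi
        have hj1 : (j : ℕ) = 1 := by
          rcases hij with h | h
          · simpa using h.2
          · have := h.1; simp at this; omega
        have hj : j ≠ 0 := fun h => by simp [h] at hj1
        have hk12 : C.IsKSeparating k (P 1 ∪ P j.succ) := hP.ksep_next _ _ (by
          rw [cyclicNext_iff_cases]; left
          simp only [Fin.val_one, Fin.val_succ]; omega)
        rw [h0, hs j hj]
        -- Uncross two consecutive pairs that share `P 1`; `P 0` witnesses that the complement of
        -- the intersection is strong.
        have := hT.ksep_union h01 hk12 ((hP.strong 1).mono fun x hx => ⟨Or.inr hx, Or.inl hx⟩)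
          ((hP.strong 0).mono fun x hx hx' => by
            rcases hx'.2 with h | h
            · exact absurd (hP.eq_of_mem hx h) (by simp)
            · exact absurd (hP.eq_of_mem hx h) (hsucc0 j).symm)
        convert this using 1
        ext x
        simp only [Set.mem_union]
        tauto
      · by_cases hj : j = 0
        · subst hj
          have hk0 : C.IsKSeparating k (P i.succ ∪ P 0) := hP.ksep_next _ _ (by
            rw [cyclicNext_iff_cases]; right
            simp at hij ⊢; omega)
          rw [h0, hs i hi]
          have := hT.ksep_union hk0 h01 ((hP.strong 0).mono fun x hx => ⟨Or.inr hx, Or.inl hx⟩)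
            ((hP.strong 1).mono fun x hx hx' => by
              rcases hx'.1 with h | h
              · exact absurd (hP.eq_of_mem hx h) (hsucc1 i hi).symm
              · exact absurd (hP.eq_of_mem hx h) (by simp))
          convert this using 1
          ext x
          simp only [Set.mem_union]
          tauto
        · rw [hs i hi, hs j hj]
          refine hP.ksep_next _ _ ?_
          have : (j : ℕ) ≠ 0 := fun h => hj (Fin.ext (by simpa using h))
          rw [cyclicNext_iff_cases]
          simp only [Fin.val_succ]
          omega
  · intro i
    by_cases hi : i = 0
    · rw [hi, h0]
      exact (hP.nonempty 0).mono Set.subset_union_left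
    · rw [hs i hi]
      exact hP.nonempty _

theorem reindex {n : ℕ} {P : Fin n → Set E} (h : C.IsProperFlower k 𝒯 P) {e : Fin n ≃ Fin n}
    (he : C.IsFlower k 𝒯 (P ∘ e)) : C.IsProperFlower k 𝒯 (P ∘ e) :=
  ⟨he, fun i => h.nonempty (e i)⟩

/-- Two neighbouring petals may be merged. -/
theorem exists_merge (hT : C.IsTangle k 𝒯) {n : ℕ} {P : Fin n → Set E}
    (hP : C.IsProperFlower k 𝒯 P) {i j : Fin n} (hij : Mergeable C k 𝒯 P i j) :
    ∃ m < n, ∃ P' : Fin m → Set E, C.IsProperFlower k 𝒯 P' ∧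
      Set.range P' = insert (P i ∪ P j) (Set.range P \ {P i, P j}) := by
  obtain ⟨m, rfl⟩ : ∃ m, n = m + 2 := by
    refine Nat.exists_eq_add_of_le' ?_
    have := i.isLt
    have := j.isLt
    have : (i : ℕ) ≠ j := fun h => hij.1 (Fin.ext h)
    omega
  have key : ∀ e : Fin (m + 2) ≃ Fin (m + 2), C.IsFlower k 𝒯 (P ∘ e) →
      ∃ m' < m + 2, ∃ P' : Fin m' → Set E, C.IsProperFlower k 𝒯 P' ∧
      Set.range P' = insert (P (e 0) ∪ P (e 1)) (Set.range P \ {P (e 0), P (e 1)}) := by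
    intro e he
    obtain ⟨P', h1, h2⟩ := merge_zero_one hT (hP.reindex he)
    rw [EquivLike.range_comp] at h2
    exact ⟨m + 1, by omega, P', h1, h2⟩
  rcases hij.2 with h | h | h
  · have := key _ (hP.rotate i)
    rw [cyclicNext_iff_eq_add_one] at h
    simpa [h, add_comm] using this
  · have := key _ (hP.rotate j)
    rw [cyclicNext_iff_eq_add_one] at h
    simpa [h, add_comm, Set.union_comm, Set.pair_comm] using this
  -- In an anemone the petals may be permuted freely; the composite of the two swaps sends `0` to
  -- `i` and `1` to `j`.
  · have hne : Equiv.swap 0 i j ≠ 0 := fun h0 => by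
      rw [Equiv.swap_apply_eq_iff, Equiv.swap_apply_left] at h0
      exact hij.1 h0.symm
    have := key ((Equiv.swap 1 (Equiv.swap 0 i j)).trans (Equiv.swap 0 i)) (h.reindex _)
    rw [Equiv.trans_apply, Equiv.trans_apply, Equiv.swap_apply_left, Equiv.swap_apply_self,
      Equiv.swap_apply_of_ne_of_ne (by simp) hne.symm, Equiv.swap_apply_left] at this
    exact this

end IsProperFlower

end Flower

end ConnectivitySystem

namespace ConnectivitySystem

/-! ### Splitting petals along a separation -/

section Refinement

variable {E : Type*} {C : ConnectivitySystem E} {k : ℕ} {𝒯 𝒮 : Set (Set E)}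

namespace IsProperFlower

theorem injective {n : ℕ} {P : Fin n → Set E} (hP : C.IsProperFlower k 𝒯 P) :
    Function.Injective P := fun i j hij => by
  obtain ⟨e, he⟩ := hP.nonempty i
  exact hP.eq_of_mem he (hij ▸ he)

/-- The new cyclic order is `G, R, P 1, …`. The one new adjacency that is not immediate is that of
the last petal with `G`; it comes from uncrossing the union of the last petal and `P 0` with the
complement of `R ∪ P 1`. -/
theorem split_zero (hT : C.IsTangle k 𝒯) {m : ℕ} {P : Fin (m + 2) → Set E}
    (hP : C.IsProperFlower k 𝒯 P) {R G : Set E} (hRG : R ∪ G = P 0) (hd : Disjoint R G)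
    (hRne : R.Nonempty) (hGne : G.Nonempty) (hRs : IsStrong 𝒯 R) (hGs : IsStrong 𝒯 G)
    (hR : C.IsKSeparating k R) (hG : C.IsKSeparating k G) (hR1 : C.IsKSeparating k (R ∪ P 1)) :
    ∃ P' : Fin (m + 3) → Set E, C.IsProperFlower k 𝒯 P' ∧
      Set.range P' = {R, G} ∪ (Set.range P \ {P 0}) := by
  set Q : Fin (m + 2) → Set E := fun i => if i = 0 then R else P i with hQ
  have hQ0 : Q 0 = R := by simp [hQ]
  have hQs : ∀ i, i ≠ 0 → Q i = P i := fun i hi => by simp [hQ, hi]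
  have hRP : R ⊆ P 0 := hRG ▸ Set.subset_union_left
  have hGP : G ⊆ P 0 := hRG ▸ Set.subset_union_right
  have hQP : ∀ i, Q i ⊆ P i := fun i => by
    by_cases hi : i = 0
    · rw [hi, hQ0]
      exact hRP
    · rw [hQs i hi]
  have hQG : ∀ i, Disjoint G (Q i) := fun i => by
    by_cases hi : i = 0
    · rw [hi, hQ0]
      exact hd.symm
    · rw [hQs i hi]
      exact (hP.disjoint (Ne.symm hi)).mono_left hGP
  set P' : Fin (m + 3) → Set E := Fin.cons G Q with hP'
  have h0 : P' 0 = G := rfl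
  have hs : ∀ i, P' (Fin.succ i) = Q i := fun i => rfl
  have hl0 : Fin.last (m + 1) ≠ 0 := by simp [Fin.ext_iff]
  have hlast : C.IsKSeparating k (P (Fin.last (m + 1)) ∪ G) := by
    have hk : C.IsKSeparating k (P (Fin.last (m + 1)) ∪ P 0) := hP.ksep_next _ _ (by
      rw [cyclicNext_iff_cases]; right; simp)
    -- With two petals the last petal is `P 1`, and its union with `G` is simply `Rᶜ`.
    by_cases hm : m = 0
    · subst hm
      convert hR.compl using 1
      ext x
      have h01 := hP.exists_mem x
      have hRGx : x ∈ P 0 ↔ x ∈ R ∨ x ∈ G := by rw [← hRG]; rfl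
      have hdx : x ∈ R → x ∉ G := fun h => Set.disjoint_left.1 hd h
      have h10 : x ∈ P 1 → x ∉ P 0 := fun h h' => absurd (hP.eq_of_mem h h') (by simp)
      have hl : Fin.last (0 + 1) = (1 : Fin 2) := rfl
      replace h01 : x ∈ P 0 ∨ x ∈ P 1 := Fin.exists_fin_two.1 h01
      rw [hl]
      simp only [Set.mem_union, Set.mem_compl_iff]
      tauto
    · have hl1 : Fin.last (m + 1) ≠ 1 := by
        simp only [ne_eq, Fin.ext_iff, Fin.val_last, Fin.val_one]
        omega
      have := hT.ksep_inter hk hR1.compl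
        ((hP.strong (Fin.last (m + 1))).mono fun x hx => Or.inl (Or.inl hx))
        ((hP.strong 1).mono fun x hx hx' => by
          rcases hx' with (h | h) | h
          · exact hl1 (hP.eq_of_mem h hx)
          · exact absurd (hP.eq_of_mem h hx) (by simp)
          · exact h (Or.inr hx))
      convert this using 1
      ext x
      have hRGx : x ∈ P 0 ↔ x ∈ R ∨ x ∈ G := by rw [← hRG]; rfl
      have hdx : x ∈ R → x ∉ G := fun h => Set.disjoint_left.1 hd h
      have h1 : x ∈ P 1 → x ∉ P 0 := fun h h' => absurd (hP.eq_of_mem h h') (by simp)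
      have h2 : x ∈ P (Fin.last (m + 1)) → x ∉ P 0 := fun h h' => hl0 (hP.eq_of_mem h h')
      have h3 : x ∈ P (Fin.last (m + 1)) → x ∉ P 1 := fun h h' => hl1 (hP.eq_of_mem h h')
      simp only [Set.mem_union, Set.mem_inter_iff, Set.mem_compl_iff]
      tauto
  have hrQ : Set.range Q = insert R (Set.range P \ {P 0}) := by
    ext A
    constructor
    · rintro ⟨i, rfl⟩
      by_cases hi : i = 0
      · exact Or.inl (by rw [hi, hQ0])
      · rw [hQs i hi]
        exact Or.inr ⟨⟨i, rfl⟩, fun h => hi (hP.injective h)⟩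
    · rintro (rfl | ⟨⟨i, rfl⟩, hi⟩)
      · exact ⟨0, hQ0⟩
      · exact ⟨i, hQs i fun h => hi (by rw [h]; rfl)⟩
  have hrange : Set.range P' = {R, G} ∪ (Set.range P \ {P 0}) := by
    rw [hP', Fin.range_cons, hrQ]
    ext A
    simp only [Set.mem_insert_iff, Set.mem_union, Set.mem_singleton_iff]
    tauto
  refine ⟨P', ⟨⟨by omega, ?_, ?_, ?_, ?_, ?_⟩, ?_⟩, hrange⟩
  · intro i j hij
    induction i using Fin.cases with
    | zero => induction j using Fin.cases with
      | zero => exact absurd rfl hij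
      | succ j => exact hQG j
    | succ i => induction j using Fin.cases with
      | zero => exact (hQG i).symm
      | succ j =>
        exact (hP.disjoint fun h => hij (congrArg Fin.succ h)).mono (hQP i) (hQP j)
  · refine Set.eq_univ_of_forall fun e => ?_
    obtain ⟨i, hi⟩ := hP.exists_mem e
    by_cases h : i = 0
    · rw [h, ← hRG] at hi
      rcases hi with hi | hi
      · exact Set.mem_iUnion.2 ⟨Fin.succ 0, by rwa [hs, hQ0]⟩
      · exact Set.mem_iUnion.2 ⟨0, hi⟩
    · exact Set.mem_iUnion.2 ⟨Fin.succ i, by rwa [hs, hQs i h]⟩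
  · intro i
    induction i using Fin.cases with
    | zero => exact hGs
    | succ i =>
      rw [hs]
      by_cases hi : i = 0
      · rwa [hi, hQ0]
      · rw [hQs i hi]
        exact hP.strong i
  · intro i
    induction i using Fin.cases with
    | zero => exact hG
    | succ i =>
      rw [hs]
      by_cases hi : i = 0
      · rwa [hi, hQ0]
      · rw [hQs i hi]
        exact hP.ksep i
  · intro i j hij
    rw [cyclicNext_iff_cases] at hij
    induction i using Fin.cases with
    | zero =>
      obtain rfl : j = Fin.succ 0 := by
        apply Fin.ext
        simp at hij ⊢
        omega
      rw [h0, hs, hQ0, Set.union_comm, hRG]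
      exact hP.ksep 0
    | succ i =>
      induction j using Fin.cases with
      | zero =>
        obtain rfl : i = Fin.last (m + 1) := by
          apply Fin.ext
          simp at hij ⊢
          omega
        rw [h0, hs, hQs _ hl0]
        exact hlast
      | succ j =>
        have hj0 : j ≠ 0 := by
          rintro rfl
          simp at hij
        rw [hs, hs, hQs j hj0]
        by_cases hi : i = 0
        · subst hi
          obtain rfl : j = 1 := by
            apply Fin.ext
            simp at hij ⊢
            omega
          rwa [hQ0]
        · rw [hQs i hi]
          refine hP.ksep_next _ _ ?_
          rw [cyclicNext_iff_cases]
          simp at hij ⊢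
          omega
  · intro i
    induction i using Fin.cases with
    | zero => exact hGne
    | succ i =>
      rw [hs]
      by_cases hi : i = 0
      · rwa [hi, hQ0]
      · rw [hQs i hi]
        exact hP.nonempty i

/-- A petal may be split if one of its parts is `k`-separating together with a neighbour. -/
theorem exists_split (hT : C.IsTangle k 𝒯) {m : ℕ} {P : Fin (m + 2) → Set E}
    (hP : C.IsProperFlower k 𝒯 P) (i : Fin (m + 2)) {R G : Set E} (hRG : R ∪ G = P i)
    (hd : Disjoint R G) (hRne : R.Nonempty) (hGne : G.Nonempty) (hRs : IsStrong 𝒯 R)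
    (hGs : IsStrong 𝒯 G) (hR : C.IsKSeparating k R) (hG : C.IsKSeparating k G)
    (hR1 : C.IsKSeparating k (R ∪ P (i + 1))) :
    ∃ P' : Fin (m + 3) → Set E, C.IsProperFlower k 𝒯 P' ∧
      Set.range P' = {R, G} ∪ (Set.range P \ {P i}) := by
  have h0 : (P ∘ Equiv.addRight i) 0 = P i := by simp
  have h1 : (P ∘ Equiv.addRight i) 1 = P (i + 1) := by simp [add_comm]
  have := split_zero hT (hP.reindex (hP.rotate i)) (hRG.trans h0.symm) hd hRne hGne hRs hGs hR hG
    (by rwa [h1])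
  rwa [h0, EquivLike.range_comp] at this

/-- If every petal cut by `U` is cut into strong pieces and neither side of `U` is contained in a
petal, then the flower has a refinement displaying `U`. -/
theorem exists_refinement [Finite E] (hT : C.IsTangle k 𝒯) {U : Set E}
    (hU : C.IsKSeparating k U) {m : ℕ} {P : Fin (m + 2) → Set E} (hP : C.IsProperFlower k 𝒯 P)
    (hc : ∀ A ∈ crossed P U, IsStrong 𝒯 (A ∩ U) ∧ IsStrong 𝒯 (A \ U))
    (hin : ∀ i, ¬ U ⊆ P i ∧ ¬ Uᶜ ⊆ P i) :
    ∃ (m' : ℕ) (P' : Fin m' → Set E), C.IsProperFlower k 𝒯 P' ∧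
      (∀ Y, Saturated P Y → Saturated P' Y) ∧ Saturated P' U ∧
      ∀ Z, Disjoint Z U → (∃ i, Z ⊆ P i) → ∃ i, Z ⊆ P' i := by
  induction hN : (crossed P U).ncard using Nat.strong_induction_on generalizing m P with
  | _ N ih =>
  subst hN
  by_cases hemp : crossed P U = ∅
  · refine ⟨m + 2, P, hP, fun _ h => h, fun i => ?_, fun _ _ h => h⟩
    by_contra hi
    rw [not_or] at hi
    have : P i ∈ crossed P U := ⟨⟨i, rfl⟩, hi⟩
    rw [hemp] at this
    exact this
  obtain ⟨A, hA⟩ := Set.nonempty_iff_ne_empty.2 hemp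
  obtain ⟨⟨i, rfl⟩, hAU, hAd⟩ := id hA
  obtain ⟨hs1, hs2⟩ := hc _ hA
  have hred : ∀ b, (P b ∩ U).Nonempty → IsStrong 𝒯 (P b ∩ U) := fun b hb => by
    by_cases h : P b ⊆ U
    · rw [Set.inter_eq_left.2 h]
      exact hP.strong b
    · exact (hc _ ⟨⟨b, rfl⟩, h, Set.not_disjoint_iff_nonempty_inter.2 hb⟩).1
  have hgreen : ∀ b, (P b \ U).Nonempty → IsStrong 𝒯 (P b \ U) := fun b hb => by
    by_cases h : Disjoint (P b) U
    · rw [h.sdiff_eq_left]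
      exact hP.strong b
    · exact (hc _ ⟨⟨b, rfl⟩, Set.sdiff_nonempty.1 hb, h⟩).2
  have hne1 : (P i ∩ U).Nonempty := Set.not_disjoint_iff_nonempty_inter.1 hAd
  have hne2 : (P i \ U).Nonempty := Set.sdiff_nonempty.2 hAU
  -- the two colours outside a union of petals
  have hredout : ∀ J : Set (Fin (m + 2)), ∀ e ∈ U, (∀ j ∈ J, e ∉ P j) →
      IsStrong 𝒯 (U \ ⋃ j ∈ J, P j) := by
    intro J e he hj
    obtain ⟨b, hb⟩ := hP.exists_mem e
    refine (hred b ⟨e, hb, he⟩).mono fun x hx => ⟨hx.2, fun hx' => ?_⟩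
    obtain ⟨j, hjJ, hxj⟩ := Set.mem_iUnion₂.1 hx'
    have hbj : b = j := hP.eq_of_mem hx.1 hxj
    exact hj j hjJ (hbj ▸ hb)
  have hgreenout : ∀ J : Set (Fin (m + 2)), ∀ e ∉ U, (∀ j ∈ J, e ∉ P j) →
      IsStrong 𝒯 (Uᶜ \ ⋃ j ∈ J, P j) := by
    intro J e he hj
    obtain ⟨b, hb⟩ := hP.exists_mem e
    refine (hgreen b ⟨e, hb, he⟩).mono fun x hx => ⟨hx.2, fun hx' => ?_⟩
    obtain ⟨j, hjJ, hxj⟩ := Set.mem_iUnion₂.1 hx'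
    have hbj : b = j := hP.eq_of_mem hx.1 hxj
    exact hj j hjJ (hbj ▸ hb)
  obtain ⟨e, heU, hei⟩ := Set.not_subset.1 (hin i).1
  obtain ⟨f, hfU, hfi⟩ := Set.not_subset.1 (hin i).2
  have hkR : C.IsKSeparating k (P i ∩ U) := by
    refine hT.ksep_inter (hP.ksep i) hU (hs1.mono fun x hx => Or.inl hx.1) ?_
    refine (hgreenout {i} f hfU (by simpa using hfi)).mono fun x hx => ?_
    simp only [Set.mem_singleton_iff, Set.iUnion_iUnion_eq_left, Set.mem_sdiff,
      Set.mem_compl_iff, Set.mem_union] at hx ⊢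
    tauto
  have hkG : C.IsKSeparating k (P i \ U) := by
    rw [Set.sdiff_eq]
    refine hT.ksep_inter (hP.ksep i) hU.compl (hs1.mono fun x hx => Or.inl hx.1) ?_
    refine (hredout {i} e heU (by simpa using hei)).mono fun x hx => ?_
    simp only [Set.mem_singleton_iff, Set.iUnion_iUnion_eq_left, Set.mem_sdiff,
      Set.mem_compl_iff, Set.mem_union] at hx ⊢
    tauto
  have hnext : C.IsKSeparating k (P i ∪ P (i + 1)) := hP.ksep_next _ _ (by
    rw [cyclicNext_iff_eq_add_one])
  have hii : i ≠ i + 1 := by simp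
  have hdisj : ∀ x, x ∈ P i → x ∉ P (i + 1) := fun x h h' => hii (hP.eq_of_mem h h')
  -- A green element `g` beyond both petals makes the red part of `P i ∪ P (i + 1)` `k`-separating.
  -- Red in `P (i + 1)` then allows the union of this part with `P (i + 1)`.
  have hR1 : ∀ g ∉ U, g ∉ P i → g ∉ P (i + 1) → (P (i + 1) ∩ U).Nonempty →
      C.IsKSeparating k (P i ∩ U ∪ P (i + 1)) := by
    intro g hg hgi hgj hne
    have hstr := hred _ hne
    have h1 : C.IsKSeparating k ((P i ∪ P (i + 1)) ∩ U) := by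
      refine hT.ksep_inter hnext hU (hs1.mono fun x hx => Or.inl (Or.inl hx.1)) ?_
      refine (hgreenout {i, i + 1} g hg (by simp [hgi, hgj])).mono fun x hx => ?_
      simp only [Set.mem_insert_iff, Set.mem_singleton_iff, Set.iUnion_iUnion_eq_or_left,
        Set.iUnion_iUnion_eq_left, Set.mem_sdiff, Set.mem_compl_iff, Set.mem_union] at hx ⊢
      tauto
    have := hT.ksep_union h1 (hP.ksep (i + 1))
      (hstr.mono fun x hx => ⟨⟨Or.inr hx.1, hx.2⟩, hx.1⟩)
      (hs1.mono fun x hx hx' => hdisj x hx.1 hx'.2)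
    convert this using 1
    ext x
    simp only [Set.mem_union, Set.mem_inter_iff]
    tauto
  have hG1 : ∀ g ∈ U, g ∉ P i → g ∉ P (i + 1) → (P (i + 1) \ U).Nonempty →
      C.IsKSeparating k (P i \ U ∪ P (i + 1)) := by
    intro g hg hgi hgj hne
    have hstr := hgreen _ hne
    have h1 : C.IsKSeparating k ((P i ∪ P (i + 1)) \ U) := by
      rw [Set.sdiff_eq]
      refine hT.ksep_inter hnext hU.compl (hs1.mono fun x hx => Or.inl (Or.inl hx.1)) ?_
      refine (hredout {i, i + 1} g hg (by simp [hgi, hgj])).mono fun x hx => ?_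
      simp only [Set.mem_insert_iff, Set.mem_singleton_iff, Set.iUnion_iUnion_eq_or_left,
        Set.iUnion_iUnion_eq_left, Set.mem_sdiff, Set.mem_compl_iff, Set.mem_union] at hx ⊢
      tauto
    have := hT.ksep_union h1 (hP.ksep (i + 1))
      (hstr.mono fun x hx => ⟨⟨Or.inr hx.1, hx.2⟩, hx.1⟩)
      (hs1.mono fun x hx hx' => hdisj x hx.1 hx'.2)
    convert this using 1
    ext x
    simp only [Set.mem_union, Set.mem_sdiff]
    tauto
  -- One of the two colours always qualifies: it must occur in `P (i + 1)` while the other occurs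
  -- outside both petals, or vice versa with the colours exchanged. The witnesses `e` (red) and `f`
  -- (green) outside `P i` settle every case in which the two petals do not cover `E`.
  have hRG : C.IsKSeparating k (P i ∩ U ∪ P (i + 1)) ∨ C.IsKSeparating k (P i \ U ∪ P (i + 1)) := by
    by_cases hall : ∀ x, x ∈ P i ∨ x ∈ P (i + 1)
    · left
      convert hkG.compl using 1
      ext x
      have := hall x
      have := hdisj x
      simp only [Set.mem_union, Set.mem_inter_iff, Set.mem_compl_iff, Set.mem_sdiff]
      tauto
    · push Not at hall
      obtain ⟨g, hgi, hgj⟩ := hall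
      by_cases hgU : g ∈ U
      · by_cases hf : f ∈ P (i + 1)
        · exact Or.inr (hG1 g hgU hgi hgj ⟨f, hf, hfU⟩)
        · by_cases hN : (P (i + 1) ∩ U).Nonempty
          · exact Or.inl (hR1 f hfU hfi hf hN)
          · refine Or.inr (hG1 g hgU hgi hgj ?_)
            obtain ⟨y, hy⟩ := hP.nonempty (i + 1)
            exact ⟨y, hy, fun h => hN ⟨y, hy, h⟩⟩
      · by_cases he : e ∈ P (i + 1)
        · exact Or.inl (hR1 g hgU hgi hgj ⟨e, he, heU⟩)
        · by_cases hN : (P (i + 1) \ U).Nonempty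
          · exact Or.inr (hG1 e heU hei he hN)
          · refine Or.inl (hR1 g hgU hgi hgj ?_)
            obtain ⟨y, hy⟩ := hP.nonempty (i + 1)
            exact ⟨y, hy, by_contra fun h => hN ⟨y, hy, h⟩⟩
  obtain ⟨P', hP', hr⟩ : ∃ P' : Fin (m + 3) → Set E, C.IsProperFlower k 𝒯 P' ∧
      Set.range P' = {P i ∩ U, P i \ U} ∪ (Set.range P \ {P i}) := by
    rcases hRG with h | h
    · exact hP.exists_split hT i (Set.inter_union_sdiff _ _)
        (Set.disjoint_left.2 fun x hx hx' => hx'.2 hx.2) hne1 hne2 hs1 hs2 hkR hkG h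
    · have := hP.exists_split hT i (Set.sdiff_union_inter _ _)
        (Set.disjoint_left.2 fun x hx hx' => hx.2 hx'.2) hne2 hne1 hs2 hs1 hkG hkR h
      rwa [Set.pair_comm] at this
  -- Neither piece of `P i` is cut any more, so the number of cut petals drops.
  have hcr : crossed P' U ⊆ crossed P U \ {P i} := by
    rintro A ⟨hA, h1, h2⟩
    rw [hr] at hA
    rcases hA with (rfl | rfl) | ⟨hA, hA'⟩
    · exact absurd Set.inter_subset_right h1
    · exact absurd (Set.disjoint_left.2 fun x hx hx' => hx.2 hx') h2
    · exact ⟨⟨hA, h1, h2⟩, hA'⟩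
  have hin' : ∀ A ∈ Set.range P', ¬ U ⊆ A ∧ ¬ Uᶜ ⊆ A := by
    intro A hA
    rw [hr] at hA
    rcases hA with (rfl | rfl) | ⟨⟨a, rfl⟩, -⟩
    · exact ⟨fun h => (hin i).1 (h.trans Set.inter_subset_left),
        fun h => (hin i).2 (h.trans Set.inter_subset_left)⟩
    · exact ⟨fun h => (hin i).1 (h.trans Set.sdiff_subset),
        fun h => (hin i).2 (h.trans Set.sdiff_subset)⟩
    · exact hin a
  obtain ⟨m', P'', h1, h2, h3, h4⟩ := ih _ (Set.ncard_lt_ncard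
      (hcr.trans_ssubset (Set.sdiff_singleton_ssubset.2 hA))) hP'
      (fun A hA => hc A (hcr hA).1) (fun a => hin' _ ⟨a, rfl⟩) rfl
  refine ⟨m', P'', h1, fun Y hY => h2 Y fun a => ?_, h3, fun Z hZU hZ => h4 Z hZU ?_⟩
  · have ha : P' a ∈ Set.range P' := ⟨a, rfl⟩
    rw [hr] at ha
    rcases ha with (ha | ha) | ⟨⟨b, hb⟩, -⟩
    · rw [ha]
      exact (hY i).imp (Set.inter_subset_left.trans ·) fun h =>
        h.mono_left Set.inter_subset_left
    · rw [ha]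
      exact (hY i).imp (Set.sdiff_subset.trans ·) fun h => h.mono_left Set.sdiff_subset
    · rw [← hb]
      exact hY b
  · obtain ⟨a, ha⟩ := hZ
    by_cases hai : a = i
    · have : P i \ U ∈ Set.range P' := by
        rw [hr]
        exact Or.inl (Or.inr rfl)
      obtain ⟨b, hb⟩ := this
      exact ⟨b, fun x hx => hb ▸ ⟨hai ▸ ha hx, Set.disjoint_left.1 hZU hx⟩⟩
    · have : P a ∈ Set.range P' := by
        rw [hr]
        exact Or.inr ⟨⟨a, rfl⟩, fun h => hai (hP.injective h)⟩
      obtain ⟨b, hb⟩ := this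
      exact ⟨b, hb ▸ ha⟩

end IsProperFlower

end Refinement

end ConnectivitySystem

namespace ConnectivitySystem

/-! ### Crossing families on a cycle -/

section CrossingFamily

open scoped Fin.NatCast Fin.CommRing

variable {m : ℕ} {F : Set (Fin (m + 1)) → Prop}

/-- If one element of a cycle has three neighbours in the graph of pairs of a crossing family, then
the family contains all sets. -/
theorem crossingFamily_of_three_neighbours (hc : ∀ I, F I → F Iᶜ)
    (hU : ∀ I J, F I → F J → (I ∩ J).Nonempty → F (I ∪ J)) (h1 : ∀ i, F {i})
    (h2 : ∀ i, F {i, i + 1}) {c a d e : Fin (m + 1)} (ha : a ≠ c) (hd : d ≠ c) (he : e ≠ c)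
    (had : a ≠ d) (hae : a ≠ e) (hde : d ≠ e) (hca : F {c, a}) (hcd : F {c, d})
    (hce : F {c, e}) (I : Set (Fin (m + 1))) : F I := by
  have hD : ∀ I J, F I → F J → (J \ I).Nonempty → F (I \ J) := by
    intro I J hI hJ hne
    have := hc _ (hU _ _ (hc _ hI) hJ (by rwa [Set.inter_comm, ← Set.sdiff_eq]))
    rwa [Set.compl_union, compl_compl, ← Set.sdiff_eq] at this
  -- The pair `{a, d}` is the union of `{c, a}` and `{c, d}` minus `{c, e}`; the third neighbour `e`
  -- makes the difference rule applicable.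
  have clique : ∀ {c a d e : Fin (m + 1)}, a ≠ c → d ≠ c → e ≠ c → a ≠ d → a ≠ e → d ≠ e →
      F {c, a} → F {c, d} → F {c, e} → F {a, d} := by
    intro c a d e ha hd he had hae hde hca hcd hce
    have h := hU _ _ hca hcd ⟨c, by simp, by simp⟩
    have := hD _ _ h hce ⟨e, by simp, by simp [he, hae.symm, hde.symm]⟩
    convert this using 1
    ext x
    simp only [Set.mem_insert_iff, Set.mem_singleton_iff, Set.mem_sdiff, Set.mem_union]
    constructor
    · rintro (rfl | rfl) <;> tauto
    · tauto
  -- Walk round the cycle. If `x` is joined to `c`, then it is joined to two further neighbours of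
  -- `c`, and applying `clique` at the centre `x` joins `c` to `x + 1`.
  have hall : ∀ t : ℕ, F {c, c + (t : Fin (m + 1))} := by
    intro t
    induction t with
    | zero => simpa using h1 c
    | succ t ih =>
      set x := c + (t : Fin (m + 1)) with hx
      have hy : c + ((t + 1 : ℕ) : Fin (m + 1)) = x + 1 := by
        rw [hx, Nat.cast_succ, add_assoc]
      rw [hy]
      by_cases hxc : x = c
      · rw [hxc]
        exact h2 c
      obtain ⟨p, q, hpc, hqc, hpx, hqx, hpq, hp, hq⟩ : ∃ p q, p ≠ c ∧ q ≠ c ∧ p ≠ x ∧ q ≠ x ∧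
          p ≠ q ∧ F {c, p} ∧ F {c, q} := by
        by_cases hxa : a = x
        · exact ⟨d, e, hd, he, hxa ▸ had.symm, hxa ▸ hae.symm, hde, hcd, hce⟩
        · by_cases hxd : d = x
          · exact ⟨a, e, ha, he, hxa, hxd ▸ hde.symm, hae, hca, hce⟩
          · exact ⟨a, d, ha, hd, hxa, hxd, had, hca, hcd⟩
      have hxp : F {x, p} := clique hxc hpc hqc hpx.symm hqx.symm hpq ih hp hq
      have hxq : F {x, q} := clique hxc hqc hpc hqx.symm hpx.symm hpq.symm ih hq hp
      by_cases hyc : x + 1 = c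
      · rw [hyc]
        simpa using h1 c
      by_cases hyp : x + 1 = p
      · rwa [hyp]
      by_cases hyx : x + 1 = x
      · rwa [hyx]
      have := clique (Ne.symm hxc) hyx hpx (Ne.symm hyc) hpc.symm hyp
        (by rwa [Set.pair_comm]) (h2 x) hxp
      exact this
  have hall' : ∀ x, F {c, x} := fun x => by
    have := hall (x - c : Fin (m + 1)).val
    rwa [Fin.cast_val_eq_self, add_sub_cancel] at this
  have hmem : ∀ I : Set (Fin (m + 1)), F (insert c I) := by
    intro I
    induction I, I.toFinite using Set.Finite.induction_on with
    | empty => simpa using h1 c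
    | @insert x I _ _ ih =>
      have := hU _ _ (hall' x) ih ⟨c, by simp, by simp⟩
      convert this using 1
      ext y
      simp only [Set.mem_insert_iff, Set.mem_union, Set.mem_singleton_iff]
      tauto
  by_cases hcI : c ∈ I
  · rw [← Set.insert_eq_of_mem hcI]
    exact hmem I
  · have := hc _ (hmem Iᶜ)
    rwa [Set.insert_eq_of_mem hcI, compl_compl] at this

/-- An interval grows by one element at a time, through union with the edge that overlaps it in its
last element. -/
theorem crossingFamily_interval (hU : ∀ I J, F I → F J → (I ∩ J).Nonempty → F (I ∪ J))
    (h2 : ∀ i, F {i, i + 1}) (h1 : ∀ i, F {i}) (a : Fin (m + 1)) (t s : ℕ) :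
    F {x | ∃ u, t ≤ u ∧ u ≤ t + s ∧ x = a + (u : Fin (m + 1))} := by
  induction s with
  | zero =>
    convert h1 (a + (t : Fin (m + 1))) using 1
    ext x
    simp only [Set.mem_ofPred_eq, Set.mem_singleton_iff]
    constructor
    · rintro ⟨u, hu, hu', rfl⟩
      rw [show u = t by omega]
    · rintro rfl
      exact ⟨t, le_rfl, by omega, rfl⟩
  | succ s ih =>
    have := hU _ _ ih (h2 (a + ((t + s : ℕ) : Fin (m + 1))))
      ⟨a + ((t + s : ℕ) : Fin (m + 1)), ⟨t + s, by omega, by omega, rfl⟩, by simp⟩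
    convert this using 1
    have hs : a + ((t + s : ℕ) : Fin (m + 1)) + 1 = a + ((t + (s + 1) : ℕ) : Fin (m + 1)) := by
      push_cast
      abel
    rw [hs]
    ext x
    simp only [Set.mem_ofPred_eq, Set.mem_union, Set.mem_insert_iff, Set.mem_singleton_iff]
    constructor
    · rintro ⟨u, hu, hu', rfl⟩
      by_cases h : u = t + (s + 1)
      · right; right; rw [h]
      · exact Or.inl ⟨u, hu, by omega, rfl⟩
    · rintro (⟨u, hu, hu', rfl⟩ | rfl | rfl)
      · exact ⟨u, hu, by omega, rfl⟩
      · exact ⟨t + s, by omega, by omega, rfl⟩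
      · exact ⟨t + (s + 1), by omega, by omega, rfl⟩

/-- A crossing family containing the edges of a cycle consists of intervals, or of all sets. -/
theorem crossingFamily_dichotomy (hc : ∀ I, F I → F Iᶜ)
    (hU : ∀ I J, F I → F J → (I ∩ J).Nonempty → F (I ∪ J)) (h1 : ∀ i, F {i})
    (h2 : ∀ i, F {i, i + 1}) :
    (∀ I : Set (Fin (m + 1)), I.Nonempty → F I) ∨
      ∀ I : Set (Fin (m + 1)), I.Nonempty → F I → IsCyclicInterval I := by
  refine or_iff_not_imp_right.2 fun hnot => ?_
  push Not at hnot
  obtain ⟨I, hI, hFI, hint⟩ := hnot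
  -- Start at the beginning of a run of `I`. Without one, `I` would be closed under predecessors,
  -- hence be the whole cycle, which is an interval.
  obtain ⟨a, haI, haI'⟩ : ∃ a ∈ I, a - 1 ∉ I := by
    by_contra hcon
    push Not at hcon
    obtain ⟨b, hb⟩ := hI
    have hall : ∀ t : ℕ, b - (t : Fin (m + 1)) ∈ I := by
      intro t
      induction t with
      | zero => simpa using hb
      | succ t ih =>
        have := hcon _ ih
        rwa [sub_sub, ← Nat.cast_succ] at this
    refine hint ⟨0, m + 1, fun j => ⟨fun _ => ⟨j, j.isLt, ?_⟩, fun _ => ?_⟩⟩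
    · rw [zero_add, Nat.mod_eq_of_lt j.isLt]
    · have := hall (b - j : Fin (m + 1)).val
      rwa [Fin.cast_val_eq_self, sub_sub_cancel] at this
  set p : ℕ → Fin (m + 1) := fun t => a + (t : Fin (m + 1)) with hp
  have hpsucc : ∀ t, p t + 1 = p (t + 1) := fun t => by
    simp only [hp]
    push_cast
    abel
  have hpinj : ∀ {t s}, t ≤ m → s ≤ m → p t = p s → t = s := by
    intro t s ht hs h
    have := congrArg Fin.val (add_left_cancel h)
    rwa [Fin.val_natCast, Fin.val_natCast, Nat.mod_eq_of_lt (by omega),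
      Nat.mod_eq_of_lt (by omega)] at this
  have hpsurj : ∀ x, ∃ t ≤ m, x = p t := fun x =>
    ⟨(x - a : Fin (m + 1)).val, by omega, by simp [hp]⟩
  have hp0 : p 0 = a := by simp [hp]
  have hpm1 : p (m + 1) = a := by simp [hp]
  have hpm : p m ∉ I := by
    have : p m = a - 1 := by rw [eq_sub_iff_add_eq, hpsucc, hpm1]
    rwa [this]
  classical
  have hex : ∃ t, p t ∉ I := ⟨m, hpm⟩
  -- Counting from `a`, the first run of `I` ends at position `l - 1`; below, `c` is the first
  -- position after `l` that returns to `I`.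
  set l := Nat.find hex with hl
  have hlI : p l ∉ I := Nat.find_spec hex
  have hlmin : ∀ t < l, p t ∈ I := fun t ht => not_not.1 (Nat.find_min hex ht)
  have hl0 : l ≠ 0 := fun h => hlI (by rwa [h, hp0])
  have hlm : l ≤ m := Nat.find_min' hex hpm
  have hex' : ∃ t, l < t ∧ t ≤ m ∧ p t ∈ I := by
    by_contra hcon
    push Not at hcon
    refine hint ⟨a, l, fun j => ⟨fun hj => ?_, ?_⟩⟩
    · obtain ⟨t, ht, rfl⟩ := hpsurj j
      refine ⟨t, ?_, by simp [hp, Fin.val_add]⟩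
      by_contra hlt
      rcases Nat.lt_or_ge l t with h | h
      · exact hcon t h ht hj
      · rw [show t = l by omega] at hj
        exact hlI hj
    · rintro ⟨t, ht, hj⟩
      have : j = p t := by
        apply Fin.ext
        simp [hp, Fin.val_add, hj]
      rw [this]
      exact hlmin t ht
  set c := Nat.find hex' with hcdef
  obtain ⟨hlc, hcm, hcI⟩ : l < c ∧ c ≤ m ∧ p c ∈ I := Nat.find_spec hex'
  have hcmin : ∀ t, l ≤ t → t < c → p t ∉ I := fun t hlt htc htI => by
    rcases Nat.lt_or_ge l t with h | h
    · exact Nat.find_min hex' htc ⟨h, by omega, htI⟩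
    · rw [show t = l by omega] at htI
      exact hlI htI
  have hcm' : c ≠ m := fun h => hpm (by rw [h] at hcI; exact hcI)
  -- `J` is the interval from position `l - 1` to position `c`. It meets `I` only in its two ends,
  -- and `p m` lies outside both sets, so the pair of ends belongs to the family.
  obtain ⟨J, hJ, hJdef⟩ : ∃ J, F J ∧
      ∀ x, x ∈ J ↔ ∃ u, l - 1 ≤ u ∧ u ≤ l - 1 + (c - l + 1) ∧ x = p u :=
    ⟨_, crossingFamily_interval hU h2 h1 a (l - 1) (c - l + 1), fun _ => Iff.rfl⟩
  have hpmJ : p m ∉ J := by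
    rw [hJdef]
    rintro ⟨u, hu, hu', h⟩
    have := hpinj le_rfl (by omega) h
    omega
  have hpair : F {p (l - 1), p c} := by
    have := hc _ (hU _ _ (hc _ hFI) (hc _ hJ) ⟨p m, hpm, hpmJ⟩)
    convert this using 1
    rw [Set.compl_union, compl_compl, compl_compl]
    ext x
    simp only [Set.mem_insert_iff, Set.mem_singleton_iff, Set.mem_inter_iff, hJdef]
    constructor
    · rintro (rfl | rfl)
      · exact ⟨hlmin _ (by omega), ⟨l - 1, le_rfl, by omega, rfl⟩⟩
      · exact ⟨hcI, ⟨c, by omega, by omega, rfl⟩⟩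
    · rintro ⟨hxI, u, hu, hu', rfl⟩
      by_cases h : u = l - 1
      · exact Or.inl (by rw [h])
      · by_cases h' : u = c
        · exact Or.inr (by rw [h'])
        · exact absurd hxI (hcmin u (by omega) (by omega))
  -- The third neighbour of `p (l - 1)`, besides `p l` and `p c`, is its cyclic predecessor; this is
  -- `p m` if `l = 1`.
  obtain ⟨q, hqm, hq1, hql, hqc, hqx⟩ : ∃ q ≤ m, p (q + 1) = p (l - 1) ∧ q ≠ l ∧ q ≠ c ∧
      q ≠ l - 1 := by
    by_cases h : l = 1
    · refine ⟨m, le_rfl, ?_, by omega, by omega, by omega⟩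
      rw [hpm1, h, ← hp0]
    · exact ⟨l - 2, by omega, by rw [show l - 2 + 1 = l - 1 by omega], by omega, by omega,
        by omega⟩
  refine fun I _ => crossingFamily_of_three_neighbours hc hU h1 h2 (c := p (l - 1)) (a := p l) (d := p c)
    (e := p q) ?_ ?_ ?_ ?_ ?_ ?_ ?_ hpair ?_ I
  · exact fun h => by have := hpinj (by omega) (by omega) h; omega
  · exact fun h => by have := hpinj (by omega) (by omega) h; omega
  · exact fun h => by have := hpinj (by omega) (by omega) h; omega
  · exact fun h => by have := hpinj (by omega) (by omega) h; omega
  · exact fun h => by have := hpinj (by omega) (by omega) h; omega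
  · exact fun h => by have := hpinj (by omega) (by omega) h; omega
  · have := h2 (p (l - 1))
    rwa [hpsucc, show l - 1 + 1 = l by omega] at this
  · have := h2 (p q)
    rwa [hpsucc, hq1, Set.pair_comm] at this

end CrossingFamily

/-! ### The anemone–daisy dichotomy -/

section AnemoneOrDaisy

open scoped Fin.NatCast Fin.CommRing

variable {E : Type*} {C : ConnectivitySystem E} {k : ℕ} {𝒯 : Set (Set E)}

/-- Every flower is an anemone or a daisy. -/
theorem IsFlower.isAnemone_or_isDaisy (hT : C.IsTangle k 𝒯) {n : ℕ} {P : Fin n → Set E}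
    (hP : C.IsFlower k 𝒯 P) : C.IsAnemone k 𝒯 P ∨ C.IsDaisy k 𝒯 P := by
  obtain ⟨m, rfl⟩ : ∃ m, n = m + 1 := ⟨n - 1, by have := hP.pos; omega⟩
  -- The index sets of `k`-separating unions of petals form a crossing family, by uncrossing: a
  -- common petal makes the intersection strong, and an omitted petal makes its complement strong.
  set F : Set (Fin (m + 1)) → Prop := fun I => C.IsKSeparating k (⋃ i ∈ I, P i) with hF
  have hcompl : ∀ I : Set (Fin (m + 1)), (⋃ i ∈ Iᶜ, P i) = (⋃ i ∈ I, P i)ᶜ := by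
    intro I
    ext x
    obtain ⟨i, hi⟩ := hP.exists_mem x
    have hiff : ∀ J : Set (Fin (m + 1)), x ∈ (⋃ i ∈ J, P i) ↔ i ∈ J := fun J => by
      refine ⟨fun h => ?_, fun h => Set.mem_biUnion h hi⟩
      obtain ⟨j, hj, hxj⟩ := Set.mem_iUnion₂.1 h
      exact hP.eq_of_mem hi hxj ▸ hj
    rw [Set.mem_compl_iff, hiff, hiff, Set.mem_compl_iff]
  have hc : ∀ I, F I → F Iᶜ := fun I hI => by
    simp only [hF, hcompl]
    exact hI.compl
  have hU : ∀ I J, F I → F J → (I ∩ J).Nonempty → F (I ∪ J) := by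
    rintro I J hI hJ ⟨i, hiI, hiJ⟩
    by_cases hIJ : I ∩ J = Set.univ
    · have h : I = Set.univ := Set.eq_univ_of_univ_subset (hIJ ▸ Set.inter_subset_left)
      rw [h, Set.univ_union, ← h]
      exact hI
    · obtain ⟨j, hj⟩ := (Set.ne_univ_iff_exists_notMem _).1 hIJ
      simp only [hF, Set.biUnion_union]
      refine hT.ksep_union hI hJ ((hP.strong i).mono fun x hx =>
        ⟨Set.mem_biUnion hiI hx, Set.mem_biUnion hiJ hx⟩) ((hP.strong j).mono ?_)
      rintro x hx ⟨h1, h2⟩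
      obtain ⟨i1, h1, hx1⟩ := Set.mem_iUnion₂.1 h1
      obtain ⟨i2, h2, hx2⟩ := Set.mem_iUnion₂.1 h2
      refine hj ⟨?_, ?_⟩
      · exact hP.eq_of_mem hx1 hx ▸ h1
      · exact hP.eq_of_mem hx2 hx ▸ h2
  have h1 : ∀ i, F {i} := fun i => by simpa [hF] using hP.ksep i
  have h2 : ∀ i, F {i, i + 1} := fun i => by
    simpa [hF] using hP.ksep_next i (i + 1) (cyclicNext_iff_eq_add_one.2 rfl)
  rcases crossingFamily_dichotomy hc hU h1 h2 with h | h
  · exact Or.inl ⟨hP, h⟩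
  · refine Or.inr ⟨hP, fun I hI => ⟨h I hI, ?_⟩⟩
    rintro ⟨a, l, hal⟩
    obtain ⟨i, hi⟩ := hI
    obtain ⟨t, ht, -⟩ := (hal i).1 hi
    -- `I` is non-empty, so `l` is positive and the offsets run from `0` to `l - 1`.
    have := crossingFamily_interval hU h2 h1 (a : Fin (m + 1)) 0 (l - 1)
    suffices he : I = {x | ∃ u, 0 ≤ u ∧ u ≤ 0 + (l - 1) ∧
        x = (a : Fin (m + 1)) + (u : Fin (m + 1))} by
      rw [he]
      exact this
    ext j
    rw [hal]
    simp only [Set.mem_ofPred_eq]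
    constructor
    · rintro ⟨u, hu, hj⟩
      exact ⟨u, by omega, by omega, Fin.ext (by simp [Fin.val_add, hj])⟩
    · rintro ⟨u, -, hu, rfl⟩
      exact ⟨u, by omega, by simp [Fin.val_add]⟩

end AnemoneOrDaisy

end ConnectivitySystem

namespace ConnectivitySystem

/-! ### Optimal flowers -/

section Optimal

variable {E : Type*} {C : ConnectivitySystem E} {k : ℕ} {𝒯 𝒮 : Set (Set E)}

/-- The `(k, 𝒮)`-separations that are displayed by the partition `P`, up to equivalence. -/
def displayedUpTo (C : ConnectivitySystem E) (k : ℕ) (𝒯 𝒮 : Set (Set E)) {n : ℕ}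
    (P : Fin n → Set E) : Set (Set E) :=
  {Y | C.IsSSep k 𝒮 Y ∧ ∃ Y', Saturated P Y' ∧ C.SepEquiv k 𝒯 Y Y'}

/-- Among the flowers with a petal containing `Z`, the flower `P` displays a maximal set of
`(k, 𝒮)`-separations up to equivalence, and does so with as few petals as possible. -/
structure IsOptimal (C : ConnectivitySystem E) (k : ℕ) (𝒯 𝒮 : Set (Set E)) (Z : Set E) {n : ℕ}
    (P : Fin n → Set E) : Prop where
  flower : C.IsProperFlower k 𝒯 P
  exists_subset : ∃ i, Z ⊆ P i
  optimal : ∀ (m : ℕ) (P' : Fin m → Set E), C.IsProperFlower k 𝒯 P' → (∃ i, Z ⊆ P' i) →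
    C.displayedUpTo k 𝒯 𝒮 P ⊆ C.displayedUpTo k 𝒯 𝒮 P' →
      C.displayedUpTo k 𝒯 𝒮 P' ⊆ C.displayedUpTo k 𝒯 𝒮 P ∧ n ≤ m

theorem exists_isOptimal [Finite E] {Z : Set E} {n : ℕ} {P : Fin n → Set E}
    (hP : C.IsProperFlower k 𝒯 P) (hZ : ∃ i, Z ⊆ P i) :
    ∃ (m : ℕ) (P' : Fin m → Set E), C.IsOptimal k 𝒯 𝒮 Z P' ∧
      C.displayedUpTo k 𝒯 𝒮 P ⊆ C.displayedUpTo k 𝒯 𝒮 P' := by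
  set 𝒟 : Set (Set (Set E)) := {D | C.displayedUpTo k 𝒯 𝒮 P ⊆ D ∧ ∃ (m : ℕ) (P' : Fin m → Set E),
    C.IsProperFlower k 𝒯 P' ∧ (∃ i, Z ⊆ P' i) ∧ C.displayedUpTo k 𝒯 𝒮 P' = D} with h𝒟
  obtain ⟨D, hD⟩ := (Set.toFinite 𝒟).exists_maximal ⟨_, subset_rfl, n, P, hP, hZ, rfl⟩
  obtain ⟨hPD, hex⟩ : D ∈ 𝒟 := hD.prop
  classical
  obtain ⟨P', hP', hZ', hDP'⟩ := Nat.find_spec hex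
  refine ⟨_, P', ⟨hP', hZ', fun m Q hQ hZQ hle => ?_⟩, hDP'.symm ▸ hPD⟩
  rw [hDP'] at hle ⊢
  have hQD : C.displayedUpTo k 𝒯 𝒮 Q ⊆ D :=
    hD.le_of_ge (⟨hPD.trans hle, m, Q, hQ, hZQ, rfl⟩ : C.displayedUpTo k 𝒯 𝒮 Q ∈ 𝒟) hle
  exact ⟨hQD, Nat.find_min' hex ⟨Q, hQ, hZQ, hQD.antisymm hle⟩⟩

/-- The set `U` cuts every displayed `k`-separating set trivially, into two weak sets or into two
strong sets. -/
def Tame (C : ConnectivitySystem E) (k : ℕ) (𝒯 : Set (Set E)) {n : ℕ} (P : Fin n → Set E)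
    (U : Set E) : Prop :=
  ∀ Q, Saturated P Q → C.IsKSeparating k Q →
    (IsStrong 𝒯 (Q ∩ U) → IsWeak 𝒯 (Q \ U) → Q ⊆ U) ∧
      (IsStrong 𝒯 (Q \ U) → IsWeak 𝒯 (Q ∩ U) → Disjoint Q U)

theorem crossed_compl {ι : Type*} (P : ι → Set E) (U : Set E) : crossed P Uᶜ = crossed P U := by
  ext A
  simp only [crossed, Set.mem_ofPred_eq, Set.subset_compl_iff_disjoint_right,
    Set.disjoint_compl_right_iff_subset]
  tauto

/-- Petals inside `Q` are no longer cut by `U ∪ Q`, and the others are cut as before. A petal of `Q`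
that is not inside `U` was cut, as otherwise this strong set would lie in the weak set `Q \ U`. -/
theorem crossed_union_ssubset {n : ℕ} {P : Fin n → Set E} (hP : C.IsFlower k 𝒯 P) {Q U : Set E}
    (hQ : Saturated P Q) (hw : IsWeak 𝒯 (Q \ U)) (hQU : ¬ Q ⊆ U) :
    crossed P (U ∪ Q) ⊂ crossed P U := by
  obtain ⟨e, heQ, heU⟩ := Set.not_subset.1 hQU
  obtain ⟨b, heb, hb⟩ := hQ.exists_subset hP.cover heQ
  refine ⟨?_, fun h => ?_⟩
  · rintro A ⟨⟨a, rfl⟩, h1, h2⟩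
    rcases hQ a with h | h
    · exact absurd (h.trans Set.subset_union_right) h1
    · exact ⟨⟨a, rfl⟩, fun h' => h1 (h'.trans Set.subset_union_left),
        fun h' => h2 (Set.disjoint_union_right.2 ⟨h', h⟩)⟩
  · have hbU : P b ∈ crossed P U := by
      refine ⟨⟨b, rfl⟩, fun h => heU (h heb), fun h => hP.strong b (hw.mono fun x hx => ?_)⟩
      exact ⟨hb hx, Set.disjoint_left.1 h hx⟩
    exact (h hbU).2.1 (hb.trans Set.subset_union_right)

theorem sepEquiv_union_of_isWeak [Finite E] (hT : C.IsTangle k 𝒯) {U Q : Set E}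
    (hU : C.IsStrongSep k 𝒯 U) (hne : C.fcl k 𝒯 U ≠ Set.univ) (hQ : C.IsKSeparating k Q)
    (hs : IsStrong 𝒯 (Q ∩ U)) (hw : IsWeak 𝒯 (Q \ U)) : C.SepEquiv k 𝒯 U (U ∪ Q) := by
  have hk : C.IsKSeparating k (U ∪ Q) := by
    rw [Set.union_comm]
    exact hT.ksep_union hQ hU.ksep hs (hU.strong_compl.mono fun x hx hx' => hx hx'.2)
  have he : U ∪ Q = U ∪ (Q \ U) := by rw [Set.union_sdiff_self]
  refine sepEquiv_of_subset_fcl hT hU hne Set.subset_union_left ?_ hk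
  rw [he] at hk ⊢
  exact Set.union_subset (subset_fcl _) (hT.subset_fcl_of_isWeak hU.strong (subset_fcl _) hw hk)

/-- Take an equivalent separation disjoint from `Z` that cuts the fewest petals. A displayed set cut
into a strong and a weak piece can be moved to the side of its strong piece without changing the
equivalence class, which lowers the count. -/
theorem exists_tame [Finite E] (hT : C.IsTangle k 𝒯) (h𝒮 : C.IsTreeCompatible k 𝒯 𝒮) {n : ℕ}
    {P : Fin n → Set E} (hP : C.IsFlower k 𝒯 P) {Z U : Set E} (hZ : Z = ∅ ∨ IsStrong 𝒯 Z)
    (hZP : ∃ i, Z ⊆ P i) (hU : C.IsSSep k 𝒮 U) (hZU : Disjoint Z U) :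
    ∃ U', C.SepEquiv k 𝒯 U U' ∧ Disjoint Z U' ∧ C.Tame k 𝒯 P U' := by
  obtain ⟨V, ⟨hUV, hZV⟩, hmin⟩ := Set.exists_min_image
    {U' | C.SepEquiv k 𝒯 U U' ∧ Disjoint Z U'} (fun U' => (crossed P U').ncard) (Set.toFinite _)
    ⟨U, h𝒮.sepEquiv_refl hU, hZU⟩
  have hV : C.IsSSep k 𝒮 V := h𝒮.isSSep_of_sepEquiv hU hUV
  have hV' := h𝒮.isStrongSep hV
  refine ⟨V, hUV, hZV, fun Q hQ hk => ⟨fun hs hw => ?_, fun hs hw => ?_⟩⟩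
  · by_contra hQV
    have hlt := Set.ncard_lt_ncard (crossed_union_ssubset hP hQ hw hQV)
    refine absurd (hmin (V ∪ Q) ⟨hUV.trans
      (sepEquiv_union_of_isWeak hT hV' (h𝒮.fcl_ne_univ hV) hk hs hw), ?_⟩) (not_le.2 hlt)
    refine Set.disjoint_union_right.2 ⟨hZV, ?_⟩
    obtain ⟨i, hi⟩ := hZP
    -- Disjointness from `Z` survives: if `Q` contained the petal around a strong `Z`, then `Z`
    -- would lie in the weak set `Q \ V`.
    rcases hQ i with h | h
    · rcases hZ with rfl | hZ
      · exact Set.empty_disjoint _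
      · exact absurd (hw.mono fun x hx => ⟨h (hi hx), Set.disjoint_left.1 hZV hx⟩) hZ
    · exact h.mono_left hi
  · by_contra hQV
    have hw' : IsWeak 𝒯 (Q \ Vᶜ) := by rwa [Set.sdiff_compl]
    have hlt := Set.ncard_lt_ncard (crossed_union_ssubset hP hQ hw'
      (by rwa [Set.subset_compl_iff_disjoint_right]))
    rw [crossed_compl] at hlt
    have := sepEquiv_union_of_isWeak hT hV'.compl (h𝒮.fcl_compl_ne_univ hV) hk hs hw'
    have hle := hmin (Vᶜ ∪ Q)ᶜ ⟨(hUV.compl_right.trans this).compl_right, ?_⟩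
    · rw [crossed_compl] at hle
      exact absurd hle (not_le.2 hlt)
    · exact hZV.mono_right fun x hx => by
        by_contra hxV
        exact hx (Or.inl hxV)

theorem IsSSep.nonempty (h𝒮 : C.IsTreeCompatible k 𝒯 𝒮) {X : Set E} (hX : C.IsSSep k 𝒮 X) :
    X.Nonempty := by
  rw [Set.nonempty_iff_ne_empty]
  rintro rfl
  refine h𝒮.fcl_compl_ne_univ hX (Set.eq_univ_of_univ_subset ?_)
  rw [Set.compl_empty]
  exact subset_fcl _

/-- In a daisy, `X` corresponds to an interval of at least two indices, so it contains a cyclic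
neighbour of each of its petals; in an anemone any other petal will do. -/
theorem exists_mergeable (hT : C.IsTangle k 𝒯) {n : ℕ} {P : Fin n → Set E}
    (hP : C.IsFlower k 𝒯 P) {X : Set E} (hX : Saturated P X) (hk : C.IsKSeparating k X) {i : Fin n}
    (hi : P i ⊆ X) (hne : ¬ X ⊆ P i) : ∃ j, IsProperFlower.Mergeable C k 𝒯 P i j ∧ P j ⊆ X := by
  obtain ⟨e, heX, hei⟩ := Set.not_subset.1 hne
  obtain ⟨b, heb, hb⟩ := hX.exists_subset hP.cover heX
  have hbi : i ≠ b := fun h => hei (h ▸ heb)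
  rcases hP.isAnemone_or_isDaisy hT with hA | hD
  · exact ⟨b, ⟨hbi, Or.inr (Or.inr hA)⟩, hb⟩
  · have hXI := hX.eq_biUnion hP.cover
    rw [hXI] at hk
    obtain ⟨a, l, hal⟩ := (hD.ksep_iff _ ⟨i, hi⟩).1 hk
    obtain ⟨t, ht, hit⟩ := (hal i).1 hi
    obtain ⟨s, hs, hbs⟩ := (hal b).1 hb
    have hpos := hP.pos
    have hst : s ≠ t := by
      rintro rfl
      exact hbi (Fin.ext (hit.trans hbs.symm))
    have hn : 2 ≤ n := by
      have := i.isLt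
      have := b.isLt
      have : (i : ℕ) ≠ b := fun h => hbi (Fin.ext h)
      omega
    have hne : ∀ {x y : Fin n}, CyclicNext x y → x ≠ y := by
      rintro x y h rfl
      rw [cyclicNext_iff_cases] at h
      omega
    -- If `i` sits at the end of the interval, step backwards; `t` is then positive because another
    -- offset `s` occurs.
    by_cases htl : t + 1 < l
    · refine ⟨⟨(a + (t + 1)) % n, Nat.mod_lt _ hpos⟩, ?_, (hal _).2 ⟨t + 1, htl, rfl⟩⟩
      have : CyclicNext i ⟨(a + (t + 1)) % n, Nat.mod_lt _ hpos⟩ := by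
        simp only [CyclicNext, hit, Nat.mod_add_mod]
        rfl
      exact ⟨hne this, Or.inl this⟩
    · refine ⟨⟨(a + (t - 1)) % n, Nat.mod_lt _ hpos⟩, ?_, (hal _).2 ⟨t - 1, by omega, rfl⟩⟩
      have : CyclicNext ⟨(a + (t - 1)) % n, Nat.mod_lt _ hpos⟩ i := by
        simp only [CyclicNext, hit, Nat.mod_add_mod]
        congr 1
        omega
      exact ⟨(hne this).symm, Or.inr (Or.inl this)⟩

/-- A set that is cut into weak parts can only be neighboured by sets cut into two weak or two
strong parts. -/
theorem Tame.weak_or_strong {n : ℕ} {P : Fin n → Set E} {U J K : Set E}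
    (hU : C.Tame k 𝒯 P U) (hJ : IsStrong 𝒯 J) (hK : Saturated P K) (hkK : C.IsKSeparating k K)
    (hJK : Saturated P (J ∪ K)) (hkJK : C.IsKSeparating k (J ∪ K)) (hJ1 : IsWeak 𝒯 (J ∩ U))
    (hJ2 : IsWeak 𝒯 (J \ U)) :
    (IsWeak 𝒯 (K ∩ U) ∧ IsWeak 𝒯 (K \ U)) ∨ (IsStrong 𝒯 (K ∩ U) ∧ IsStrong 𝒯 (K \ U)) := by
  rcases isWeak_or_isStrong (𝒯 := 𝒯) (K ∩ U) with h1 | h1 <;>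
    rcases isWeak_or_isStrong (𝒯 := 𝒯) (K \ U) with h2 | h2
  · exact Or.inl ⟨h1, h2⟩
  -- In a mixed case tameness puts `K` on one side of `U`; then `J ∪ K` is cut in the same mixed way
  -- and is on that side too, making `J` weak.
  · have hd := (hU K hK hkK).2 h2 h1
    have := (hU _ hJK hkJK).2 (h2.mono fun x hx => ⟨Or.inr hx.1, hx.2⟩) (hJ1.mono ?_)
    · refine absurd (hJ2.mono fun x hx => ⟨hx, ?_⟩) hJ
      exact Set.disjoint_left.1 this (Or.inl hx)
    · rintro x ⟨hx | hx, hxU⟩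
      · exact ⟨hx, hxU⟩
      · exact absurd hxU (Set.disjoint_left.1 hd hx)
  · have hd := (hU K hK hkK).1 h1 h2
    have := (hU _ hJK hkJK).1 (h1.mono fun x hx => ⟨Or.inr hx.1, hx.2⟩) (hJ2.mono ?_)
    · exact absurd (hJ1.mono fun x hx => ⟨hx, this (Or.inl hx)⟩) hJ
    · rintro x ⟨hx | hx, hxU⟩
      · exact ⟨hx, hxU⟩
      · exact absurd (hd hx) hxU
  · exact Or.inr ⟨h1, h2⟩

namespace IsOptimal

variable {Z : Set E} {n : ℕ} {P : Fin n → Set E}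

/-- Merging neighbouring petals of an optimal flower loses a displayed separation. -/
theorem exists_lost (h : C.IsOptimal k 𝒯 𝒮 Z P) (hT : C.IsTangle k 𝒯)
    (h𝒮 : C.IsTreeCompatible k 𝒯 𝒮) {i j : Fin n}
    (hij : IsProperFlower.Mergeable C k 𝒯 P i j) :
    ∃ Y, Saturated P Y ∧ C.IsSSep k 𝒮 Y ∧ P i ⊆ Y ∧ Disjoint (P j) Y ∧
      ∀ Y', Saturated P Y' → C.SepEquiv k 𝒯 Y Y' → ¬ (P i ⊆ Y' ↔ P j ⊆ Y') := by
  obtain ⟨m, hm, P', hP', hr⟩ := h.flower.exists_merge hT hij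
  -- The merged flower still has a petal containing `Z` but has fewer petals, so optimality of `P`
  -- prevents it from displaying as much.
  have hnd : ¬ C.displayedUpTo k 𝒯 𝒮 P ⊆ C.displayedUpTo k 𝒯 𝒮 P' := by
    refine fun hle => absurd (h.optimal m P' hP' ?_ hle).2 (not_le.2 hm)
    obtain ⟨a, ha⟩ := h.exists_subset
    by_cases haij : P a = P i ∨ P a = P j
    · obtain ⟨b, hb⟩ : P i ∪ P j ∈ Set.range P' := hr ▸ Or.inl rfl
      refine ⟨b, hb ▸ ha.trans ?_⟩
      rcases haij with h | h
      · exact h ▸ Set.subset_union_left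
      · exact h ▸ Set.subset_union_right
    · obtain ⟨b, hb⟩ : P a ∈ Set.range P' := hr ▸ Or.inr ⟨⟨a, rfl⟩, haij⟩
      exact ⟨b, hb ▸ ha⟩
  obtain ⟨Y₀, ⟨hY₀, Y, hY, hYY⟩, hlost⟩ := Set.not_subset.1 hnd
  have key : ∀ Y', Saturated P Y' → C.SepEquiv k 𝒯 Y Y' → ¬ (P i ⊆ Y' ↔ P j ⊆ Y') := by
    refine fun Y' hY' hYY' hiff => hlost ⟨hY₀, Y', fun a => ?_, hYY.trans hYY'⟩
    have ha : P' a ∈ Set.range P' := ⟨a, rfl⟩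
    rw [hr] at ha
    rcases ha with ha | ⟨⟨b, hb⟩, -⟩
    · rw [ha]
      rcases hY' i with hi | hi
      · exact Or.inl (Set.union_subset hi (hiff.1 hi))
      · rcases hY' j with hj | hj
        · exact Or.inl (Set.union_subset (hiff.2 hj) hj)
        · exact Or.inr (Set.disjoint_union_left.2 ⟨hi, hj⟩)
    · rw [← hb]
      exact hY' b
  have hS : C.IsSSep k 𝒮 Y := h𝒮.isSSep_of_sepEquiv hY₀ hYY
  have hYr := h𝒮.sepEquiv_refl hS
  have hk := key Y hY hYr
  by_cases hi : P i ⊆ Y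
  · exact ⟨Y, hY, hS, hi, (hY j).resolve_left fun hj => hk ⟨fun _ => hj, fun _ => hi⟩, key⟩
  · have hj : P j ⊆ Y := by
      by_contra hj
      exact hk ⟨fun h => absurd h hi, fun h => absurd h hj⟩
    exact ⟨Yᶜ, hY.compl, hS.compl,
      Set.subset_compl_iff_disjoint_right.2 ((hY i).resolve_left hi),
      Set.disjoint_compl_right_iff_subset.2 hj,
      fun Y' h1 h2 => key Y' h1 (hYr.compl_right.trans h2)⟩

/-- Merging the petals loses some `Y` containing `P j` and avoiding `P i`. If `P i` lay in the full
closure of `P j`, adding it to `Y` would give an equivalent displayed set that does not separate the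
two petals. -/
theorem not_subset_fcl [Finite E] (h : C.IsOptimal k 𝒯 𝒮 Z P) (hT : C.IsTangle k 𝒯)
    (h𝒮 : C.IsTreeCompatible k 𝒯 𝒮) {i j : Fin n}
    (hij : IsProperFlower.Mergeable C k 𝒯 P i j) : ¬ P i ⊆ C.fcl k 𝒯 (P j) := by
  intro hsub
  have hP := h.flower.toIsFlower
  obtain ⟨Y, hY, hS, hj, hi, hlost⟩ := h.exists_lost hT h𝒮 hij.symm
  have hk : C.IsKSeparating k (Y ∪ P i) := by
    have := hT.ksep_union hS.ksep (hij.ksep hP) ((hP.strong j).mono fun x hx => ⟨hj hx, Or.inr hx⟩)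
      ((hP.strong i).mono fun x hx hx' => Set.disjoint_left.1 hi hx hx'.1)
    rwa [Set.union_comm (P i), ← Set.union_assoc, Set.union_eq_self_of_subset_right hj] at this
  refine hlost (Y ∪ P i) (hY.union (saturated_part hP.disjoint i))
    (sepEquiv_of_subset_fcl hT (h𝒮.isStrongSep hS) (h𝒮.fcl_ne_univ hS) Set.subset_union_left
      (Set.union_subset (subset_fcl _) (hsub.trans (fcl_mono hj))) hk) ?_
  exact ⟨fun _ => Set.subset_union_right, fun _ => hj.trans Set.subset_union_left⟩

/-- Take the separation lost by merging. Tameness leaves two options for `Y \ P i`. If it is cut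
into strong pieces, its full closure contains `P i`, so it is equivalent to `Y` while avoiding both
petals, which a lost separation does not permit. -/
theorem exists_lost_of_weak_parts [Finite E] (h : C.IsOptimal k 𝒯 𝒮 Z P)
    (hR : C.IsRobustTangle k 𝒯) (h𝒮 : C.IsTreeCompatible k 𝒯 𝒮) {U : Set E}
    (hU : C.IsKSeparating k U) (hUt : C.Tame k 𝒯 P U) {i j : Fin n}
    (h1 : IsWeak 𝒯 (P i ∩ U)) (h2 : IsWeak 𝒯 (P i \ U))
    (hij : IsProperFlower.Mergeable C k 𝒯 P i j) :
    ∃ Y, Saturated P Y ∧ C.IsSSep k 𝒮 Y ∧ P i ⊆ Y ∧ Disjoint (P j) Y ∧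
      IsWeak 𝒯 ((Y \ P i) ∩ U) ∧ IsWeak 𝒯 ((Y \ P i) \ U) := by
  have hT := hR.toIsTangle
  have hP := h.flower.toIsFlower
  obtain ⟨Y, hY, hS, hi, hj, hlost⟩ := h.exists_lost hT h𝒮 hij
  refine ⟨Y, hY, hS, hi, hj, ?_⟩
  have hu : P i ∪ Y \ P i = Y := Set.union_sdiff_cancel hi
  have hsat : Saturated P (Y \ P i) := hY.diff (saturated_part hP.disjoint i)
  have hne : (Y \ P i).Nonempty := by
    rw [Set.sdiff_nonempty]
    intro hsub
    rw [hsub.antisymm hi] at hS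
    rcases hS.strong_inter_or_diff hR h𝒮 hU with h | h
    · exact h h1
    · exact h h2
  have hst := hP.isStrong_of_saturated hsat hne
  have hk : C.IsKSeparating k (Y \ P i) := by
    have := hT.ksep_inter hS.ksep (hij.ksep hP).compl
      ((hP.strong i).mono fun x hx => Or.inl (hi hx))
      ((hP.strong j).mono fun x hx hx' => by
        rcases hx' with hx' | hx'
        · exact Set.disjoint_left.1 hj hx hx'
        · exact hx' (Or.inr hx))
    convert this using 1
    ext x
    have : x ∈ P j → x ∉ Y := fun h => Set.disjoint_left.1 hj h
    simp only [Set.mem_sdiff, Set.mem_inter_iff, Set.mem_compl_iff, Set.mem_union]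
    tauto
  rcases hUt.weak_or_strong (hP.strong i) hsat hk (hu.symm ▸ hY) (hu.symm ▸ hS.ksep) h1 h2 with
    hw | ⟨hs1, hs2⟩
  · exact hw
  · exfalso
    have hsub : P i ⊆ C.fcl k 𝒯 (Y \ P i) := by
      refine subset_fcl_of_weak_parts hT hU (hu.symm ▸ hS.ksep) hk h1 h2 hs1 hs2 ?_
      rw [hu]
      exact hS.compl.strong_inter_or_diff hR h𝒮 hU
    have hYs := h𝒮.isStrongSep hS
    have heq := sepEquiv_of_subset_fcl (X := Y \ P i) (X' := Y) hT
      ⟨hk, hst, hYs.strong_compl.mono (Set.compl_subset_compl.2 Set.sdiff_subset)⟩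
      (fun hu => h𝒮.fcl_ne_univ hS (Set.eq_univ_of_univ_subset
        (hu ▸ fcl_mono Set.sdiff_subset))) Set.sdiff_subset
      (hu.symm.subset.trans (Set.union_subset hsub (subset_fcl _))) hS.ksep
    refine hlost _ hsat heq.symm ⟨fun hc => ?_, fun hc => ?_⟩
    · obtain ⟨e, he⟩ := h.flower.nonempty i
      exact absurd he (hc he).2
    · obtain ⟨e, he⟩ := h.flower.nonempty j
      exact absurd (hc he).1 (Set.disjoint_left.1 hj he)

/-- No petal of an optimal flower is cut into two weak sets. -/
theorem not_weak_parts [Finite E] (h : C.IsOptimal k 𝒯 𝒮 Z P) (hn : 2 ≤ n)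
    (hR : C.IsRobustTangle k 𝒯) (h𝒮 : C.IsTreeCompatible k 𝒯 𝒮) {U : Set E}
    (hU : C.IsKSeparating k U) (hUt : C.Tame k 𝒯 P U) (i : Fin n)
    (h1 : IsWeak 𝒯 (P i ∩ U)) (h2 : IsWeak 𝒯 (P i \ U)) : False := by
  have hT := hR.toIsTangle
  have hP := h.flower.toIsFlower
  set 𝒳 : Set (Set E) := {Y | Saturated P Y ∧ C.IsSSep k 𝒮 Y ∧ P i ⊆ Y ∧
    IsWeak 𝒯 ((Y \ P i) ∩ U) ∧ IsWeak 𝒯 ((Y \ P i) \ U)} with h𝒳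
  have hbad : ∀ j, IsProperFlower.Mergeable C k 𝒯 P i j → ∃ Y ∈ 𝒳, Disjoint (P j) Y := by
    intro j hij
    obtain ⟨Y, a, b, c, d, e, f⟩ := h.exists_lost_of_weak_parts hR h𝒮 hU hUt h1 h2 hij
    exact ⟨Y, ⟨a, b, c, e, f⟩, d⟩
  obtain ⟨j₀, hj₀⟩ : ∃ j, IsProperFlower.Mergeable C k 𝒯 P i j := by
    obtain ⟨m, rfl⟩ := Nat.exists_eq_add_of_le' hn
    exact ⟨i + 1, by simp, Or.inl (cyclicNext_iff_eq_add_one.2 rfl)⟩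
  -- Take `X` smallest among the displayed `(k, 𝒮)`-separations around `P i` whose remainder is also
  -- cut into weak pieces. It contains a neighbour `P j`, while another member `Y` of the family
  -- avoids `P j`; the aim is to put `X ∩ Y` in the family.
  obtain ⟨X, hX, hmin⟩ := Set.exists_min_image 𝒳 Set.ncard (Set.toFinite _)
    (let ⟨Y, hY, _⟩ := hbad j₀ hj₀; ⟨Y, hY⟩)
  obtain ⟨hXs, hXS, hiX, hX1, hX2⟩ := id hX
  have hXne : ¬ X ⊆ P i := by
    intro hsub
    rw [hsub.antisymm hiX] at hXS
    rcases hXS.strong_inter_or_diff hR h𝒮 hU with h | h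
    · exact h h1
    · exact h h2
  obtain ⟨j, hij, hjX⟩ := exists_mergeable hT hP hXs hXS.ksep hiX hXne
  obtain ⟨Y, hY, hjY⟩ := hbad j hij
  obtain ⟨hYs, hYS, hiY, hY1, hY2⟩ := id hY
  obtain ⟨ej, hej⟩ := h.flower.nonempty j
  have hejY : ej ∉ Y := Set.disjoint_left.1 hjY hej
  have hXYne : (X \ Y).Nonempty := ⟨ej, hjX hej, hejY⟩
  have hYXne : (Y \ X).Nonempty := by
    rw [Set.sdiff_nonempty]
    intro hYX
    exact absurd (hmin Y hY) (not_le.2 (Set.ncard_lt_ncard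
      ⟨hYX, fun hXY => hejY (hXY (hjX hej))⟩))
  have hMs : Saturated P (X ∪ Y)ᶜ := (hXs.union hYs).compl
  have hcover : ∀ x, x ∈ P i ∨ x ∈ X \ P i ∨ x ∈ Y \ P i ∨ x ∈ (X ∪ Y)ᶜ := fun x => by
    simp only [Set.mem_sdiff, Set.mem_compl_iff, Set.mem_union]
    tauto
  -- This is where eight sets are needed: the four sets `P i`, `X \ P i`, `Y \ P i` and `(X ∪ Y)ᶜ`
  -- cover `E`, and each is halved by `U`.
  have hMw : ¬ (IsWeak 𝒯 ((X ∪ Y)ᶜ ∩ U) ∧ IsWeak 𝒯 ((X ∪ Y)ᶜ \ U)) := by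
    rintro ⟨h3, h4⟩
    refine hR.not_eight (A := ![P i ∩ U, P i \ U, (X \ P i) ∩ U, (X \ P i) \ U, (Y \ P i) ∩ U,
      (Y \ P i) \ U, (X ∪ Y)ᶜ ∩ U, (X ∪ Y)ᶜ \ U]) (fun a => ?_) fun e => ?_
    · fin_cases a <;> assumption
    · by_cases heU : e ∈ U <;> rcases hcover e with he | he | he | he
      · exact ⟨0, he, heU⟩
      · exact ⟨2, he, heU⟩
      · exact ⟨4, he, heU⟩
      · exact ⟨6, he, heU⟩
      · exact ⟨1, he, heU⟩
      · exact ⟨3, he, heU⟩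
      · exact ⟨5, he, heU⟩
      · exact ⟨7, he, heU⟩
  have hwempty : IsWeak 𝒯 ∅ := h1.mono (Set.empty_subset _)
  have hMne : (X ∪ Y)ᶜ.Nonempty := by
    rw [Set.nonempty_iff_ne_empty]
    intro hM
    rw [hM] at hMw
    exact hMw ⟨by simpa using hwempty, by simpa using hwempty⟩
  have hMst := hP.isStrong_of_saturated hMs hMne
  have hist := hP.strong i
  have hkI : C.IsKSeparating k (X ∩ Y) :=
    hT.ksep_inter hXS.ksep hYS.ksep (hist.mono fun x hx => Or.inl (hiX hx)) hMst
  have hkM : C.IsKSeparating k (X ∪ Y)ᶜ :=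
    (hT.ksep_union hXS.ksep hYS.ksep (hist.mono fun x hx => ⟨hiX hx, hiY hx⟩)
      (hMst.mono fun x hx hx' => hx (Or.inl hx'.1))).compl
  have hJs : Saturated P (X \ Y) := hXs.diff hYs
  have hJst := hP.isStrong_of_saturated hJs hXYne
  have hJ1 : IsWeak 𝒯 ((X \ Y) ∩ U) :=
    hX1.mono fun x hx => ⟨⟨hx.1.1, fun h => hx.1.2 (hiY h)⟩, hx.2⟩
  have hJ2 : IsWeak 𝒯 ((X \ Y) \ U) :=
    hX2.mono fun x hx => ⟨⟨hx.1.1, fun h => hx.1.2 (hiY h)⟩, hx.2⟩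
  have hJM : X \ Y ∪ (X ∪ Y)ᶜ = Yᶜ := by
    ext x
    simp only [Set.mem_sdiff, Set.mem_compl_iff, Set.mem_union]
    tauto
  have hkJM : C.IsKSeparating k (X \ Y ∪ (X ∪ Y)ᶜ) := hJM ▸ hYS.ksep.compl
  obtain ⟨hM1, hM2⟩ := (hUt.weak_or_strong hJst hMs hkM (hJs.union hMs) hkJM hJ1 hJ2).resolve_left
    hMw
  -- `(X ∪ Y)ᶜ` is cut into strong pieces, so its full closure contains its weakly cut neighbour `X
  -- \ Y`. Hence removing `X \ Y` from `X` stays within the equivalence class.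
  have hsub : X \ Y ⊆ C.fcl k 𝒯 (X ∪ Y)ᶜ := by
    refine subset_fcl_of_weak_parts hT hU hkJM hkM hJ1 hJ2 hM1 hM2 ?_
    rw [hJM, compl_compl]
    exact hYS.strong_inter_or_diff hR h𝒮 hU
  have hXYS : C.IsSSep k 𝒮 (X ∩ Y) := by
    have he : (X ∩ Y)ᶜ = Xᶜ ∪ (X \ Y) := by
      ext x
      simp only [Set.mem_sdiff, Set.mem_compl_iff, Set.mem_union, Set.mem_inter_iff]
      tauto
    have hequiv : C.SepEquiv k 𝒯 Xᶜ (X ∩ Y)ᶜ := by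
      refine sepEquiv_of_subset_fcl hT (h𝒮.isStrongSep hXS.compl) (h𝒮.fcl_compl_ne_univ hXS)
        (Set.compl_subset_compl.2 Set.inter_subset_left) ?_ hkI.compl
      rw [he]
      exact Set.union_subset (subset_fcl _)
        (hsub.trans (fcl_mono (Set.compl_subset_compl.2 Set.subset_union_left)))
    have := (h𝒮.isSSep_of_sepEquiv hXS.compl hequiv).compl
    rwa [compl_compl] at this
  refine absurd (hmin (X ∩ Y) ⟨hXs.inter hYs, hXYS, Set.subset_inter hiX hiY,
    hX1.mono fun x hx => ⟨⟨hx.1.1.1, hx.1.2⟩, hx.2⟩,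
    hX2.mono fun x hx => ⟨⟨hx.1.1.1, hx.1.2⟩, hx.2⟩⟩) (not_le.2 (Set.ncard_lt_ncard
      ⟨Set.inter_subset_left, fun hsub => hejY (hsub (hjX hej)).2⟩))

/-- Every `(k, 𝒮)`-separation with a side avoiding `Z` conforms with an optimal flower. -/
theorem conforms [Finite E] (h : C.IsOptimal k 𝒯 𝒮 Z P) (hn : 2 ≤ n)
    (hR : C.IsRobustTangle k 𝒯) (h𝒮 : C.IsTreeCompatible k 𝒯 𝒮) (hZ : Z = ∅ ∨ IsStrong 𝒯 Z)
    {U : Set E} (hU : C.IsSSep k 𝒮 U) (hZU : Disjoint Z U) :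
    U ∈ C.displayedUpTo k 𝒯 𝒮 P ∨
      ∃ U', C.SepEquiv k 𝒯 U U' ∧ Disjoint Z U' ∧ ∃ i, U' ⊆ P i ∨ U'ᶜ ⊆ P i := by
  have hT := hR.toIsTangle
  have hP := h.flower.toIsFlower
  obtain ⟨V, hUV, hZV, hVt⟩ := exists_tame hT h𝒮 hP hZ h.exists_subset hU hZU
  by_cases hin : ∃ i, V ⊆ P i ∨ Vᶜ ⊆ P i
  · exact Or.inr ⟨V, hUV, hZV, hin⟩
  push Not at hin
  have hV := h𝒮.isSSep_of_sepEquiv hU hUV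
  obtain ⟨m, rfl⟩ := Nat.exists_eq_add_of_le' hn
  obtain ⟨m', P', hP', hmono, hVs, hZ'⟩ := h.flower.exists_refinement hT hV.ksep
    (fun A hA => by
      obtain ⟨⟨i, rfl⟩, hA1, hA2⟩ := hA
      obtain ⟨ht1, ht2⟩ := hVt _ (saturated_part hP.disjoint i) (hP.ksep i)
      rcases isWeak_or_isStrong (𝒯 := 𝒯) (P i ∩ V) with h1 | h1 <;>
        rcases isWeak_or_isStrong (𝒯 := 𝒯) (P i \ V) with h2 | h2
      · exact (h.not_weak_parts hn hR h𝒮 hV.ksep hVt i h1 h2).elim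
      · exact absurd (ht2 h2 h1) hA2
      · exact absurd (ht1 h1 h2) hA1
      · exact ⟨h1, h2⟩) hin
  -- The refinement displays everything that `P` displays and also `V`; by maximality `P` displays
  -- `V` up to equivalence.
  refine Or.inl ((h.optimal m' P' hP' (hZ' Z hZV h.exists_subset) ?_).1 ⟨hU, V, hVs, hUV⟩)
  rintro Y ⟨hY, Y', hY', hYY'⟩
  exact ⟨hY, Y', hmono Y' hY', hYY'⟩

end IsOptimal

theorem mem_flowerDisplayed_iff {n : ℕ} {P : Fin n → Set E} (hP : C.IsFlower k 𝒯 P) {X : Set E} :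
    X ∈ C.flowerDisplayed k P ↔ C.IsKSeparating k X ∧ Saturated P X := by
  refine and_congr_right fun _ => ⟨?_, fun h => ⟨_, h.eq_biUnion hP.cover⟩⟩
  rintro ⟨I, rfl⟩
  exact saturated_biUnion hP.disjoint I

theorem isProperFlower_pair (h𝒮 : C.IsTreeCompatible k 𝒯 𝒮) {Y : Set E} (hY : C.IsSSep k 𝒮 Y) :
    C.IsProperFlower k 𝒯 ![Y, Yᶜ] := by
  have hs := h𝒮.isStrongSep hY
  refine ⟨⟨by omega, ?_, ?_, ?_, ?_, ?_⟩, ?_⟩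
  · intro i j hij
    fin_cases i <;> fin_cases j <;> simp_all [disjoint_compl_left, disjoint_compl_right]
  · ext x
    simp [Fin.exists_fin_two, em]
  · rw [Fin.forall_fin_two]
    exact ⟨hs.strong, hs.strong_compl⟩
  · rw [Fin.forall_fin_two]
    exact ⟨hY.ksep, hY.ksep.compl⟩
  · intro i j _
    fin_cases i <;> fin_cases j <;>
      simp [hY.ksep, hY.ksep.compl, hY.ksep.univ]
  · rw [Fin.forall_fin_two]
    exact ⟨hY.nonempty h𝒮, hY.compl.nonempty h𝒮⟩

theorem Saturated.eq_or_eq_compl {m : ℕ} (hm : m ≤ 2) {Q : Fin m → Set E}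
    (hc : (⋃ i, Q i) = Set.univ) {V W : Set E} (hV : Saturated Q V) (hW : Saturated Q W)
    (hV0 : V.Nonempty) (hV1 : Vᶜ.Nonempty) (hW0 : W.Nonempty) (hW1 : Wᶜ.Nonempty) :
    V = W ∨ V = Wᶜ := by
  obtain ⟨v, hv⟩ := hV0
  obtain ⟨v', hv'⟩ := hV1
  obtain ⟨w, hw⟩ := hW0
  obtain ⟨w', hw'⟩ := hW1
  obtain ⟨a, -, ha⟩ := hV.exists_subset hc hv
  obtain ⟨a', hva', ha'⟩ := hV.compl.exists_subset hc hv'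
  obtain ⟨b, hwb, hb⟩ := hW.exists_subset hc hw
  obtain ⟨b', hwb', hb'⟩ := hW.compl.exists_subset hc hw'
  have hbb : b ≠ b' := by
    rintro rfl
    exact hb' hwb (hb hwb)
  by_cases haa : a = a'
  · subst haa
    exact absurd (ha hva') (ha' hva')
  have hall : ∀ x : Fin m, x = b ∨ x = b' := by
    intro x
    have := x.isLt
    have := b.isLt
    have := b'.isLt
    simp only [Fin.ext_iff, ne_eq] at hbb ⊢
    omega
  have hcov : ∀ x, x ∈ Q b ∨ x ∈ Q b' := by
    intro x
    obtain ⟨i, hi⟩ := Set.mem_iUnion.1 (hc.symm ▸ Set.mem_univ x : x ∈ ⋃ i, Q i)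
    rcases hall i with rfl | rfl
    · exact Or.inl hi
    · exact Or.inr hi
  have hWb : ∀ x, x ∈ W ↔ x ∈ Q b := fun x =>
    ⟨fun h => (hcov x).resolve_right fun h' => hb' h' h, fun h => hb h⟩
  have hWb' : ∀ x, x ∉ W ↔ x ∈ Q b' := fun x =>
    ⟨fun h => (hcov x).resolve_left fun h' => h (hb h'), fun h => hb' h⟩
  rcases hall a with rfl | rfl <;> rcases hall a' with rfl | rfl
  · exact absurd rfl haa
  · left
    ext x
    rw [hWb]
    exact ⟨fun h => (hcov x).resolve_right fun h' => ha' h' h, fun h => ha h⟩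
  · right
    ext x
    rw [Set.mem_compl_iff, hWb']
    exact ⟨fun h => (hcov x).resolve_left fun h' => ha' h' h, fun h => ha h⟩
  · exact absurd rfl haa

/-- An equivalent flower with at most two petals displays at most one `(k, 𝒮)`-separation, up to
complement. Then the two-petal flower `(Y, Yᶜ)` would display as much as `P`, with fewer petals and
still with one containing `Z`. -/
theorem IsOptimal.three_le_sOrder {Z : Set E} {n : ℕ} {P : Fin n → Set E}
    (h : C.IsOptimal k 𝒯 𝒮 Z P) (h𝒮 : C.IsTreeCompatible k 𝒯 𝒮) (hn : 3 ≤ n)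
    (hne : (C.displayedUpTo k 𝒯 𝒮 P).Nonempty) : 3 ≤ C.sOrder k 𝒯 𝒮 P := by
  have hP := h.flower.toIsFlower
  by_contra hlt
  have hself : C.DisplayLE k 𝒯 𝒮 (C.flowerDisplayed k P) (C.flowerDisplayed k P) :=
    fun X hX hS => ⟨X, hX, hS, h𝒮.sepEquiv_refl hS⟩
  obtain ⟨Q, hQ, hPQ, -⟩ := Nat.sInf_mem
    (⟨n, P, hP, hself, hself⟩ : {m : ℕ | ∃ Q : Fin m → Set E, C.IsFlower k 𝒯 Q ∧
      C.FlowerEquiv k 𝒯 𝒮 P Q}.Nonempty)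
  change ¬ 3 ≤ sInf _ at hlt
  have hm := Nat.lt_succ_iff.1 (not_le.1 hlt)
  obtain ⟨X, hX, Y, hY, hXY⟩ := hne
  have hYS := h𝒮.isSSep_of_sepEquiv hX hXY
  have hmem : ∀ {Y}, Saturated P Y → C.IsSSep k 𝒮 Y → Y ∈ C.flowerDisplayed k P :=
    fun h1 h2 => (mem_flowerDisplayed_iff hP).2 ⟨h2.ksep, h1⟩
  obtain ⟨V, hV, hVS, hYV⟩ := hPQ Y (hmem hY hYS) hYS
  have hle : C.displayedUpTo k 𝒯 𝒮 P ⊆ C.displayedUpTo k 𝒯 𝒮 ![Y, Yᶜ] := by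
    rintro A ⟨hA, B, hB, hAB⟩
    have hBS := h𝒮.isSSep_of_sepEquiv hA hAB
    obtain ⟨W, hW, hWS, hBW⟩ := hPQ B (hmem hB hBS) hBS
    refine ⟨hA, Y, (saturated_part (isProperFlower_pair h𝒮 hYS).disjoint 0), ?_⟩
    refine (hAB.trans hBW).trans (SepEquiv.trans ?_ hYV.symm)
    rcases Saturated.eq_or_eq_compl hm hQ.cover ((mem_flowerDisplayed_iff hQ).1 hW).2
      ((mem_flowerDisplayed_iff hQ).1 hV).2 (hWS.nonempty h𝒮) (hWS.compl.nonempty h𝒮)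
      (hVS.nonempty h𝒮) (hVS.compl.nonempty h𝒮) with rfl | rfl
    · exact h𝒮.sepEquiv_refl hWS
    · exact (h𝒮.sepEquiv_refl hVS).compl_left
  have := (h.optimal 2 _ (isProperFlower_pair h𝒮 hYS) ?_ hle).2
  · omega
  · obtain ⟨i, hi⟩ := h.exists_subset
    rcases hY i with h' | h'
    · exact ⟨0, hi.trans h'⟩
    · exact ⟨1, hi.trans (Set.subset_compl_iff_disjoint_right.2 h')⟩

theorem IsOptimal.two_le {Z : Set E} {n : ℕ} {P : Fin n → Set E}
    (h : C.IsOptimal k 𝒯 𝒮 Z P) (h𝒮 : C.IsTreeCompatible k 𝒯 𝒮)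
    (hne : (C.displayedUpTo k 𝒯 𝒮 P).Nonempty) : 2 ≤ n := by
  obtain ⟨X, hX, Y, hY, hXY⟩ := hne
  have hYS := h𝒮.isSSep_of_sepEquiv hX hXY
  obtain ⟨e, he⟩ := hYS.nonempty h𝒮
  obtain ⟨f, hf⟩ := hYS.compl.nonempty h𝒮
  obtain ⟨i, hi, hi'⟩ := hY.exists_subset h.flower.cover he
  obtain ⟨j, hj, hj'⟩ := hY.compl.exists_subset h.flower.cover hf
  have hij : i ≠ j := by
    rintro rfl
    exact hf (hi' hj)
  have := i.isLt
  have := j.isLt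
  have : (i : ℕ) ≠ j := fun h => hij (Fin.ext h)
  omega

end Optimal

end ConnectivitySystem

namespace SimpleGraph

/-! ### Attaching a star to a tree -/

section Reachability

variable {V W : Type*}

theorem Reachable.mem_of_closed {G : SimpleGraph V} {S : Set V}
    (hS : ∀ x y, G.Adj x y → x ∈ S → y ∈ S) {x y : V} (h : G.Reachable x y) (hx : x ∈ S) :
    y ∈ S := by
  rw [reachable_iff_reflTransGen] at h
  induction h with
  | refl => exact hx
  | tail _ hab ih => exact hS _ _ hab ih

theorem Reachable.map_of_adj {G : SimpleGraph V} {H : SimpleGraph W} (f : V → W)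
    (hf : ∀ x y, G.Adj x y → f x = f y ∨ H.Adj (f x) (f y)) {x y : V} (h : G.Reachable x y) :
    H.Reachable (f x) (f y) := by
  refine h.mem_of_closed (S := {y | H.Reachable (f x) (f y)}) (fun a b hab ha => ?_) .rfl
  rcases hf a b hab with hf | hf
  · change H.Reachable (f x) (f b)
    rw [← hf]
    exact ha
  · exact Reachable.trans ha hf.reachable

/-- The graph `G` together with a star with centre `0` and `N` leaves, whose centre is joined to the
vertex `v` of `G`. -/
def attachStar (G : SimpleGraph V) (v : V) (N : ℕ) : SimpleGraph (V ⊕ Fin (N + 1)) where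
  Adj
    | .inl a, .inl b => G.Adj a b
    | .inl a, .inr i => a = v ∧ i = 0
    | .inr i, .inl a => a = v ∧ i = 0
    | .inr i, .inr j => (i = 0 ∧ j ≠ 0) ∨ (j = 0 ∧ i ≠ 0)
  symm := ⟨by
    rintro (a | i) (b | j) h
    · exact G.adj_symm h
    · exact h
    · exact h
    · exact h.symm⟩
  loopless := ⟨by
    rintro (a | i) h
    · exact G.irrefl h
    · rcases h with ⟨h, h'⟩ | ⟨h, h'⟩ <;> exact h' h⟩

variable {G : SimpleGraph V} {v : V} {N : ℕ}

@[simp] theorem attachStar_inl_inl {a b : V} :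
    (G.attachStar v N).Adj (.inl a) (.inl b) ↔ G.Adj a b := Iff.rfl

@[simp] theorem attachStar_inl_inr {a : V} {i : Fin (N + 1)} :
    (G.attachStar v N).Adj (.inl a) (.inr i) ↔ a = v ∧ i = 0 := Iff.rfl

@[simp] theorem attachStar_inr_inl {a : V} {i : Fin (N + 1)} :
    (G.attachStar v N).Adj (.inr i) (.inl a) ↔ a = v ∧ i = 0 := Iff.rfl

@[simp] theorem attachStar_inr_inr {i j : Fin (N + 1)} :
    (G.attachStar v N).Adj (.inr i) (.inr j) ↔ (i = 0 ∧ j ≠ 0) ∨ (j = 0 ∧ i ≠ 0) := Iff.rfl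

/-- Contract the attached star into `v`. -/
def contractStar (v : V) (N : ℕ) : V ⊕ Fin (N + 1) → V := Sum.elim id fun _ => v

@[simp] theorem contractStar_inl (a : V) : contractStar v N (.inl a) = a := rfl

@[simp] theorem contractStar_inr (i : Fin (N + 1)) : contractStar v N (.inr i) = v := rfl

/-- `D` is a subgraph of `G.attachStar v N` that contains the star and induces `H` on `V`. -/
structure ExtendsByStar (H : SimpleGraph V) (v : V) (D : SimpleGraph (V ⊕ Fin (N + 1))) : Prop where
  project : ∀ x y, D.Adj x y →
    contractStar v N x = contractStar v N y ∨ H.Adj (contractStar v N x) (contractStar v N y)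
  embed : ∀ a b, H.Adj a b → D.Adj (.inl a) (.inl b)
  link : D.Adj (.inl v) (.inr 0)
  star : ∀ i, i ≠ 0 → D.Adj (.inr 0) (.inr i)

/-- The star is connected to `v` inside `D`, so contracting it changes no connectivity. Applied
after deleting an old edge or vertex, this shows that old edges and vertices display the same sets
as before. -/
theorem ExtendsByStar.reachable_iff {H : SimpleGraph V} {D : SimpleGraph (V ⊕ Fin (N + 1))}
    (h : ExtendsByStar H v D) {x y : V ⊕ Fin (N + 1)} :
    D.Reachable x y ↔ H.Reachable (contractStar v N x) (contractStar v N y) := by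
  refine ⟨fun hxy => hxy.map_of_adj _ h.project, fun hxy => ?_⟩
  have hx : ∀ x, D.Reachable (.inl (contractStar v N x)) x := by
    rintro (a | i)
    · exact .rfl
    · by_cases hi : i = 0
      · rw [hi]
        exact h.link.reachable
      · exact h.link.reachable.trans (h.star i hi).reachable
  exact ((hx x).symm.trans (hxy.map_of_adj Sum.inl fun a b hab => Or.inr (h.embed a b hab))).trans
    (hx y)

theorem extendsByStar_self : ExtendsByStar G v (G.attachStar v N) where
  project := by
    rintro (a | i) (b | j) h
    · exact Or.inr h
    · exact Or.inl h.1
    · exact Or.inl h.1.symm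
    · exact Or.inl rfl
  embed _ _ h := h
  link := by simp
  star i hi := by simp [hi]

theorem extendsByStar_deleteEdges (u w : V) :
    ExtendsByStar (G.deleteEdges {s(u, w)}) v
      ((G.attachStar v N).deleteEdges {s(.inl u, .inl w)}) where
  project := by
    rintro (a | i) (b | j) h
    · right
      simpa [deleteEdges_adj] using h
    · exact Or.inl h.1.1
    · exact Or.inl h.1.1.symm
    · exact Or.inl rfl
  embed a b h := by simpa [deleteEdges_adj] using h
  link := by simp [deleteEdges_adj]
  star i hi := by simp [deleteEdges_adj, hi]

theorem extendsByStar_deleteIncidenceSet {w : V} (hw : w ≠ v) :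
    ExtendsByStar (G.deleteIncidenceSet w) v
      ((G.attachStar v N).deleteIncidenceSet (.inl w)) where
  project := by
    rintro (a | i) (b | j) h
    · right
      simpa [deleteIncidenceSet_adj] using h
    · exact Or.inl (deleteIncidenceSet_adj.1 h).1.1
    · exact Or.inl (deleteIncidenceSet_adj.1 h).1.1.symm
    · exact Or.inl rfl
  embed a b h := by simpa [deleteIncidenceSet_adj] using h
  link := by simp [deleteIncidenceSet_adj, hw.symm]
  star i hi := by simp [deleteIncidenceSet_adj, hi]

theorem reachable_attachStar_deleteEdges_link (hG : G.Connected) {x : V ⊕ Fin (N + 1)} :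
    ((G.attachStar v N).deleteEdges {s(.inl v, .inr 0)}).Reachable (.inl v) x ↔
      x ∈ Set.range Sum.inl := by
  refine ⟨fun h => h.mem_of_closed ?_ ⟨v, rfl⟩, ?_⟩
  · rintro _ (b | j) h ⟨a, rfl⟩
    · exact ⟨b, rfl⟩
    · simp [deleteEdges_adj] at h
      exact absurd h.2 (h.1.1 ▸ h.1.2 ▸ by simp)
  · rintro ⟨a, rfl⟩
    exact (hG v a).map_of_adj Sum.inl fun a b hab => Or.inr (by simpa [deleteEdges_adj] using hab)

theorem reachable_attachStar_deleteEdges_leaf {i : Fin (N + 1)} (hi : i ≠ 0)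
    {x : V ⊕ Fin (N + 1)} :
    ((G.attachStar v N).deleteEdges {s(.inr i, .inr 0)}).Reachable (.inr i) x ↔ x = .inr i := by
  refine ⟨fun h => h.mem_of_closed (S := {.inr i}) ?_ rfl, ?_⟩
  · rintro _ (b | j) h rfl
    · simp [deleteEdges_adj, hi] at h
    · simp only [deleteEdges_adj, attachStar_inr_inr, hi, false_and, false_or] at h
      exact absurd h.2 (by simp [h.1.1])
  · rintro rfl
    exact .rfl

theorem IsTree.attachStar (hG : G.IsTree) (v : V) (N : ℕ) : (G.attachStar v N).IsTree := by
  have hc := hG.connected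
  have hb := isAcyclic_iff_forall_adj_isBridge.1 hG.isAcyclic
  refine { connected := { preconnected := fun x y => extendsByStar_self.reachable_iff.2 (hc _ _)
                          nonempty := ⟨.inl v⟩ }
           isAcyclic := ?_ }
  rw [isAcyclic_iff_forall_adj_isBridge]
  have hlink : (G.attachStar v N).IsBridge s(.inl v, .inr 0) := by
    rw [isBridge_iff, reachable_attachStar_deleteEdges_link hc]
    rintro ⟨a, ha⟩
    simp at ha
  have hleaf : ∀ i : Fin (N + 1), i ≠ 0 → (G.attachStar v N).IsBridge s(.inr i, .inr 0) := by
    intro i hi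
    rw [isBridge_iff, reachable_attachStar_deleteEdges_leaf hi]
    simpa using hi.symm
  rintro (a | i) (b | j) h
  · rw [isBridge_iff, (extendsByStar_deleteEdges a b).reachable_iff]
    exact hb h
  · obtain ⟨rfl, rfl⟩ := h
    exact hlink
  · obtain ⟨rfl, rfl⟩ := h
    rw [Sym2.eq_swap]
    exact hlink
  · rcases h with ⟨rfl, h⟩ | ⟨rfl, h⟩
    · rw [Sym2.eq_swap]
      exact hleaf j h
    · exact hleaf i h

/-- The neighbours of an old vertex other than the attachment vertex. -/
def attachStarNeighborEquiv (G : SimpleGraph V) {v w : V} (N : ℕ) (hw : w ≠ v) :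
    G.neighborSet w ≃ (G.attachStar v N).neighborSet (.inl w) where
  toFun x := ⟨.inl x, x.2⟩
  invFun
    | ⟨.inl x, hx⟩ => ⟨x, hx⟩
    | ⟨.inr _, hx⟩ => absurd hx.1 hw
  left_inv _ := rfl
  right_inv
    | ⟨.inl _, _⟩ => rfl
    | ⟨.inr _, hx⟩ => absurd hx.1 hw

/-- The neighbours of the centre of the attached star. -/
def attachStarCentreEquiv (G : SimpleGraph V) (v : V) (N : ℕ) :
    Fin (N + 1) ≃ (G.attachStar v N).neighborSet (.inr 0) where
  toFun := Fin.cases ⟨.inl v, rfl, rfl⟩ fun i => ⟨.inr i.succ, Or.inl ⟨rfl, i.succ_ne_zero⟩⟩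
  invFun
    | ⟨.inl _, _⟩ => 0
    | ⟨.inr i, _⟩ => i
  left_inv i := by
    induction i using Fin.cases with
    | zero => rfl
    | succ i => rfl
  right_inv := by
    rintro ⟨a | i, hx⟩
    · obtain ⟨rfl, -⟩ := hx
      rfl
    · induction i using Fin.cases with
      | zero => exact absurd hx (by simp)
      | succ i => rfl

end Reachability

end SimpleGraph

namespace LabelledTree

/-! ### Sets displayed by edges and vertices -/

section Sides

variable {E V : Type*} (T : LabelledTree E V)

theorem exists_mem_content (e : E) : ∃ x, e ∈ (T.label x).content :=
  Set.mem_iUnion.1 (T.cover.symm ▸ Set.mem_univ e)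

theorem mem_biUnion_content_iff {S : Set V} {e : E} {x : V} (he : e ∈ (T.label x).content) :
    e ∈ (⋃ y ∈ S, (T.label y).content) ↔ x ∈ S := by
  refine ⟨fun h => ?_, fun h => Set.mem_biUnion h he⟩
  obtain ⟨y, hy, hey⟩ := Set.mem_iUnion₂.1 h
  by_contra hx
  have hne : x ≠ y := by
    rintro rfl
    exact hx hy
  exact Set.disjoint_left.1 (T.disjoint hne) he hey

variable {T}

theorem not_reachable_of_adj {u v : V} (h : T.graph.Adj u v) :
    ¬ (T.graph.deleteEdges {s(u, v)}).Reachable u v :=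
  SimpleGraph.isAcyclic_iff_forall_adj_isBridge.1 T.isTree.isAcyclic h

theorem edgeSide_swap {u v : V} (h : T.graph.Adj u v) : T.edgeSide v u = (T.edgeSide u v)ᶜ := by
  ext e
  obtain ⟨x, hx⟩ := T.exists_mem_content e
  rw [Set.mem_compl_iff, edgeSide, edgeSide, T.mem_biUnion_content_iff hx,
    T.mem_biUnion_content_iff hx, Sym2.eq_swap]
  have hor : x ∈ {x | (T.graph.deleteEdges {s(u, v)}).Reachable u x ∨
      (T.graph.deleteEdges {s(u, v)}).Reachable v x} := by
    refine (T.isTree.connected u x).mem_of_closed (fun a b hab ha => ?_) (Or.inl .rfl)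
    by_cases hs : s(a, b) = s(u, v)
    · rw [Sym2.eq_iff] at hs
      rcases hs with ⟨rfl, rfl⟩ | ⟨rfl, rfl⟩
      · exact Or.inr .rfl
      · exact Or.inl .rfl
    · have hab' : (T.graph.deleteEdges {s(u, v)}).Adj a b := by
        rw [SimpleGraph.deleteEdges_adj]
        exact ⟨hab, hs⟩
      exact ha.imp (·.trans hab'.reachable) (·.trans hab'.reachable)
  refine ⟨fun h1 h2 => not_reachable_of_adj h (h2.trans h1.symm), fun h1 => hor.resolve_left h1⟩

/-- Once the edge between `v` and `w` is gone, nothing reachable from `v` can be `w`, so deleting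
the other edges at `w` does not affect the component of `v`. -/
theorem petal_eq_edgeSide {v w : V} (h : T.graph.Adj w v) :
    T.petal w ⟨v, h⟩ = T.edgeSide v w := by
  have hiff : ∀ x, (T.graph.deleteIncidenceSet w).Reachable v x ↔
      (T.graph.deleteEdges {s(v, w)}).Reachable v x := by
    have hmono : ∀ x, (T.graph.deleteIncidenceSet w).Reachable v x →
        (T.graph.deleteEdges {s(v, w)}).Reachable v x := fun x hx =>
      hx.map_of_adj id fun a b hab => Or.inr (by
        rw [SimpleGraph.deleteIncidenceSet_adj] at hab
        rw [id, id, SimpleGraph.deleteEdges_adj]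
        refine ⟨hab.1, fun hs => ?_⟩
        rw [Set.mem_singleton_iff, Sym2.eq_iff] at hs
        rcases hs with ⟨_, h⟩ | ⟨h, _⟩
        · exact hab.2.2 h
        · exact hab.2.1 h)
    refine fun x => ⟨hmono x, fun hx => ?_⟩
    refine hx.mem_of_closed (S := {x | (T.graph.deleteIncidenceSet w).Reachable v x})
      (fun a b hab ha => ?_) .rfl
    have hav := hmono a ha
    refine SimpleGraph.Reachable.trans ha (SimpleGraph.Adj.reachable ?_)
    rw [SimpleGraph.deleteIncidenceSet_adj]
    refine ⟨hab.1, ?_, ?_⟩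
    · rintro rfl
      exact not_reachable_of_adj h.symm hav
    · rintro rfl
      exact not_reachable_of_adj h.symm (hav.trans hab.reachable)
  unfold petal edgeSide
  congr 1
  ext e
  simp only [Set.mem_ofPred_eq, hiff]

end Sides

end LabelledTree

/-- Transport a vertex label along a bijection between the sets of neighbours. -/
def VertexLabel.map {E N M : Type*} (f : N ≃ M) : VertexLabel E N → VertexLabel E M
  | .bag B => .bag B
  | .A => .A
  | .D n o => .D n (o.trans f)

theorem VertexLabel.content_map {E N M : Type*} (f : N ≃ M) (l : VertexLabel E N) :
    (l.map f).content = l.content := by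
  cases l <;> rfl

namespace LabelledTree

/-! ### Replacing a bag by a star -/

section Attach

variable {E V : Type*}

/-- The data needed to replace the bag at the vertex `v` by a smaller bag with a star attached. -/
structure StarData (T : LabelledTree E V) (v : V) (N : ℕ) where
  bag : Set E
  part : Fin (N + 1) → Set E
  centre : VertexLabel E ((T.graph.attachStar v N).neighborSet (.inr 0))
  content_centre : centre.content = part 0
  hasBag : T.HasBag v (bag ∪ ⋃ i, part i)
  disjoint : Pairwise fun i j => Disjoint (part i) (part j)
  disjoint_bag : ∀ i, Disjoint bag (part i)

namespace StarData

variable {T : LabelledTree E V} {v : V} {N : ℕ} (S : T.StarData v N)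

open Classical in
/-- The labels of the tree with the star attached. -/
noncomputable def label : (x : V ⊕ Fin (N + 1)) →
    VertexLabel E ((T.graph.attachStar v N).neighborSet x)
  | .inl w =>
    if h : w = v then .bag S.bag
    else (T.label w).map (SimpleGraph.attachStarNeighborEquiv T.graph N h)
  | .inr i =>
    Fin.cases (motive := fun i => VertexLabel E ((T.graph.attachStar v N).neighborSet (.inr i)))
      S.centre (fun j => .bag (S.part j.succ)) i

theorem label_inl_self : S.label (.inl v) = .bag S.bag := by
  simp [label]

theorem label_inl_of_ne {w : V} (h : w ≠ v) :
    S.label (.inl w) = (T.label w).map (SimpleGraph.attachStarNeighborEquiv T.graph N h) := by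
  simp [label, h]

theorem label_leaf {i : Fin (N + 1)} (hi : i ≠ 0) : S.label (.inr i) = .bag (S.part i) := by
  obtain ⟨j, rfl⟩ := Fin.exists_succ_eq.2 hi
  rfl

theorem content_inr (i : Fin (N + 1)) : (S.label (.inr i)).content = S.part i := by
  by_cases hi : i = 0
  · subst hi
    exact S.content_centre
  · rw [S.label_leaf hi]
    rfl

theorem content_bag : (T.label v).content = S.bag ∪ ⋃ i, S.part i := by
  rw [show T.label v = _ from S.hasBag]
  rfl

theorem content_subset (x : V ⊕ Fin (N + 1)) :
    (S.label x).content ⊆ (T.label (SimpleGraph.contractStar v N x)).content := by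
  rcases x with w | i
  · by_cases hw : w = v
    · subst hw
      rw [S.label_inl_self, SimpleGraph.contractStar_inl, S.content_bag]
      exact Set.subset_union_left
    · rw [S.label_inl_of_ne hw, VertexLabel.content_map]
      rfl
  · rw [S.content_inr, SimpleGraph.contractStar_inr, S.content_bag]
    exact (Set.subset_iUnion S.part i).trans Set.subset_union_right

theorem exists_mem_content (e : E) : ∃ x, e ∈ (S.label x).content := by
  obtain ⟨w, hw⟩ := T.exists_mem_content e
  by_cases h : w = v
  · subst h
    rw [S.content_bag] at hw
    rcases hw with hw | hw
    · exact ⟨.inl w, by rwa [S.label_inl_self]⟩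
    · obtain ⟨i, hi⟩ := Set.mem_iUnion.1 hw
      exact ⟨.inr i, by rwa [S.content_inr]⟩
  · exact ⟨.inl w, by rwa [S.label_inl_of_ne h, VertexLabel.content_map]⟩

/-- The tree with the star attached. -/
noncomputable def attach : LabelledTree E (V ⊕ Fin (N + 1)) where
  graph := T.graph.attachStar v N
  isTree := T.isTree.attachStar v N
  label := S.label
  disjoint := by
    have hd : ∀ (a : V) (i : Fin (N + 1)),
        Disjoint (S.label (.inl a)).content (S.label (.inr i)).content := by
      intro a i
      by_cases ha : a = v
      · subst ha
        rw [S.label_inl_self, S.content_inr]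
        exact S.disjoint_bag i
      · exact (T.disjoint ha).mono (S.content_subset (.inl a)) (S.content_subset (.inr i))
    rintro (a | i) (b | j) hne
    · exact (T.disjoint fun h => hne (congrArg Sum.inl h)).mono (S.content_subset (.inl a))
        (S.content_subset (.inl b))
    · exact hd a j
    · exact (hd b i).symm
    · rw [S.content_inr, S.content_inr]
      exact S.disjoint fun h => hne (congrArg Sum.inr h)
  cover := Set.eq_univ_of_forall fun e => Set.mem_iUnion.2 (S.exists_mem_content e)

theorem hasBag_attach_self : S.attach.HasBag (.inl v) S.bag := S.label_inl_self

theorem hasBag_attach_leaf {i : Fin (N + 1)} (hi : i ≠ 0) :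
    S.attach.HasBag (.inr i) (S.part i) := S.label_leaf hi

theorem hasBag_attach_iff {w : V} (hw : w ≠ v) {B : Set E} :
    S.attach.HasBag (.inl w) B ↔ T.HasBag w B := by
  unfold HasBag
  change S.label (.inl w) = _ ↔ _
  rw [S.label_inl_of_ne hw]
  generalize T.label w = l
  cases l with
  | bag A =>
    constructor <;>
    · intro h
      injection h with h
      subst h
      rfl
  | A => simp [VertexLabel.map]
  | D n o => simp [VertexLabel.map]

theorem isBagVertex_attach_iff {w : V} :
    S.attach.IsBagVertex (.inl w) ↔ T.IsBagVertex w := by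
  by_cases hw : w = v
  · subst hw
    exact ⟨fun _ => ⟨_, S.hasBag⟩, fun _ => ⟨_, S.hasBag_attach_self⟩⟩
  · exact exists_congr fun B => S.hasBag_attach_iff hw

/-- Every element sits at a new vertex that contracts to its old vertex, and contraction preserves
reachability. -/
theorem biUnion_content_eq {H : SimpleGraph V} {D : SimpleGraph (V ⊕ Fin (N + 1))}
    (h : SimpleGraph.ExtendsByStar H v D) (y : V ⊕ Fin (N + 1)) :
    (⋃ x ∈ {x | D.Reachable y x}, (S.attach.label x).content) =
      ⋃ a ∈ {a | H.Reachable (SimpleGraph.contractStar v N y) a}, (T.label a).content := by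
  ext e
  obtain ⟨x, hx⟩ := S.exists_mem_content e
  rw [S.attach.mem_biUnion_content_iff hx, T.mem_biUnion_content_iff (S.content_subset x hx)]
  exact h.reachable_iff

theorem edgeSide_attach (u w : V) :
    S.attach.edgeSide (.inl u) (.inl w) = T.edgeSide u w :=
  S.biUnion_content_eq (SimpleGraph.extendsByStar_deleteEdges u w) _

theorem petal_attach {w : V} (hw : w ≠ v) (x : T.graph.neighborSet w) :
    S.attach.petal (.inl w) (SimpleGraph.attachStarNeighborEquiv T.graph N hw x) =
      T.petal w x :=
  S.biUnion_content_eq (SimpleGraph.extendsByStar_deleteIncidenceSet hw) _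

theorem biUnion_range_inl :
    (⋃ x ∈ Set.range (Sum.inl : V → V ⊕ Fin (N + 1)), (S.attach.label x).content) =
      (⋃ i, S.part i)ᶜ := by
  ext e
  obtain ⟨x, hx⟩ := S.exists_mem_content e
  rw [S.attach.mem_biUnion_content_iff hx, Set.mem_compl_iff, Set.mem_iUnion]
  constructor
  · rintro ⟨a, rfl⟩ ⟨i, hi⟩
    rw [← S.content_inr] at hi
    exact Set.disjoint_left.1 (S.attach.disjoint Sum.inl_ne_inr) hx hi
  · intro h
    rcases x with a | i
    · exact ⟨a, rfl⟩
    · rw [S.content_inr] at hx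
      exact absurd ⟨i, hx⟩ h

theorem edgeSide_attach_link :
    S.attach.edgeSide (.inl v) (.inr 0) = (⋃ i, S.part i)ᶜ := by
  rw [← S.biUnion_range_inl, edgeSide]
  congr 1
  ext e
  simp only [attach, Set.mem_ofPred_eq,
    SimpleGraph.reachable_attachStar_deleteEdges_link T.isTree.connected]

theorem edgeSide_attach_leaf {i : Fin (N + 1)} (hi : i ≠ 0) :
    S.attach.edgeSide (.inr i) (.inr 0) = S.part i := by
  ext e
  simp only [edgeSide, attach, Set.mem_ofPred_eq,
    SimpleGraph.reachable_attachStar_deleteEdges_leaf hi, Set.iUnion_iUnion_eq_left, S.content_inr]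

theorem petal_attach_link (h : (T.graph.attachStar v N).Adj (.inr 0) (.inl v)) :
    S.attach.petal (.inr 0) ⟨.inl v, h⟩ = (⋃ i, S.part i)ᶜ := by
  rw [petal_eq_edgeSide (T := S.attach) h, S.edgeSide_attach_link]

theorem petal_attach_leaf {i : Fin (N + 1)} (hi : i ≠ 0)
    (h : (T.graph.attachStar v N).Adj (.inr 0) (.inr i)) :
    S.attach.petal (.inr 0) ⟨.inr i, h⟩ = S.part i := by
  rw [petal_eq_edgeSide (T := S.attach) h, S.edgeSide_attach_leaf hi]

variable {C : ConnectivitySystem E} {k : ℕ} {𝒯 𝒮 : Set (Set E)}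

theorem petals_attach {w : V} (hw : w ≠ v) {n : ℕ} (e : Fin n ≃ T.graph.neighborSet w) :
    S.attach.petals (.inl w) (e.trans (SimpleGraph.attachStarNeighborEquiv T.graph N hw)) =
      T.petals w e :=
  funext fun i => S.petal_attach hw (e i)

theorem displayed_subset_attach : T.displayed C k 𝒯 ⊆ S.attach.displayed C k 𝒯 := by
  rintro X ⟨hk, ⟨u, w, huw, rfl⟩ | ⟨w, hw, n, e, hf, hX⟩⟩
  · exact ⟨hk, Or.inl ⟨.inl u, .inl w, huw, (S.edgeSide_attach u w).symm⟩⟩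
  · have hwv : w ≠ v := by
      rintro rfl
      exact hw ⟨_, S.hasBag⟩
    rw [← S.petals_attach hwv] at hf hX
    exact ⟨hk, Or.inr ⟨.inl w, fun h => hw (S.isBagVertex_attach_iff.1 h), n, _, hf, hX⟩⟩

end StarData

variable {C : ConnectivitySystem E} {k : ℕ} {𝒯 𝒮 : Set (Set E)}

theorem Conforms.of_sepEquiv {T : LabelledTree E V} {X Y : Set E} (h : T.Conforms C k 𝒯 Y)
    (hXY : C.SepEquiv k 𝒯 X Y) : T.Conforms C k 𝒯 X := by
  rcases h with ⟨A, hA, hYA⟩ | ⟨A, hYA, hA⟩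
  · exact Or.inl ⟨A, hA, hXY.trans hYA⟩
  · exact Or.inr ⟨A, hXY.trans hYA, hA⟩

/-- Old edges and old flower vertices inherit their conditions from `T`. What remains to be supplied
concerns the new edges, the centre, and the separations inside the bag that is being broken up. -/
theorem StarData.isPartialTree_attach {T : LabelledTree E V} {v : V} {N : ℕ} (S : T.StarData v N)
    (h𝒮 : C.IsTreeCompatible k 𝒯 𝒮) (hT : T.IsPartialTree C k 𝒯 𝒮)
    (hlink : C.IsStrongSep k 𝒯 (⋃ i, S.part i))
    (hleaf : ∀ i, i ≠ 0 → C.IsStrongSep k 𝒯 (S.part i))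
    (hbag : ∀ B, S.centre = .bag B →
      C.IsSSep k 𝒮 (⋃ i, S.part i) ∧ ∀ i, i ≠ 0 → C.IsSSep k 𝒮 (S.part i))
    (hA : S.centre = .A → ∃ (n : ℕ) (e : Fin n ≃ S.attach.graph.neighborSet (.inr 0)),
      C.IsAnemone k 𝒯 (S.attach.petals _ e) ∧ 3 ≤ C.sOrder k 𝒯 𝒮 (S.attach.petals _ e) ∧
        ∀ i, ¬ C.IsLoosePetal k 𝒯 (S.attach.petals _ e) i)
    (hD : ∀ (n : ℕ) (e : Fin n ≃ S.attach.graph.neighborSet (.inr 0)), S.centre = .D n e →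
      C.IsDaisy k 𝒯 (S.attach.petals _ e) ∧ 3 ≤ C.sOrder k 𝒯 𝒮 (S.attach.petals _ e) ∧
        ∀ i, ¬ C.IsLoosePetal k 𝒯 (S.attach.petals _ e) i)
    (hconf : ∀ X, C.IsSSep k 𝒮 X → X ⊆ S.bag ∪ ⋃ i, S.part i → S.attach.Conforms C k 𝒯 X) :
    S.attach.IsPartialTree C k 𝒯 𝒮 where
  edge_strong := by
    rintro (u | i) (w | j) h
    · rw [S.edgeSide_attach]
      exact hT.edge_strong u w h
    · obtain ⟨rfl, rfl⟩ := h
      rw [S.edgeSide_attach_link]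
      exact hlink.compl
    · rw [edgeSide_swap h.symm]
      obtain ⟨rfl, rfl⟩ := h
      rw [S.edgeSide_attach_link]
      exact hlink.compl.compl
    · have h' := h
      rcases h with ⟨rfl, h⟩ | ⟨rfl, h⟩
      · rw [edgeSide_swap h'.symm, S.edgeSide_attach_leaf h]
        exact (hleaf j h).compl
      · rw [S.edgeSide_attach_leaf h]
        exact hleaf i h
  edge_bags := by
    rintro (u | i) (w | j) h hu hw
    · rw [S.edgeSide_attach]
      exact hT.edge_bags u w h (S.isBagVertex_attach_iff.1 hu) (S.isBagVertex_attach_iff.1 hw)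
    · obtain ⟨rfl, rfl⟩ := h
      obtain ⟨B, hB⟩ := hw
      rw [S.edgeSide_attach_link]
      exact (hbag B hB).1.compl
    · rw [edgeSide_swap h.symm]
      obtain ⟨rfl, rfl⟩ := h
      obtain ⟨B, hB⟩ := hu
      rw [S.edgeSide_attach_link]
      exact (hbag B hB).1.compl.compl
    · have h' := h
      rcases h with ⟨rfl, h⟩ | ⟨rfl, h⟩
      · obtain ⟨B, hB⟩ := hu
        rw [edgeSide_swap h'.symm, S.edgeSide_attach_leaf h]
        exact ((hbag B hB).2 j h).compl
      · obtain ⟨B, hB⟩ := hw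
        rw [S.edgeSide_attach_leaf h]
        exact (hbag B hB).2 i h
  anemone := by
    rintro (w | i) h
    · have hw : w ≠ v := by
        rintro rfl
        rw [show S.attach.label (.inl w) = _ from S.label_inl_self] at h
        cases h
      have hl : T.label w = .A := by
        rw [show S.attach.label (.inl w) = _ from S.label_inl_of_ne hw] at h
        generalize T.label w = l at h
        cases l <;> first | rfl | cases h
      obtain ⟨n, e, h1⟩ := hT.anemone w hl
      rw [← S.petals_attach hw] at h1
      exact ⟨n, _, h1⟩
    · by_cases hi : i = 0
      · subst hi
        exact hA h
      · rw [show S.attach.label (.inr i) = _ from S.label_leaf hi] at h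
        cases h
  daisy := by
    rintro (w | i) n e h
    · have hw : w ≠ v := by
        rintro rfl
        rw [show S.attach.label (.inl w) = _ from S.label_inl_self] at h
        cases h
      obtain ⟨e', hl, rfl⟩ : ∃ e', T.label w = .D n e' ∧
          e = e'.trans (SimpleGraph.attachStarNeighborEquiv T.graph N hw) := by
        rw [show S.attach.label (.inl w) = _ from S.label_inl_of_ne hw] at h
        generalize T.label w = l at h
        cases l with
        | bag B => cases h
        | A => cases h
        | D m o =>
          cases h
          exact ⟨o, rfl, rfl⟩
      have h1 := hT.daisy w n e' hl
      rw [← S.petals_attach hw] at h1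
      exact h1
    · by_cases hi : i = 0
      · subst hi
        exact hD n e h
      · rw [show S.attach.label (.inr i) = _ from S.label_leaf hi] at h
        cases h
  conforms := by
    intro X hX
    rcases hT.conforms X hX with ⟨Y, hY, hXY⟩ | ⟨Y, hXY, w, B, hw, hYB⟩
    · exact Or.inl ⟨Y, S.displayed_subset_attach hY, hXY⟩
    · by_cases hwv : w = v
      · subst hwv
        have hB : B = S.bag ∪ ⋃ i, S.part i := by
          have := hw.symm.trans S.hasBag
          injection this
        have hY := h𝒮.isSSep_of_sepEquiv hX hXY
        subst hB
        rcases hYB with h | h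
        · exact (hconf Y hY h).of_sepEquiv hXY
        · exact (hconf _ hY.compl h).of_sepEquiv hXY.compl_right
      · exact Or.inr ⟨Y, hXY, .inl w, B, (S.hasBag_attach_iff hwv).2 hw, hYB⟩

end Attach

end LabelledTree

namespace ConnectivitySystem

/-! ### Rotating an optimal flower -/

section Rotation

variable {E : Type*} {C : ConnectivitySystem E} {k : ℕ} {𝒯 𝒮 : Set (Set E)}

theorem saturated_comp_equiv {ι κ : Type*} {P : ι → Set E} (e : κ ≃ ι) {Y : Set E} :
    Saturated (P ∘ e) Y ↔ Saturated P Y :=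
  (e.surjective.forall (p := fun i => P i ⊆ Y ∨ Disjoint (P i) Y)).symm

theorem displayedUpTo_comp_equiv {n : ℕ} {P : Fin n → Set E} (e : Fin n ≃ Fin n) :
    C.displayedUpTo k 𝒯 𝒮 (P ∘ e) = C.displayedUpTo k 𝒯 𝒮 P := by
  unfold displayedUpTo
  simp only [saturated_comp_equiv]

theorem IsOptimal.exists_rotate {Z : Set E} {m : ℕ} {P : Fin (m + 1) → Set E}
    (h : C.IsOptimal k 𝒯 𝒮 Z P) : ∃ P' : Fin (m + 1) → Set E, C.IsOptimal k 𝒯 𝒮 Z P' ∧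
      Z ⊆ P' 0 ∧ C.displayedUpTo k 𝒯 𝒮 P' = C.displayedUpTo k 𝒯 𝒮 P := by
  obtain ⟨i, hi⟩ := h.exists_subset
  have hD := displayedUpTo_comp_equiv (C := C) (k := k) (𝒯 := 𝒯) (𝒮 := 𝒮) (P := P)
    (Equiv.addRight i)
  have h0 : Z ⊆ (P ∘ Equiv.addRight i) 0 := by simpa using hi
  refine ⟨P ∘ Equiv.addRight i, ⟨h.flower.reindex (h.flower.rotate i), ⟨0, h0⟩, ?_⟩, h0, hD⟩
  rw [hD]
  exact h.optimal

theorem IsFlower.sOrder_le (h𝒮 : C.IsTreeCompatible k 𝒯 𝒮) {n : ℕ} {P : Fin n → Set E}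
    (hP : C.IsFlower k 𝒯 P) : C.sOrder k 𝒯 𝒮 P ≤ n :=
  have h : C.DisplayLE k 𝒯 𝒮 (C.flowerDisplayed k P) (C.flowerDisplayed k P) :=
    fun X hX hS => ⟨X, hX, hS, h𝒮.sepEquiv_refl hS⟩
  Nat.sInf_le ⟨P, hP, h, h⟩

end Rotation

end ConnectivitySystem

namespace LabelledTree

open ConnectivitySystem

/-! ### The complement of a bag -/

section Bags

variable {E V : Type*} {T : LabelledTree E V} {C : ConnectivitySystem E} {k : ℕ}
  {𝒯 𝒮 : Set (Set E)}

/-- The side away from the petal at `v` contains the next petal, which would otherwise be loose. -/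
theorem not_edgeSide_subset_fcl_of_flower {v w : V} (h : T.graph.Adj w v) {n : ℕ}
    {e : Fin n ≃ T.graph.neighborSet w} (hP : C.IsFlower k 𝒯 (T.petals w e)) (hn : 2 ≤ n)
    (hl : ∀ i, ¬ C.IsLoosePetal k 𝒯 (T.petals w e) i) :
    ¬ T.edgeSide w v ⊆ C.fcl k 𝒯 (T.edgeSide w v)ᶜ := by
  intro hsub
  obtain ⟨m, rfl⟩ := Nat.exists_eq_add_of_le' hn
  obtain ⟨i, hi⟩ := e.surjective ⟨v, h⟩
  have hPi : T.petals w e i = (T.edgeSide w v)ᶜ := by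
    rw [petals, hi, petal_eq_edgeSide h, edgeSide_swap h]
  have hne : i ≠ i + 1 := by simp
  refine hl (i + 1) ⟨i, hne, Or.inr (Or.inl (cyclicNext_iff_eq_add_one.2 rfl)), ?_⟩
  rw [hPi]
  refine Set.Subset.trans ?_ hsub
  rw [← compl_compl (T.edgeSide w v), ← hPi]
  exact Set.subset_compl_iff_disjoint_left.2 (hP.disjoint hne)

/-- If `w` is a bag vertex, the edge displays a `(k, 𝒮)`-separation and the inclusion would make its
side sequential. If `w` is a flower vertex, there would be a loose petal. -/
theorem IsPartialTree.not_edgeSide_subset_fcl (hT : T.IsPartialTree C k 𝒯 𝒮)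
    (h𝒮 : C.IsTreeCompatible k 𝒯 𝒮) {v w : V} (hv : T.IsBagVertex v) (h : T.graph.Adj w v) :
    ¬ T.edgeSide w v ⊆ C.fcl k 𝒯 (T.edgeSide w v)ᶜ := by
  cases hl : T.label w with
  | bag B =>
    intro hsub
    refine h𝒮.fcl_compl_ne_univ (hT.edge_bags w v h ⟨B, hl⟩ hv) (Set.eq_univ_of_univ_subset ?_)
    rw [← Set.union_compl_self (T.edgeSide w v)]
    exact Set.union_subset hsub (subset_fcl _)
  | A =>
    obtain ⟨n, e, h1, h2, h3⟩ := hT.anemone w hl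
    exact not_edgeSide_subset_fcl_of_flower h h1.flower
      (by have := h1.flower.sOrder_le h𝒮; omega) h3
  | D n e =>
    obtain ⟨h1, h2, h3⟩ := hT.daisy w n e hl
    exact not_edgeSide_subset_fcl_of_flower h h1.flower
      (by have := h1.flower.sOrder_le h𝒮; omega) h3

/-- The complement of a bag is either empty or a strong set outside the full closure of the bag. -/
theorem IsPartialTree.compl_bag (hT : T.IsPartialTree C k 𝒯 𝒮) (h𝒮 : C.IsTreeCompatible k 𝒯 𝒮)
    {v : V} {B : Set E} (hv : T.HasBag v B) :
    Bᶜ = ∅ ∨ IsStrong 𝒯 Bᶜ ∧ ¬ Bᶜ ⊆ C.fcl k 𝒯 B := by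
  have hB : (T.label v).content = B := by
    rw [show T.label v = _ from hv]
    rfl
  rw [or_iff_not_imp_left, ← ne_eq, ← Set.nonempty_iff_ne_empty]
  rintro ⟨e, he⟩
  obtain ⟨x, hx⟩ := T.exists_mem_content e
  -- Something lies outside the bag, so `v` has a neighbour `w`; the far side of that edge is a
  -- strong part of `Bᶜ`.
  obtain ⟨w, hw⟩ : ∃ w, T.graph.Adj w v := by
    by_contra hno
    push Not at hno
    have : x = v := (T.isTree.connected v x).mem_of_closed (S := {v})
      (fun a b hab ha => absurd (ha ▸ hab.symm) (hno b)) rfl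
    rw [this, hB] at hx
    exact he hx
  have hsub : T.edgeSide w v ⊆ Bᶜ := by
    intro f hf hfB
    rw [← hB] at hfB
    exact not_reachable_of_adj hw ((T.mem_biUnion_content_iff hfB).1 hf)
  refine ⟨(hT.edge_strong w v hw).strong.mono hsub, fun hfcl => ?_⟩
  exact hT.not_edgeSide_subset_fcl h𝒮 ⟨B, hv⟩ hw
    ((hsub.trans hfcl).trans (fcl_mono (Set.subset_compl_comm.1 hsub)))

end Bags

/-! ### The extended tree is a partial tree -/

section Extension

variable {E V : Type*} [Finite E] {T : LabelledTree E V} {C : ConnectivitySystem E} {k : ℕ}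
  {𝒯 𝒮 : Set (Set E)} {v : V} {B : Set E}

/-- Every separation inside the bag `B` that has a side within the petal containing the complement
of `B` is displayed by the flower `P` or by the tree `T`. -/
def Complements (T : LabelledTree E V) (C : ConnectivitySystem E) (k : ℕ) (𝒯 𝒮 : Set (Set E))
    (B : Set E) {n : ℕ} (P : Fin n → Set E) : Prop :=
  ∀ (U : Set E) (i : Fin n), C.IsSSep k 𝒮 U → U ⊆ B → Bᶜ.Nonempty → Bᶜ ⊆ P i → Uᶜ ⊆ P i →
    U ∈ C.displayedUpTo k 𝒯 𝒮 P ∨ ∃ Y ∈ T.displayed C k 𝒯, C.SepEquiv k 𝒯 U Y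

/-- Optimality leaves only separations with a side in a petal. A side in both `B` and a petal fits
into a new bag; the case where only the other side fits is the purpose of `Complements`. -/
theorem StarData.conforms_attach {N : ℕ} (S : T.StarData v N) (hR : C.IsRobustTangle k 𝒯)
    (h𝒮 : C.IsTreeCompatible k 𝒯 𝒮) (hT : T.IsPartialTree C k 𝒯 𝒮) (hv : T.HasBag v B) {n : ℕ}
    {P : Fin n → Set E} (hP : C.IsOptimal k 𝒯 𝒮 Bᶜ P) (hn : 2 ≤ n)
    (hc : T.Complements C k 𝒯 𝒮 B P)
    (hd : ∀ U ∈ C.displayedUpTo k 𝒯 𝒮 P, ∃ Y ∈ S.attach.displayed C k 𝒯, C.SepEquiv k 𝒯 U Y)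
    (hb : ∀ i, ∃ x A, S.attach.HasBag x A ∧ P i ∩ B ⊆ A) {X : Set E} (hX : C.IsSSep k 𝒮 X)
    (hXB : X ⊆ B) : S.attach.Conforms C k 𝒯 X := by
  have hZ := hT.compl_bag h𝒮 hv
  rcases hP.conforms hn hR h𝒮 (hZ.imp_right And.left) hX
    (Set.disjoint_compl_left_iff_subset.2 hXB) with h | ⟨U, hXU, hU, i, hi⟩
  · exact Or.inl (hd X h)
  · rw [Set.disjoint_compl_left_iff_subset] at hU
    obtain ⟨x, A, hx, hA⟩ := hb i
    rcases hi with hi | hi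
    · exact Or.inr ⟨U, hXU, x, A, hx, Or.inl ((Set.subset_inter hi hU).trans hA)⟩
    -- If `B` is all of `E`, the complementary side also lies in `P i ∩ B`, hence in a bag.
    · rcases Bᶜ.eq_empty_or_nonempty with hB | hB
      · rw [Set.compl_empty_iff] at hB
        exact Or.inr ⟨U, hXU, x, A, hx,
          Or.inr ((Set.subset_inter hi (hB ▸ Set.subset_univ _)).trans hA)⟩
      · rcases hc U i (h𝒮.isSSep_of_sepEquiv hX hXU) hU hB
          ((Set.compl_subset_compl.2 hU).trans hi) hi with h | ⟨Y, hY, hUY⟩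
        · obtain ⟨Y, hY, hUY⟩ := hd U h
          exact Or.inl ⟨Y, hY, hXU.trans hUY⟩
        · exact Or.inl ⟨Y, S.displayed_subset_attach hY, hXU.trans hUY⟩

theorem exists_attach_of_two (hR : C.IsRobustTangle k 𝒯)
    (h𝒮 : C.IsTreeCompatible k 𝒯 𝒮) (hT : T.IsPartialTree C k 𝒯 𝒮) (hv : T.HasBag v B)
    {P : Fin 2 → Set E} (hP : C.IsOptimal k 𝒯 𝒮 Bᶜ P) (h0 : Bᶜ ⊆ P 0)
    (hc : T.Complements C k 𝒯 𝒮 B P) (hne : (C.displayedUpTo k 𝒯 𝒮 P).Nonempty) :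
    ∃ (N : ℕ) (S : T.StarData v N), S.attach.IsPartialTree C k 𝒯 𝒮 ∧
      ∀ U ∈ C.displayedUpTo k 𝒯 𝒮 P, ∃ Y ∈ S.attach.displayed C k 𝒯, C.SepEquiv k 𝒯 U Y := by
  have hF := hP.flower.toIsFlower
  have h01 : Disjoint (P 0) (P 1) := hF.disjoint (by decide)
  have hcov : P 0 ∪ P 1 = Set.univ := by
    rw [← hF.cover]
    ext x
    simp [Fin.exists_fin_two]
  have h1B : P 1 ⊆ B :=
    Set.compl_subset_compl.1 (h0.trans (Set.subset_compl_iff_disjoint_right.2 h01))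
  have hBe : B ∩ P 0 ∪ ⋃ _ : Fin 1, P 1 = B := by
    rw [Set.iUnion_const]
    ext x
    have hx : x ∈ P 0 ∪ P 1 := hcov ▸ Set.mem_univ x
    have := @h1B x
    simp only [Set.mem_union, Set.mem_inter_iff] at hx ⊢
    tauto
  have hsat : Saturated P (P 1) := saturated_part hF.disjoint 1
  have heq : ∀ Y, Saturated P Y → C.IsSSep k 𝒮 Y → Y = P 1 ∨ Y = (P 1)ᶜ := fun Y hY hS =>
    hY.eq_or_eq_compl le_rfl hF.cover hsat (hS.nonempty h𝒮) (hS.compl.nonempty h𝒮)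
      (hP.flower.nonempty 1) ((hP.flower.nonempty 0).mono
        (Set.subset_compl_iff_disjoint_right.2 h01))
  have hS1 : C.IsSSep k 𝒮 (P 1) := by
    obtain ⟨X, hX, Y, hY, hXY⟩ := hne
    have hYS := h𝒮.isSSep_of_sepEquiv hX hXY
    rcases heq Y hY hYS with rfl | rfl
    · exact hYS
    · simpa using hYS.compl
  -- The star degenerates to a single new bag vertex, its centre, holding `P 1`.
  let S : T.StarData v 0 :=
    { bag := B ∩ P 0
      part := fun _ => P 1
      centre := .bag (P 1)
      content_centre := rfl
      hasBag := by rw [hBe]; exact hv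
      disjoint := fun i j hij => absurd (Subsingleton.elim (α := Fin 1) i j) hij
      disjoint_bag := fun _ => h01.mono_left Set.inter_subset_right }
  have hpart : ⋃ i, S.part i = P 1 := Set.iUnion_const _
  have hdisp : ∀ U ∈ C.displayedUpTo k 𝒯 𝒮 P,
      ∃ Y ∈ S.attach.displayed C k 𝒯, C.SepEquiv k 𝒯 U Y := by
    rintro U ⟨hU, Y, hY, hUY⟩
    refine ⟨(P 1)ᶜ, ⟨hS1.ksep.compl, Or.inl ⟨.inl v, .inr 0, ⟨rfl, rfl⟩, ?_⟩⟩, ?_⟩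
    · rw [S.edgeSide_attach_link, hpart]
    · rcases heq Y hY (h𝒮.isSSep_of_sepEquiv hU hUY) with rfl | rfl
      · exact hUY.compl_right
      · exact hUY
  refine ⟨0, S, S.isPartialTree_attach h𝒮 hT ?_ ?_ ?_ ?_ ?_ ?_, hdisp⟩
  · rw [hpart]
    exact h𝒮.isStrongSep hS1
  · exact fun i hi => absurd (Subsingleton.elim (α := Fin 1) i 0) hi
  · rw [hpart]
    exact fun _ _ => ⟨hS1, fun _ _ => hS1⟩
  · exact fun h => nomatch h
  · exact fun _ _ h => nomatch h
  · intro X hX hXB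
    refine S.conforms_attach hR h𝒮 hT hv hP le_rfl hc hdisp ?_ hX (hXB.trans hBe.subset)
    rw [Fin.forall_fin_two]
    exact ⟨⟨.inl v, _, S.hasBag_attach_self, (Set.inter_comm _ _).subset⟩,
      ⟨.inr 0, P 1, rfl, Set.inter_subset_left⟩⟩

/-- The centre becomes a flower vertex whose displayed partition is exactly `P`: the petal towards
the old tree is `P 0`, and the leaves are the others. Optimality supplies the conditions on the
`𝒮`-order and on loose petals. -/
theorem exists_attach_of_three_le (hR : C.IsRobustTangle k 𝒯)
    (h𝒮 : C.IsTreeCompatible k 𝒯 𝒮) (hT : T.IsPartialTree C k 𝒯 𝒮) (hv : T.HasBag v B) {m : ℕ}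
    {P : Fin (m + 3) → Set E} (hP : C.IsOptimal k 𝒯 𝒮 Bᶜ P) (h0 : Bᶜ ⊆ P 0)
    (hc : T.Complements C k 𝒯 𝒮 B P) (hne : (C.displayedUpTo k 𝒯 𝒮 P).Nonempty) :
    ∃ (N : ℕ) (S : T.StarData v N), S.attach.IsPartialTree C k 𝒯 𝒮 ∧
      ∀ U ∈ C.displayedUpTo k 𝒯 𝒮 P, ∃ Y ∈ S.attach.displayed C k 𝒯, C.SepEquiv k 𝒯 U Y := by
  have hTg := hR.toIsTangle
  have hF := hP.flower.toIsFlower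
  -- Index `0` is the centre, which holds no elements; `P 0` itself is displayed by the link to the
  -- old tree.
  set part : Fin (m + 2 + 1) → Set E := fun i => if i = 0 then ∅ else P i with hpart
  have hpart0 : part 0 = ∅ := if_pos rfl
  have hparts : ∀ {i}, i ≠ 0 → part i = P i := fun hi => if_neg hi
  have hle : ∀ i, part i ⊆ P i := by
    intro i
    by_cases hi : i = 0
    · rw [hi, hpart0]
      exact Set.empty_subset _
    · rw [hparts hi]
  have hunion : ⋃ i, part i = (P 0)ᶜ := by
    ext x
    rw [Set.mem_iUnion, Set.mem_compl_iff]
    constructor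
    · rintro ⟨i, hi⟩ hx
      have := hF.eq_of_mem (hle i hi) hx
      rw [this, hpart0] at hi
      exact hi
    · intro hx
      obtain ⟨i, hi⟩ := hF.exists_mem x
      refine ⟨i, ?_⟩
      rw [hparts]
      · exact hi
      · rintro rfl
        exact hx hi
  have hBe : B ∩ P 0 ∪ ⋃ i, part i = B := by
    rw [hunion]
    ext x
    have := @h0 x
    simp only [Set.mem_union, Set.mem_inter_iff, Set.mem_compl_iff] at this ⊢
    tauto
  obtain ⟨c, hcA⟩ : ∃ c : VertexLabel E ((T.graph.attachStar v (m + 2)).neighborSet (.inr 0)),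
      (c = .A ∧ C.IsAnemone k 𝒯 P) ∨
        (c = .D _ (T.graph.attachStarCentreEquiv v (m + 2)) ∧ C.IsDaisy k 𝒯 P) := by
    rcases hF.isAnemone_or_isDaisy hTg with h | h
    · exact ⟨_, Or.inl ⟨rfl, h⟩⟩
    · exact ⟨_, Or.inr ⟨rfl, h⟩⟩
  have hcB : ∀ A, c ≠ .bag A := by
    rintro A rfl
    rcases hcA with ⟨h, -⟩ | ⟨h, -⟩ <;> cases h
  let S : T.StarData v (m + 2) :=
    { bag := B ∩ P 0
      part := part
      centre := c
      content_centre := by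
        rw [hpart0]
        rcases hcA with ⟨rfl, -⟩ | ⟨rfl, -⟩ <;> rfl
      hasBag := by rw [hBe]; exact hv
      disjoint := fun i j hij => (hF.disjoint hij).mono (hle i) (hle j)
      disjoint_bag := fun i => by
        refine Set.disjoint_of_subset Set.inter_subset_right (Set.subset_iUnion part i) ?_
        rw [hunion]
        exact disjoint_compl_right }
  have hSpart : ⋃ i, S.part i = (P 0)ᶜ := hunion
  have hpet : S.attach.petals (.inr 0) (T.graph.attachStarCentreEquiv v (m + 2)) = P := by
    funext i
    induction i using Fin.cases with
    | zero =>
      refine (S.petal_attach_link _).trans ?_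
      rw [hSpart, compl_compl]
    | succ i => exact (S.petal_attach_leaf i.succ_ne_zero _).trans (hparts i.succ_ne_zero)
  have hgood : ∀ Q : Fin (m + 3) → Set E, Q = P →
      3 ≤ C.sOrder k 𝒯 𝒮 Q ∧ ∀ i, ¬ C.IsLoosePetal k 𝒯 Q i := by
    rintro Q rfl
    refine ⟨hP.three_le_sOrder h𝒮 (by omega) hne, ?_⟩
    rintro i ⟨j, hji, hij, hsub⟩
    exact hP.not_subset_fcl hTg h𝒮 ⟨hji.symm, hij⟩ hsub
  have hdisp : ∀ U ∈ C.displayedUpTo k 𝒯 𝒮 P,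
      ∃ Y ∈ S.attach.displayed C k 𝒯, C.SepEquiv k 𝒯 U Y := by
    rintro U ⟨hU, Y, hY, hUY⟩
    have hYk := (h𝒮.isSSep_of_sepEquiv hU hUY).ksep
    refine ⟨Y, ⟨hYk, Or.inr ⟨.inr 0, fun ⟨A, hA⟩ => hcB A hA, m + 3,
      T.graph.attachStarCentreEquiv v (m + 2), ?_⟩⟩, hUY⟩
    have : ∀ Q : Fin (m + 3) → Set E, Q = P → C.IsFlower k 𝒯 Q ∧ Y ∈ C.flowerDisplayed k Q := by
      rintro Q rfl
      exact ⟨hF, (mem_flowerDisplayed_iff hF).2 ⟨hYk, hY⟩⟩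
    exact this _ hpet
  have hstrong : ∀ i, C.IsStrongSep k 𝒯 (P i) := fun i =>
    ⟨hF.ksep i, hF.strong i, IsProperFlower.isStrong_compl hF
      (show i ≠ i + 1 by simp) subset_rfl⟩
  refine ⟨_, S, S.isPartialTree_attach h𝒮 hT ?_ ?_ ?_ ?_ ?_ ?_, hdisp⟩
  · rw [hSpart]
    exact (hstrong 0).compl
  · intro i hi
    rw [show S.part i = P i from hparts hi]
    exact hstrong i
  · exact fun A hA => absurd hA (hcB A)
  · intro hA
    rcases id hcA with ⟨-, h⟩ | ⟨h, -⟩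
    · refine ⟨m + 3, T.graph.attachStarCentreEquiv v (m + 2), ?_, hgood _ hpet⟩
      have : ∀ Q : Fin (m + 3) → Set E, Q = P → C.IsAnemone k 𝒯 Q := by
        rintro Q rfl
        exact h
      exact this _ hpet
    · cases h.symm.trans hA
  · intro n e hD
    rcases id hcA with ⟨h, -⟩ | ⟨h, h'⟩
    · cases h.symm.trans hD
    · cases h.symm.trans hD
      have : ∀ Q : Fin (m + 3) → Set E, Q = P → C.IsDaisy k 𝒯 Q := by
        rintro Q rfl
        exact h'
      exact ⟨this _ hpet, hgood _ hpet⟩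
  · intro X hX hXB
    refine S.conforms_attach hR h𝒮 hT hv hP (by omega) hc hdisp ?_ hX (hXB.trans hBe.subset)
    intro i
    by_cases hi : i = 0
    · subst hi
      exact ⟨.inl v, _, S.hasBag_attach_self, (Set.inter_comm _ _).subset⟩
    · refine ⟨.inr i, _, S.hasBag_attach_leaf hi, ?_⟩
      rw [show S.part i = P i from hparts hi]
      exact Set.inter_subset_left

end Extension

/-! ### The effect of a largest full closure -/

section Complements

variable {E V : Type*} [Finite E] {T : LabelledTree E V} {C : ConnectivitySystem E} {k : ℕ}
  {𝒯 𝒮 : Set (Set E)} {B : Set E}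

/-- A flower complements the tree if it displays an undisplayed separation inside the bag `B` with a
full closure of maximal size. -/
theorem complements_of_maximal (hR : C.IsTangle k 𝒯) (h𝒮 : C.IsTreeCompatible k 𝒯 𝒮)
    (hB : Bᶜ.Nonempty → ¬ Bᶜ ⊆ C.fcl k 𝒯 B) {X : Set E} (hXB : X ⊆ B)
    (hmax : ∀ U, C.IsSSep k 𝒮 U → U ⊆ B →
      (∀ Y ∈ T.displayed C k 𝒯, ¬ C.SepEquiv k 𝒯 U Y) →
        (C.fcl k 𝒯 U).ncard ≤ (C.fcl k 𝒯 X).ncard)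
    {n : ℕ} {P : Fin n → Set E} (hX : X ∈ C.displayedUpTo k 𝒯 𝒮 P) :
    T.Complements C k 𝒯 𝒮 B P := by
  intro U i hU hUB hne hBi hUi
  obtain ⟨hXS, Y, hY, hXY⟩ := hX
  rw [or_iff_not_imp_right]
  intro hund
  push Not at hund
  -- Equivalence matches full closures only as unordered pairs; pass to the displayed side whose
  -- full closure is that of `X`.
  obtain ⟨W, hW, hXW, hfcl⟩ : ∃ W, Saturated P W ∧ C.SepEquiv k 𝒯 X W ∧
      C.fcl k 𝒯 X = C.fcl k 𝒯 W := by
    rcases hXY.fcl_eq_or with h | h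
    · exact ⟨Y, hY, hXY, h⟩
    · exact ⟨Yᶜ, hY.compl, hXY.compl_right, h⟩
  -- If `W` contained `P i`, then `Bᶜ ⊆ fcl W = fcl X ⊆ fcl B`, which is excluded. Hence `W ⊆ (P i)ᶜ
  -- ⊆ U`.
  have hdisj : Disjoint (P i) W := by
    refine (hW i).resolve_left fun h => hB hne ?_
    exact ((hBi.trans h).trans (subset_fcl W)).trans (hfcl.symm.subset.trans (fcl_mono hXB))
  have hWU : W ⊆ U := Set.compl_subset_compl.1
    (hUi.trans (Set.subset_compl_iff_disjoint_right.2 hdisj))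
  have hWS := h𝒮.isSSep_of_sepEquiv hXS hXW
  -- Maximality of `fcl X = fcl W` turns the inclusion into equality, so `U` lies between `W` and
  -- `fcl W` and is equivalent to it.
  have heq : C.fcl k 𝒯 W = C.fcl k 𝒯 U :=
    Set.eq_of_subset_of_ncard_le (fcl_mono hWU) (hfcl ▸ hmax U hU hUB hund)
  refine ⟨hU, W, hW, SepEquiv.symm ?_⟩
  exact sepEquiv_of_subset_fcl hR (h𝒮.isStrongSep hWS) (h𝒮.fcl_ne_univ hWS) hWU
    (heq ▸ subset_fcl U) hU.ksep

end Complements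

end LabelledTree

/-! ### The main theorem -/

open ConnectivitySystem in
theorem theorem6p1 {E : Type*} [Finite E] (C : ConnectivitySystem E) (k : ℕ) (hk : 0 < k)
    (𝒯 : Set (Set E)) (h𝒯 : C.IsRobustTangle k 𝒯)
    (𝒮 : Set (Set E)) (h𝒮 : C.IsTreeCompatible k 𝒯 𝒮)
    {V : Type*} [Finite V] (T : LabelledTree E V) (hT : T.IsMaximalPartialTree C k 𝒯 𝒮) :
    ∀ X : Set E, C.IsSSep k 𝒮 X →
      ∃ Y ∈ T.displayed C k 𝒯, C.IsSSep k 𝒮 Y ∧ C.SepEquiv k 𝒯 X Y := by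
  intro X₀ hX₀
  by_contra hcon
  have hund₀ : ∀ Y ∈ T.displayed C k 𝒯, ¬ C.SepEquiv k 𝒯 X₀ Y := fun Y hY h =>
    hcon ⟨Y, hY, h𝒮.isSSep_of_sepEquiv hX₀ h, h⟩
  have hpt := hT.isPartialTree
  obtain ⟨v, B, hv, X₁, hX₁, hX₁B, hund₁⟩ : ∃ v B, T.HasBag v B ∧ ∃ X, C.IsSSep k 𝒮 X ∧ X ⊆ B ∧
      ∀ Y ∈ T.displayed C k 𝒯, ¬ C.SepEquiv k 𝒯 X Y := by
    rcases hpt.conforms X₀ hX₀ with ⟨Y, hY, h⟩ | ⟨Y, hXY, v, B, hv, hYB⟩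
    · exact absurd h (hund₀ Y hY)
    · have hYS := h𝒮.isSSep_of_sepEquiv hX₀ hXY
      rcases hYB with h | h
      · exact ⟨v, B, hv, Y, hYS, h, fun W hW hYW => hund₀ W hW (hXY.trans hYW)⟩
      · exact ⟨v, B, hv, Yᶜ, hYS.compl, h, fun W hW hYW =>
          hund₀ W hW (hXY.compl_right.trans hYW)⟩
  -- The largest full closure is what later handles separations whose other side lies in the petal
  -- containing `Bᶜ`.
  obtain ⟨X, ⟨hX, hXB, hund⟩, hmax⟩ := Set.exists_max_image
    {U | C.IsSSep k 𝒮 U ∧ U ⊆ B ∧ ∀ Y ∈ T.displayed C k 𝒯, ¬ C.SepEquiv k 𝒯 U Y}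
    (fun U => (C.fcl k 𝒯 U).ncard) (Set.toFinite _) ⟨X₁, hX₁, hX₁B, hund₁⟩
  have hpair := isProperFlower_pair h𝒮 hX
  -- Optimise from the flower `(X, Xᶜ)`, whose second petal contains `Bᶜ`.
  obtain ⟨n, P, hP, hle⟩ := exists_isOptimal (𝒮 := 𝒮) (Z := Bᶜ) hpair
    ⟨1, Set.compl_subset_compl.2 hXB⟩
  have hXP : X ∈ C.displayedUpTo k 𝒯 𝒮 P :=
    hle ⟨hX, X, saturated_part hpair.disjoint 0, h𝒮.sepEquiv_refl hX⟩
  obtain ⟨m, rfl⟩ := Nat.exists_eq_add_of_le' (hP.two_le h𝒮 ⟨X, hXP⟩)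
  obtain ⟨Q, hQ, hQ0, hQP⟩ := hP.exists_rotate
  rw [← hQP] at hXP
  have hc : T.Complements C k 𝒯 𝒮 B Q :=
    LabelledTree.complements_of_maximal h𝒯.toIsTangle h𝒮
      (fun hne => ((hpt.compl_bag h𝒮 hv).resolve_left hne.ne_empty).2) hXB
      (fun U h1 h2 h3 => hmax U ⟨h1, h2, h3⟩) hXP
  obtain ⟨N, S, hS, hdisp⟩ : ∃ (N : ℕ) (S : T.StarData v N), S.attach.IsPartialTree C k 𝒯 𝒮 ∧
      ∀ U ∈ C.displayedUpTo k 𝒯 𝒮 Q, ∃ Y ∈ S.attach.displayed C k 𝒯, C.SepEquiv k 𝒯 U Y := by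
    cases m with
    | zero => exact LabelledTree.exists_attach_of_two h𝒯 h𝒮 hpt hv hQ hQ0 hc ⟨X, hXP⟩
    | succ m => exact LabelledTree.exists_attach_of_three_le h𝒯 h𝒮 hpt hv hQ hQ0 hc ⟨X, hXP⟩
  obtain ⟨Y, hY, hXY⟩ := hdisp X hXP
  -- The extended tree displays all that `T` does, so by maximality `T` displays a separation
  -- equivalent to `Y`, hence to `X`.
  obtain ⟨W, hW, -, hYW⟩ := hT.maximal _ S.attach hS
    (fun A hA hAS => ⟨A, S.displayed_subset_attach hA, hAS, h𝒮.sepEquiv_refl hAS⟩) Y hY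
    (h𝒮.isSSep_of_sepEquiv hX hXY)
  exact hund W hW (hXY.trans hYW)
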